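/- **Setting.** $\hat E_f$ is the set of fuzzy numbers $z:\mathbb R\to[0,1]$ (normal, fuzzy convex, upper semicontinuous, compactly supported) whose level sets $[z]^r=[\underline z_r,\overline z_r]$, $0\le r\le 1$, depend continuously on $r$ for the Hausdorff distance $d_H$. Sums and scalar multiples are taken levelwise, and $\mathbb D(p,q)=\sup_{r}d_H([p]^r,[q]^r)$. The Hukuhara difference $p\ominus q$ is the $w$ with $p=q+w$; the generalized difference $p\ominus_{gH}q$ is the $w$ with (i) $p=q+w$ or (ii) $q=p+(-1)w$. Let $a,b>0$, $\Omega=(0,a]\times(0,b]$, $\varphi,\psi\in(0,1)^2$, $\rho=(\rho_1,\rho_2)$ with $\rho_1,\rho_2>0$. The mixed Katugampola integral is $$\mathfrak I^{\varphi,\rho}\mu(x,y)=\frac{\rho_1^{1-\varphi_1}\rho_2^{1-\varphi_2}}{\Gamma(\varphi_1)\Gamma(\varphi_2)}\int_0^x\!\!\int_0^y\frac{s^{\rho_1-1}t^{\rho_2-1}\,\mu(s,t)}{(x^{\rho_1}-s^{\rho_1})^{1-\varphi_1}(y^{\rho_2}-t^{\rho_2})^{1-\varphi_2}}\,dt\,ds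 ,$$ and for fuzzy-valued functions it is taken on the end points of every level set. Put $\mathfrak D^{\varphi,\rho}g=x^{1-\rho_1}y^{1-\rho_2}\,\partial^2_{xy}(\mathfrak I^{1-\varphi,\rho}g)$ on $\Omega$. Here $\partial^2_{xy}U$ is the mixed $gH$-derivative: $U$ and its $gH$-derivative $\partial_xU$ are continuous on $\Omega$, $\partial_y(\partial_xU)$ exists at every point of $\Omega$, and there is no switching, i.e. each of the two differentiations is of type (i) on all of $\Omega$ or of type (ii) on all of $\Omega$. Type (i) means that the end points of the levels of the derivative are the derivatives of the lower and upper end points, in this order; type (ii) means in the reverse order. The Caputo–Katugampola derivative is ${}^C\mathfrak D^{\varphi,\rho}\upsilon=\mathfrak D^{\varphi,\rho}g$, where for $(x,y)\in\Omega$ $$g(x,y)=\big(\upsilon(x,y)+\upsilon(0,0)\big)\ominus_{gH}\big(\upsilon(x,0)+\upsilon(0,y)\big).$$ For a pair $(\upsilon,\omega)$ the difference is the one of $\hat E_f\times\hat E_f$: at each point the same clause, (i) or (ii), is used for both components. Let $\xi_1(0)=\xi_2(0)$, $\eta_1(0)=\eta_2(0)$, and suppose that the Hukuhara differences $h(x,y)=(\xi_1(x)+\xi_2(y))\ominus\xi_1(0)$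 and $\mathfrak g(x,y)=(\eta_1(x)+\eta_2(y))\ominus\eta_1(0)$ exist for $(x,y)\in[0,a]\times[0,b]$ (those of $\eta$ are needed only in 2). **1. Single problem.** Let $\upsilon:[0,a]\times[0,b]\to\hat E_f$ be continuous, $F:\Omega\times\hat E_f\to\hat E_f$, $f(x,y)=F(x,y,\upsilon(x,y))$. Consider the Darboux problem $${}^C\mathfrak D^{\varphi,\rho}\upsilon=f\ \text{ on }\Omega,\qquad \upsilon(x,0)=\xi_1(x),\quad \upsilon(0,y)=\xi_2(y)\qquad(x\in[0,a],\ y\in[0,b]).\tag{P}$$ (a) If $\mathfrak I^{\varphi,\rho}f$ exists at every point of $\Omega$ (the end points of all levels of $f$ are integrable against the kernel) and $\upsilon$ solves (P), then one of the following holds on all of $[0,a]\times[0,b]$, the integrals and differences in it existing in $\hat E_f$: $$\upsilon=h+\mathfrak I^{\varphi,\rho}f\qquad\text{or}\qquad \upsilon=h\ominus(-1)\,\mathfrak I^{\varphi,\rho}f .$$ (b) Conversely, if $f$ is continuous and bounded on $\Omega$ and one of these two equations holds on $[0,a]\times[0,b]$, then $\upsilon$ solves (P). **2. Coupled problem.**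 Let $\upsilon,\omega:[0,a]\times[0,b]\to\hat E_f$ be continuous, $F,G:\Omega\times\hat E_f\times\hat E_f\to\hat E_f$, $f(x,y)=F(x,y,\upsilon(x,y),\omega(x,y))$ and $e(x,y)=G(x,y,\upsilon(x,y),\omega(x,y))$. Consider the system ${}^C\mathfrak D^{\varphi,\rho}\upsilon=f$, ${}^C\mathfrak D^{\psi,\rho}\omega=e$ on $\Omega$ (derivatives of the pair), with $\upsilon(x,0)=\xi_1(x)$, $\upsilon(0,y)=\xi_2(y)$, $\omega(x,0)=\eta_1(x)$, $\omega(0,y)=\eta_2(y)$. (a) If $\mathfrak I^{\varphi,\rho}f$ and $\mathfrak I^{\psi,\rho}e$ exist at every point of $\Omega$ and $(\upsilon,\omega)$ solves the system, then one of the following holds on all of $[0,a]\times[0,b]$: $$\begin{cases}\upsilon=h+\mathfrak I^{\varphi,\rho}f\\ \omega=\mathfrak g+\mathfrak I^{\psi,\rho}e\end{cases}\qquad\text{or}\qquad\begin{cases}\upsilon=h\ominus(-1)\,\mathfrak I^{\varphi,\rho}f\\ \omega=\mathfrak g\ominus(-1)\,\mathfrak I^{\psi,\rho}e.\end{cases}$$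 (b) Conversely, if $f$ and $e$ are continuous and bounded on $\Omega$ and one of these two systems holds on $[0,a]\times[0,b]$, then $(\upsilon,\omega)$ solves the coupled system. -/

import Mathlib

open Set Filter Topology MeasureTheory
open scoped Pointwise

noncomputable section

/-! ### Fuzzy numbers -/

/-- A fuzzy number, given by its membership function: normal, (fuzzy) convex, upper semicontinuous
and compactly supported, with values in `[0,1]`. -/
structure IsFuzzyNumber (z : ℝ → ℝ) : Prop where
  nonneg : ∀ x, 0 ≤ z x
  le_one : ∀ x, z x ≤ 1
  normal : ∃ x, z x = 1
  convex : ∀ x₁ x₂ t : ℝ, 0 ≤ t → t ≤ 1 → min (z x₁) (z x₂) ≤ z (t * x₁ + (1 - t) * x₂)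
  usc : UpperSemicontinuous z
  compact_support : HasCompactSupport z

/-- The level set `[z]^r`; for `r = 0` it is the closure of the support. -/
def fuzzyLevel (z : ℝ → ℝ) (r : ℝ) : Set ℝ :=
  if 0 < r then {x | r ≤ z x} else closure {x | 0 < z x}

/-- The map `r ↦ [z]^r` is continuous on `[0,1]` for the Hausdorff metric. -/
def IsLevelContinuous (z : ℝ → ℝ) : Prop :=
  ∀ r ∈ Icc (0 : ℝ) 1,
    Tendsto (fun s => Metric.hausdorffDist (fuzzyLevel z s) (fuzzyLevel z r))
      (𝓝[Icc (0 : ℝ) 1] r) (𝓝 0)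

/-- The space `Ê_f` of the fuzzy numbers with continuous level map. -/
structure FuzzyNum where
  toFun : ℝ → ℝ
  isFuzzy : IsFuzzyNumber toFun
  levelCont : IsLevelContinuous toFun

lemma IsFuzzyNumber.isCompact_level {z : ℝ → ℝ} (hz : IsFuzzyNumber z) (r : ℝ) :
    IsCompact (fuzzyLevel z r) := by
  have hsub : {x | 0 < z x} ⊆ tsupport z := fun x hx =>
    subset_tsupport z (Function.mem_support.2 (ne_of_gt hx))
  unfold fuzzyLevel
  split_ifs with h
  · refine hz.compact_support.isCompact.of_isClosed_subset ?_ ?_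
    · exact upperSemicontinuous_iff_isClosed_preimage.1 hz.usc r
    · intro x hx
      exact hsub (lt_of_lt_of_le h hx)
  · exact hz.compact_support.isCompact.of_isClosed_subset isClosed_closure
      (closure_minimal hsub (isClosed_tsupport z))

lemma IsFuzzyNumber.level_nonempty {z : ℝ → ℝ} (hz : IsFuzzyNumber z) {r : ℝ} (hr : r ≤ 1) :
    (fuzzyLevel z r).Nonempty := by
  obtain ⟨x, hx⟩ := hz.normal
  refine ⟨x, ?_⟩
  unfold fuzzyLevel
  split_ifs with h
  · simpa [hx] using hr
  · exact subset_closure (by simp [hx])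

lemma exists_dist_le_hausdorffDist {A B : Set ℝ} (hA : IsCompact A) (hA' : A.Nonempty)
    (hB : IsCompact B) (hB' : B.Nonempty) {x : ℝ} (hx : x ∈ A) :
    ∃ y ∈ B, dist x y ≤ Metric.hausdorffDist A B := by
  obtain ⟨y, hy, hxy⟩ := hB.exists_infDist_eq_dist hB' x
  refine ⟨y, hy, ?_⟩
  rw [← hxy]
  exact Metric.infDist_le_hausdorffDist_of_mem hx
    (Metric.hausdorffEDist_ne_top_of_nonempty_of_bounded hA' hB' hA.isBounded hB.isBounded)

lemma hausdorffDist_add_le {A B C D : Set ℝ} (hA : IsCompact A) (hA' : A.Nonempty)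
    (hB : IsCompact B) (hB' : B.Nonempty) (hC : IsCompact C) (hC' : C.Nonempty)
    (hD : IsCompact D) (hD' : D.Nonempty) :
    Metric.hausdorffDist (A + B) (C + D) ≤
      Metric.hausdorffDist A C + Metric.hausdorffDist B D := by
  refine Metric.hausdorffDist_le_of_mem_dist
    (add_nonneg Metric.hausdorffDist_nonneg Metric.hausdorffDist_nonneg) ?_ ?_
  · rintro _ ⟨x, hx, y, hy, rfl⟩
    obtain ⟨x', hx', h1⟩ := exists_dist_le_hausdorffDist hA hA' hC hC' hx
    obtain ⟨y', hy', h2⟩ := exists_dist_le_hausdorffDist hB hB' hD hD' hy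
    exact ⟨x' + y', add_mem_add hx' hy', (dist_add_add_le _ _ _ _).trans (add_le_add h1 h2)⟩
  · rintro _ ⟨x, hx, y, hy, rfl⟩
    obtain ⟨x', hx', h1⟩ := exists_dist_le_hausdorffDist hC hC' hA hA' hx
    obtain ⟨y', hy', h2⟩ := exists_dist_le_hausdorffDist hD hD' hB hB' hy
    rw [Metric.hausdorffDist_comm] at h1 h2
    exact ⟨x' + y', add_mem_add hx' hy', (dist_add_add_le _ _ _ _).trans (add_le_add h1 h2)⟩

lemma hausdorffDist_mul_le {A B : Set ℝ} (c : ℝ) (hA : IsCompact A) (hA' : A.Nonempty)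
    (hB : IsCompact B) (hB' : B.Nonempty) :
    Metric.hausdorffDist ((fun x => c * x) '' A) ((fun x => c * x) '' B) ≤
      |c| * Metric.hausdorffDist A B := by
  have key : ∀ x y : ℝ, dist (c * x) (c * y) = |c| * dist x y := fun x y => by
    rw [Real.dist_eq, Real.dist_eq, ← mul_sub, abs_mul]
  refine Metric.hausdorffDist_le_of_mem_dist
    (mul_nonneg (abs_nonneg c) Metric.hausdorffDist_nonneg) ?_ ?_
  · rintro _ ⟨x, hx, rfl⟩
    obtain ⟨x', hx', h1⟩ := exists_dist_le_hausdorffDist hA hA' hB hB' hx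
    refine ⟨c * x', mem_image_of_mem _ hx', ?_⟩
    show dist (c * x) (c * x') ≤ _
    rw [key]
    exact mul_le_mul_of_nonneg_left h1 (abs_nonneg c)
  · rintro _ ⟨x, hx, rfl⟩
    obtain ⟨x', hx', h1⟩ := exists_dist_le_hausdorffDist hB hB' hA hA' hx
    rw [Metric.hausdorffDist_comm] at h1
    refine ⟨c * x', mem_image_of_mem _ hx', ?_⟩
    show dist (c * x) (c * x') ≤ _
    rw [key]
    exact mul_le_mul_of_nonneg_left h1 (abs_nonneg c)

/-- Zadeh's sum of two membership functions. -/
def fuzzyAddFun (p q : ℝ → ℝ) (z : ℝ) : ℝ := ⨆ x : ℝ, min (p x) (q (z - x))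

lemma fuzzyAdd_bdd {p q : ℝ → ℝ} (hp : IsFuzzyNumber p) (z : ℝ) :
    BddAbove (range fun x : ℝ => min (p x) (q (z - x))) := by
  refine ⟨1, ?_⟩
  rintro _ ⟨x, rfl⟩
  exact (min_le_left _ _).trans (hp.le_one x)

lemma fuzzyAdd_attained {p q : ℝ → ℝ} (hp : IsFuzzyNumber p) (hq : IsFuzzyNumber q) (z : ℝ) :
    ∃ x, fuzzyAddFun p q z = min (p x) (q (z - x)) := by
  have husc : UpperSemicontinuous fun x : ℝ => min (p x) (q (z - x)) := by
    refine hp.usc.inf ?_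
    exact hq.usc.comp (by fun_prop)
  have hne : (tsupport p).Nonempty := by
    obtain ⟨x, hx⟩ := hp.normal
    exact ⟨x, subset_tsupport p (by simp [hx])⟩
  obtain ⟨x₀, -, h₀⟩ := UpperSemicontinuousOn.exists_isMaxOn hne hp.compact_support.isCompact
    (husc.upperSemicontinuousOn _)
  refine ⟨x₀, le_antisymm (ciSup_le fun x => ?_) (le_ciSup (fuzzyAdd_bdd hp z) x₀)⟩
  by_cases hx : x ∈ tsupport p
  · exact h₀ hx
  · rw [image_eq_zero_of_notMem_tsupport hx]
    exact (min_le_left _ _).trans (le_min (hp.nonneg _) (hq.nonneg _))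

lemma le_fuzzyAdd {p q : ℝ → ℝ} (hp : IsFuzzyNumber p) (x y : ℝ) :
    min (p x) (q y) ≤ fuzzyAddFun p q (x + y) := by
  have := le_ciSup (fuzzyAdd_bdd (q := q) hp (x + y)) x
  simpa [fuzzyAddFun] using this

/-- The level sets of the sum are the Minkowski sums of the level sets. -/
lemma fuzzyLevel_add {p q : ℝ → ℝ} (hp : IsFuzzyNumber p) (hq : IsFuzzyNumber q) (r : ℝ) :
    fuzzyLevel (fuzzyAddFun p q) r = fuzzyLevel p r + fuzzyLevel q r := by
  by_cases h : 0 < r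
  · simp only [fuzzyLevel, if_pos h]
    ext z
    constructor
    · intro hz
      obtain ⟨x, hx⟩ := fuzzyAdd_attained hp hq z
      have hz' : r ≤ min (p x) (q (z - x)) := hx ▸ hz
      exact ⟨x, (le_min_iff.1 hz').1, z - x, (le_min_iff.1 hz').2, by simp⟩
    · rintro ⟨x, hx, y, hy, rfl⟩
      exact (le_min hx hy).trans (le_fuzzyAdd hp x y)
  · have hP := hp.isCompact_level 0
    have hQ := hq.isCompact_level 0
    simp only [fuzzyLevel, lt_irrefl, if_false] at hP hQ
    simp only [fuzzyLevel, if_neg h]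
    have hset : {z | 0 < fuzzyAddFun p q z} = {x | 0 < p x} + {x | 0 < q x} := by
      ext z
      constructor
      · intro hz
        obtain ⟨x, hx⟩ := fuzzyAdd_attained hp hq z
        have hz' : 0 < min (p x) (q (z - x)) := hx ▸ hz
        exact ⟨x, (lt_min_iff.1 hz').1, z - x, (lt_min_iff.1 hz').2, by simp⟩
      · rintro ⟨x, hx, y, hy, rfl⟩
        exact lt_of_lt_of_le (lt_min hx hy) (le_fuzzyAdd hp x y)
    rw [hset]
    refine Subset.antisymm ?_ ?_
    · exact closure_minimal (add_subset_add subset_closure subset_closure)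
        (hP.add hQ).isClosed
    · rintro _ ⟨x, hx, y, hy, rfl⟩
      exact map_mem_closure₂ continuous_add hx hy fun a ha b hb => add_mem_add ha hb

lemma isFuzzyNumber_add {p q : ℝ → ℝ} (hp : IsFuzzyNumber p) (hq : IsFuzzyNumber q) :
    IsFuzzyNumber (fuzzyAddFun p q) where
  nonneg z := by
    obtain ⟨x, hx⟩ := fuzzyAdd_attained hp hq z
    rw [hx]
    exact le_min (hp.nonneg _) (hq.nonneg _)
  le_one z := by
    obtain ⟨x, hx⟩ := fuzzyAdd_attained hp hq z
    rw [hx]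
    exact (min_le_left _ _).trans (hp.le_one _)
  normal := by
    obtain ⟨x, hx⟩ := hp.normal
    obtain ⟨y, hy⟩ := hq.normal
    refine ⟨x + y, le_antisymm ?_ ?_⟩
    · obtain ⟨w, hw⟩ := fuzzyAdd_attained hp hq (x + y)
      rw [hw]
      exact (min_le_left _ _).trans (hp.le_one _)
    · simpa [hx, hy] using le_fuzzyAdd (q := q) hp x y
  convex z₁ z₂ t h0 h1 := by
    obtain ⟨x₁, e₁⟩ := fuzzyAdd_attained hp hq z₁
    obtain ⟨x₂, e₂⟩ := fuzzyAdd_attained hp hq z₂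
    have A := hp.convex x₁ x₂ t h0 h1
    have B := hq.convex (z₁ - x₁) (z₂ - x₂) t h0 h1
    have C := le_fuzzyAdd (q := q) hp (t * x₁ + (1 - t) * x₂)
      (t * (z₁ - x₁) + (1 - t) * (z₂ - x₂))
    have e : t * x₁ + (1 - t) * x₂ + (t * (z₁ - x₁) + (1 - t) * (z₂ - x₂)) =
        t * z₁ + (1 - t) * z₂ := by ring
    rw [e] at C
    refine le_trans ?_ C
    rw [e₁, e₂]
    refine le_min (le_trans ?_ A) (le_trans ?_ B)
    · exact min_le_min (min_le_left _ _) (min_le_left _ _)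
    · exact min_le_min (min_le_right _ _) (min_le_right _ _)
  usc := by
    rw [upperSemicontinuous_iff_isClosed_preimage]
    intro r
    by_cases h : 0 < r
    · have : fuzzyAddFun p q ⁻¹' Ici r = fuzzyLevel (fuzzyAddFun p q) r := by
        simp only [fuzzyLevel, if_pos h]
        rfl
      rw [this, fuzzyLevel_add hp hq]
      exact ((hp.isCompact_level r).add (hq.isCompact_level r)).isClosed
    · have : fuzzyAddFun p q ⁻¹' Ici r = univ := by
        ext z
        obtain ⟨x, hx⟩ := fuzzyAdd_attained hp hq z
        have : 0 ≤ fuzzyAddFun p q z := by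
          rw [hx]
          exact le_min (hp.nonneg _) (hq.nonneg _)
        simp only [mem_preimage, mem_Ici, mem_univ, iff_true]
        linarith
      rw [this]
      exact isClosed_univ
  compact_support := by
    refine HasCompactSupport.intro
      ((hp.compact_support.isCompact).add (hq.compact_support.isCompact)) fun z hz => ?_
    obtain ⟨x, hx⟩ := fuzzyAdd_attained hp hq z
    rw [hx]
    by_cases h1 : x ∈ tsupport p
    · have h2 : z - x ∉ tsupport q := fun h2 => hz ⟨x, h1, z - x, h2, by simp⟩
      rw [image_eq_zero_of_notMem_tsupport h2]
      exact min_eq_right (hp.nonneg _)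
    · rw [image_eq_zero_of_notMem_tsupport h1]
      exact min_eq_left (hq.nonneg _)

lemma isLevelContinuous_add {p q : ℝ → ℝ} (hp : IsFuzzyNumber p) (hq : IsFuzzyNumber q)
    (hp' : IsLevelContinuous p) (hq' : IsLevelContinuous q) :
    IsLevelContinuous (fuzzyAddFun p q) := by
  intro r hr
  have hsum := (hp' r hr).add (hq' r hr)
  rw [add_zero] at hsum
  refine tendsto_of_tendsto_of_tendsto_of_le_of_le' tendsto_const_nhds hsum
    (Eventually.of_forall fun _ => Metric.hausdorffDist_nonneg) ?_
  filter_upwards [self_mem_nhdsWithin] with s hs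
  rw [fuzzyLevel_add hp hq, fuzzyLevel_add hp hq]
  exact hausdorffDist_add_le (hp.isCompact_level s) (hp.level_nonempty hs.2)
    (hq.isCompact_level s) (hq.level_nonempty hs.2) (hp.isCompact_level r)
    (hp.level_nonempty hr.2) (hq.isCompact_level r) (hq.level_nonempty hr.2)

/-- The sum of fuzzy numbers, by Zadeh's extension principle
(equivalently, `[p + q]^r = [p]^r + [q]^r`). -/
instance : Add FuzzyNum where
  add p q :=
    { toFun := fuzzyAddFun p.toFun q.toFun
      isFuzzy := isFuzzyNumber_add p.isFuzzy q.isFuzzy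
      levelCont := isLevelContinuous_add p.isFuzzy q.isFuzzy p.levelCont q.levelCont }

/-- The membership function of the crisp number zero. -/
def fuzzyZeroFun (x : ℝ) : ℝ := if x = 0 then 1 else 0

lemma fuzzyLevel_zero {r : ℝ} (hr : r ≤ 1) : fuzzyLevel fuzzyZeroFun r = {0} := by
  unfold fuzzyLevel fuzzyZeroFun
  split_ifs with h
  · ext x
    by_cases hx : x = 0
    · simp [hx, hr]
    · simp [hx, h]
  · have : {x : ℝ | (0 : ℝ) < if x = 0 then 1 else 0} = {0} := by
      ext x
      by_cases hx : x = 0 <;> simp [hx]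
    rw [this, closure_singleton]

lemma isFuzzyNumber_zero : IsFuzzyNumber fuzzyZeroFun where
  nonneg x := by unfold fuzzyZeroFun; split_ifs <;> norm_num
  le_one x := by unfold fuzzyZeroFun; split_ifs <;> norm_num
  normal := ⟨0, by simp [fuzzyZeroFun]⟩
  convex x₁ x₂ t h0 h1 := by
    unfold fuzzyZeroFun
    by_cases e1 : x₁ = 0 <;> by_cases e2 : x₂ = 0 <;> simp [e1, e2] <;> split_ifs <;> norm_num
  usc := by
    have : fuzzyZeroFun = indicator {0} (fun _ => (1 : ℝ)) := by
      ext x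
      by_cases hx : x = 0 <;> simp [fuzzyZeroFun, hx]
    rw [this]
    exact isClosed_singleton.upperSemicontinuous_indicator zero_le_one
  compact_support := HasCompactSupport.intro (isCompact_singleton (x := (0 : ℝ))) fun x hx => by
    simp only [mem_singleton_iff] at hx
    simp [fuzzyZeroFun, hx]

lemma isLevelContinuous_zero : IsLevelContinuous fuzzyZeroFun := by
  intro r hr
  refine tendsto_const_nhds.congr' ?_
  filter_upwards [self_mem_nhdsWithin] with s hs
  rw [fuzzyLevel_zero hs.2, fuzzyLevel_zero hr.2, Metric.hausdorffDist_self_zero]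

instance : Zero FuzzyNum where
  zero :=
    { toFun := fuzzyZeroFun
      isFuzzy := isFuzzyNumber_zero
      levelCont := isLevelContinuous_zero }

/-- The membership function of a scalar multiple. -/
def fuzzySMulFun (c : ℝ) (p : ℝ → ℝ) : ℝ → ℝ :=
  if c = 0 then fuzzyZeroFun else fun x => p (x / c)

lemma fuzzyLevel_smul {c : ℝ} (hc : c ≠ 0) (p : ℝ → ℝ) (r : ℝ) :
    fuzzyLevel (fuzzySMulFun c p) r = (fun x => c * x) '' fuzzyLevel p r := by
  have himg : ∀ S : Set ℝ, {x | x / c ∈ S} = (fun x => c * x) '' S := by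
    intro S
    ext x
    constructor
    · intro hx
      exact ⟨x / c, hx, mul_div_cancel₀ x hc⟩
    · rintro ⟨y, hy, rfl⟩
      simpa [mul_div_cancel_left₀ y hc] using hy
  simp only [fuzzyLevel, fuzzySMulFun, if_neg hc]
  split_ifs with h
  · exact himg {x | r ≤ p x}
  · have e : {x | 0 < p (x / c)} = (fun x => c * x) '' {x | 0 < p x} := himg {x | 0 < p x}
    rw [e]
    exact ((Homeomorph.mulLeft₀ c hc).image_closure _).symm

lemma isFuzzyNumber_smul (c : ℝ) {p : ℝ → ℝ} (hp : IsFuzzyNumber p) :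
    IsFuzzyNumber (fuzzySMulFun c p) := by
  by_cases hc : c = 0
  · simpa [fuzzySMulFun, hc] using isFuzzyNumber_zero
  · simp only [fuzzySMulFun, if_neg hc]
    exact
      { nonneg := fun x => hp.nonneg _
        le_one := fun x => hp.le_one _
        normal := by
          obtain ⟨x, hx⟩ := hp.normal
          exact ⟨c * x, by rw [mul_div_cancel_left₀ x hc, hx]⟩
        convex := fun x₁ x₂ t h0 h1 => by
          have := hp.convex (x₁ / c) (x₂ / c) t h0 h1
          have e : t * (x₁ / c) + (1 - t) * (x₂ / c) = (t * x₁ + (1 - t) * x₂) / c := by ring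
          rwa [e] at this
        usc := hp.usc.comp (by fun_prop)
        compact_support := by
          have := hp.compact_support.comp_homeomorph (Homeomorph.mulRight₀ c⁻¹ (inv_ne_zero hc))
          simpa [Function.comp_def, div_eq_mul_inv] using this }

lemma isLevelContinuous_smul (c : ℝ) {p : ℝ → ℝ} (hp : IsFuzzyNumber p)
    (hp' : IsLevelContinuous p) : IsLevelContinuous (fuzzySMulFun c p) := by
  by_cases hc : c = 0
  · simpa [fuzzySMulFun, hc] using isLevelContinuous_zero
  · intro r hr
    have hmul := (hp' r hr).const_mul |c|
    rw [mul_zero] at hmul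
    refine tendsto_of_tendsto_of_tendsto_of_le_of_le' tendsto_const_nhds hmul
      (Eventually.of_forall fun _ => Metric.hausdorffDist_nonneg) ?_
    filter_upwards [self_mem_nhdsWithin] with s hs
    rw [fuzzyLevel_smul hc, fuzzyLevel_smul hc]
    exact hausdorffDist_mul_le c (hp.isCompact_level s) (hp.level_nonempty hs.2)
      (hp.isCompact_level r) (hp.level_nonempty hr.2)

/-- Scalar multiplication, `[c • p]^r = c [p]^r`. -/
instance : SMul ℝ FuzzyNum where
  smul c p :=
    { toFun := fuzzySMulFun c p.toFun
      isFuzzy := isFuzzyNumber_smul c p.isFuzzy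
      levelCont := isLevelContinuous_smul c p.isFuzzy p.levelCont }

namespace FuzzyNum

/-- The level set `[z]^r`. -/
def level (z : FuzzyNum) (r : ℝ) : Set ℝ := fuzzyLevel z.toFun r

/-- The left end point of `[z]^r`. -/
def lo (z : FuzzyNum) (r : ℝ) : ℝ := sInf (z.level r)

/-- The right end point of `[z]^r`. -/
def hi (z : FuzzyNum) (r : ℝ) : ℝ := sSup (z.level r)

/-- The metric `𝔻`: the supremum over `r ∈ [0,1]` of the Hausdorff distances of the level sets. -/
def D (p q : FuzzyNum) : ℝ :=
  ⨆ r : Icc (0 : ℝ) 1, Metric.hausdorffDist (p.level r) (q.level r)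

/-- `w = p ⊖ q`, the Hukuhara difference; also clause (i) of the generalized difference. -/
def IsHDiff (p q w : FuzzyNum) : Prop := p = q + w

/-- Clause (ii) of the generalized Hukuhara difference. -/
def IsHDiffII (p q w : FuzzyNum) : Prop := q = p + (-1 : ℝ) • w

/-- `w = p ⊖_{gH} q`, the generalized Hukuhara difference. -/
def IsGHDiff (p q w : FuzzyNum) : Prop := IsHDiff p q w ∨ IsHDiffII p q w

/-- Continuity on `S ⊆ ℝ²` of a function with fuzzy values. -/
def ContOn (f : ℝ → ℝ → FuzzyNum) (S : Set (ℝ × ℝ)) : Prop :=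
  ∀ p ∈ S, Tendsto (fun q : ℝ × ℝ => D (f q.1 q.2) (f p.1 p.2)) (𝓝[S] p) (𝓝 0)

/-! ### `gH`-derivatives -/

/-- `f'` is the `gH`-derivative of `f` at `x`, the variable ranging over `s`. -/
def HasGHDeriv (f : ℝ → FuzzyNum) (f' : FuzzyNum) (s : Set ℝ) (x : ℝ) : Prop :=
  ∃ q : ℝ → FuzzyNum, (∀ᶠ u in 𝓝[s \ {x}] x, IsGHDiff (f u) (f x) (q u)) ∧
    Tendsto (fun u => D ((u - x)⁻¹ • q u) f') (𝓝[s \ {x}] x) (𝓝 0)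

/-- `f` is (i)-`gH`-differentiable at `x` with derivative `f'`. -/
def HasGHDerivI (f : ℝ → FuzzyNum) (f' : FuzzyNum) (s : Set ℝ) (x : ℝ) : Prop :=
  HasGHDeriv f f' s x ∧ ∀ r ∈ Icc (0 : ℝ) 1,
    HasDerivWithinAt (fun u => (f u).lo r) (f'.lo r) s x ∧
    HasDerivWithinAt (fun u => (f u).hi r) (f'.hi r) s x

/-- `f` is (ii)-`gH`-differentiable at `x` with derivative `f'`. -/
def HasGHDerivII (f : ℝ → FuzzyNum) (f' : FuzzyNum) (s : Set ℝ) (x : ℝ) : Prop :=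
  HasGHDeriv f f' s x ∧ ∀ r ∈ Icc (0 : ℝ) 1,
    HasDerivWithinAt (fun u => (f u).lo r) (f'.hi r) s x ∧
    HasDerivWithinAt (fun u => (f u).hi r) (f'.lo r) s x

/-- `Q` is the mixed second order `gH`-derivative `∂²U/∂x∂y` on `(0,a] × (0,b]`: `U` and its
`gH`-derivative `P = ∂U/∂x` are continuous, and neither `U` (in `x`) nor `P` (in `y`) switches
its type of `gH`-differentiability. -/
def HasMixedGHDeriv (a b : ℝ) (U Q : ℝ → ℝ → FuzzyNum) : Prop :=
  ContOn U (Ioc 0 a ×ˢ Ioc 0 b) ∧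
  ∃ P : ℝ → ℝ → FuzzyNum, ContOn P (Ioc 0 a ×ˢ Ioc 0 b) ∧
    ((∀ x ∈ Ioc 0 a, ∀ y ∈ Ioc 0 b, HasGHDerivI (fun u => U u y) (P x y) (Ioc 0 a) x) ∨
      (∀ x ∈ Ioc 0 a, ∀ y ∈ Ioc 0 b, HasGHDerivII (fun u => U u y) (P x y) (Ioc 0 a) x)) ∧
    ((∀ x ∈ Ioc 0 a, ∀ y ∈ Ioc 0 b, HasGHDerivI (fun v => P x v) (Q x y) (Ioc 0 b) y) ∨
      (∀ x ∈ Ioc 0 a, ∀ y ∈ Ioc 0 b, HasGHDerivII (fun v => P x v) (Q x y) (Ioc 0 b) y))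

/-! ### Mixed Katugampola integrals and derivatives -/

/-- The kernel of the mixed Katugampola integral of order `α` at the point `(x, y)`. -/
def katKernel (α ρ : ℝ × ℝ) (x y : ℝ) (p : ℝ × ℝ) : ℝ :=
  ρ.1 ^ (1 - α.1) * ρ.2 ^ (1 - α.2) / (Real.Gamma α.1 * Real.Gamma α.2) *
    (p.1 ^ (ρ.1 - 1) * p.2 ^ (ρ.2 - 1) /
      ((x ^ ρ.1 - p.1 ^ ρ.1) ^ (1 - α.1) * (y ^ ρ.2 - p.2 ^ ρ.2) ^ (1 - α.2)))

/-- The real integrand of the mixed Katugampola integral at `(x, y)` is Lebesgue integrable. -/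
def KatIntegrable (α ρ : ℝ × ℝ) (μ : ℝ → ℝ → ℝ) (x y : ℝ) : Prop :=
  IntegrableOn (fun p : ℝ × ℝ => katKernel α ρ x y p * μ p.1 p.2) (Ioo 0 x ×ˢ Ioo 0 y)

/-- The mixed Katugampola integral of order `α` of a real function. -/
def katInt (α ρ : ℝ × ℝ) (μ : ℝ → ℝ → ℝ) (x y : ℝ) : ℝ :=
  ∫ p in Ioo 0 x ×ˢ Ioo 0 y, katKernel α ρ x y p * μ p.1 p.2

/-- The mixed Katugampola integral of a fuzzy function exists at `(x, y)`: the end points of all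
level sets are integrable against the kernel. -/
def FuzzyKatIntegrable (α ρ : ℝ × ℝ) (f : ℝ → ℝ → FuzzyNum) (x y : ℝ) : Prop :=
  ∀ r ∈ Icc (0 : ℝ) 1, KatIntegrable α ρ (fun s t => (f s t).lo r) x y ∧
    KatIntegrable α ρ (fun s t => (f s t).hi r) x y

/-- `J` is the mixed Katugampola integral of order `α` of the fuzzy function `f` at `(x, y)`. -/
def HasFuzzyKatInt (α ρ : ℝ × ℝ) (f : ℝ → ℝ → FuzzyNum) (x y : ℝ) (J : FuzzyNum) : Prop :=
  FuzzyKatIntegrable α ρ f x y ∧ ∀ r ∈ Icc (0 : ℝ) 1,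
    J.level r = Icc (katInt α ρ (fun s t => (f s t).lo r) x y)
      (katInt α ρ (fun s t => (f s t).hi r) x y)

/-- `d` is the mixed Katugampola `gH`-derivative of order `φ` of `g` on `(0,a] × (0,b]`, i.e.
`d = x^{1-ρ₁} y^{1-ρ₂} ∂²/∂x∂y (I^{1-φ,ρ} g)`. -/
def HasKatDeriv (a b : ℝ) (φ ρ : ℝ × ℝ) (g d : ℝ → ℝ → FuzzyNum) : Prop :=
  ∃ U Q : ℝ → ℝ → FuzzyNum,
    (∀ x ∈ Ioc 0 a, ∀ y ∈ Ioc 0 b, HasFuzzyKatInt (1 - φ) ρ g x y (U x y)) ∧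
    HasMixedGHDeriv a b U Q ∧
    ∀ x ∈ Ioc 0 a, ∀ y ∈ Ioc 0 b, d x y = (x ^ (1 - ρ.1) * y ^ (1 - ρ.2)) • Q x y

/-- `g` is the increment `υ(x,y) ⊖ υ(x,0) ⊖ υ(0,y) + υ(0,0)` at `(x,y)`, taken as a Hukuhara
difference. -/
def IsIncrI (υ g : ℝ → ℝ → FuzzyNum) (x y : ℝ) : Prop :=
  IsHDiff (υ x y + υ 0 0) (υ x 0 + υ 0 y) (g x y)

/-- The same increment, in the sense of clause (ii) of the generalized Hukuhara difference. -/
def IsIncrII (υ g : ℝ → ℝ → FuzzyNum) (x y : ℝ) : Prop :=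
  IsHDiffII (υ x y + υ 0 0) (υ x 0 + υ 0 y) (g x y)

/-- `d` is the mixed Caputo–Katugampola `gH`-derivative of order `φ` of `υ` on `(0,a] × (0,b]`. -/
def HasCKDeriv (a b : ℝ) (φ ρ : ℝ × ℝ) (υ d : ℝ → ℝ → FuzzyNum) : Prop :=
  ∃ g : ℝ → ℝ → FuzzyNum,
    (∀ x ∈ Ioc 0 a, ∀ y ∈ Ioc 0 b, IsIncrI υ g x y ∨ IsIncrII υ g x y) ∧
    HasKatDeriv a b φ ρ g d

/-- `(d, e)` is the pair of Caputo–Katugampola `gH`-derivatives, of orders `φ` and `ψ`, of the pair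
`(υ, ω)`, where the generalized difference is the one of `Ê_f × Ê_f`: at each point, the
increments of `υ` and of `ω` are taken in the sense of the same clause. -/
def HasJointCKDeriv (a b : ℝ) (φ ψ ρ : ℝ × ℝ) (υ ω d e : ℝ → ℝ → FuzzyNum) : Prop :=
  ∃ g k : ℝ → ℝ → FuzzyNum,
    (∀ x ∈ Ioc 0 a, ∀ y ∈ Ioc 0 b,
      (IsIncrI υ g x y ∧ IsIncrI ω k x y) ∨ (IsIncrII υ g x y ∧ IsIncrII ω k x y)) ∧
    HasKatDeriv a b φ ρ g d ∧ HasKatDeriv a b ψ ρ k e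

/-! ### The Darboux problems and the Volterra equations -/

/-- The boundary conditions `υ(x,0) = ξ₁(x)`, `υ(0,y) = ξ₂(y)`. -/
def HasBoundary (a b : ℝ) (ξ₁ ξ₂ : ℝ → FuzzyNum) (υ : ℝ → ℝ → FuzzyNum) : Prop :=
  (∀ x ∈ Icc 0 a, υ x 0 = ξ₁ x) ∧ (∀ y ∈ Icc 0 b, υ 0 y = ξ₂ y)

/-- `h(x,y) = ξ₁(x) + ξ₂(y) ⊖ ξ₁(0)` on `[0,a] × [0,b]`. -/
def IsDarbouxData (a b : ℝ) (ξ₁ ξ₂ : ℝ → FuzzyNum) (h : ℝ → ℝ → FuzzyNum) : Prop :=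
  ∀ x ∈ Icc 0 a, ∀ y ∈ Icc 0 b, IsHDiff (ξ₁ x + ξ₂ y) (ξ₁ 0) (h x y)

/-- `υ` solves the Darboux problem. -/
def SolvesDarboux (a b : ℝ) (φ ρ : ℝ × ℝ) (F : ℝ → ℝ → FuzzyNum → FuzzyNum)
    (ξ₁ ξ₂ : ℝ → FuzzyNum) (υ : ℝ → ℝ → FuzzyNum) : Prop :=
  HasBoundary a b ξ₁ ξ₂ υ ∧ HasCKDeriv a b φ ρ υ (fun x y => F x y (υ x y))

/-- `(υ, ω)` solves the coupled Darboux problem. -/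
def SolvesCoupledDarboux (a b : ℝ) (φ ψ ρ : ℝ × ℝ)
    (F G : ℝ → ℝ → FuzzyNum → FuzzyNum → FuzzyNum) (ξ₁ ξ₂ η₁ η₂ : ℝ → FuzzyNum)
    (υ ω : ℝ → ℝ → FuzzyNum) : Prop :=
  HasBoundary a b ξ₁ ξ₂ υ ∧ HasBoundary a b η₁ η₂ ω ∧
    HasJointCKDeriv a b φ ψ ρ υ ω (fun x y => F x y (υ x y) (ω x y))
      (fun x y => G x y (υ x y) (ω x y))

/-- `υ = h + I^{φ,ρ} f` on `[0,a] × [0,b]`; the existence of the integral is part of this. -/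
def VolterraPlus (a b : ℝ) (φ ρ : ℝ × ℝ) (h f υ : ℝ → ℝ → FuzzyNum) : Prop :=
  ∀ x ∈ Icc 0 a, ∀ y ∈ Icc 0 b, ∃ J, HasFuzzyKatInt φ ρ f x y J ∧ υ x y = h x y + J

/-- `υ = h ⊖ (-1) I^{φ,ρ} f` on `[0,a] × [0,b]`; the existence of the integral and of the Hukuhara
difference is part of this. -/
def VolterraMinus (a b : ℝ) (φ ρ : ℝ × ℝ) (h f υ : ℝ → ℝ → FuzzyNum) : Prop :=
  ∀ x ∈ Icc 0 a, ∀ y ∈ Icc 0 b, ∃ J, HasFuzzyKatInt φ ρ f x y J ∧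
    IsHDiff (h x y) ((-1 : ℝ) • J) (υ x y)

/-- The mixed Katugampola integral of `f` exists at every point of `(0,a] × (0,b]`. -/
def KatIntegrableOn (a b : ℝ) (φ ρ : ℝ × ℝ) (f : ℝ → ℝ → FuzzyNum) : Prop :=
  ∀ x ∈ Ioc 0 a, ∀ y ∈ Ioc 0 b, FuzzyKatIntegrable φ ρ f x y

/-- `f` is continuous and bounded on `(0,a] × (0,b]`. -/
def BddContOn (a b : ℝ) (f : ℝ → ℝ → FuzzyNum) : Prop :=
  ContOn f (Ioc 0 a ×ˢ Ioc 0 b) ∧ ∃ M : ℝ, ∀ x ∈ Ioc 0 a, ∀ y ∈ Ioc 0 b, D (f x y) 0 ≤ M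

end FuzzyNum

end

open FuzzyNum

/-! ### Intervals and the Hausdorff distance -/

/-! An element of `FuzzyNum` amounts to a pair of continuous functions on [0,1], the end points of
its levels, lying in a convex cone. The map `ends` is an additive isometry onto this cone
(`D_eq_norm`, `exists_ends_eq`). Hence sums can be cancelled, both clauses of the generalized
difference become linear identities, and integrals and derivatives can be handled on real end points
or in the Banach space `EndSpace`.

From the derivative to the integral: at a fixed level the end points of the increment g are the
minimum and the maximum of two continuous functions, whichever clause holds at each point. So
I^{1-φ} g vanishes at the axes, and integrating its mixed derivative gives I^{1-φ} γ = I^1 f, where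
γ is an end point of g and f an end point of the derivative. Applying I^φ (`katInt_katInt`) yields
I^1 γ = I^{φ+1} f. The mixed left difference quotients of the two sides tend to γ(x,y) by continuity
and to I^φ f(x,y) by dominated convergence (`eq_katInt_of_katInt_eq`). Thus γ = I^φ f at every
point, with f merely integrable against the kernel. When the two differentiations have different
types the end points come out interchanged, and their order forces them to coincide.

One clause then holds everywhere. The difference e between the upper and the lower increment
satisfies |e| = I^φ(length of the levels of f). A zero of e forces these lengths to vanish almost
everywhere on the rectangle below it, hence e to vanish there. By the intermediate value theorem,
the sign of e at the corner (a,b) therefore decides its sign on the whole rectangle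
(`nonneg_of_abs_eq_katInt`). For a pair, the clause at the corner is common to both components,
hence so is the type of equation.

From the integral to the derivative: if g = I^φ f with f continuous and bounded, then I^{1-φ} g =
I^1 f is an iterated Bochner integral of functions with values in the cone. Its increments stay in
the cone, so both differentiations are of type (i) (`hasKatDeriv_of_hasFuzzyKatInt`). The two
Volterra equations differ only in the clause that g satisfies (`HasBoundary.incr_iff`). -/

lemma abs_sub_le_hausdorffDist_Icc {a b c d : ℝ} (hab : a ≤ b) (hcd : c ≤ d) :
    max |a - c| |b - d| ≤ Metric.hausdorffDist (Icc a b) (Icc c d) := by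
  have hA := nonempty_Icc.2 hab
  have hB := nonempty_Icc.2 hcd
  obtain ⟨y₁, hy₁, h₁⟩ := exists_dist_le_hausdorffDist isCompact_Icc hA isCompact_Icc hB
    (left_mem_Icc.2 hab)
  obtain ⟨y₂, hy₂, h₂⟩ := exists_dist_le_hausdorffDist isCompact_Icc hA isCompact_Icc hB
    (right_mem_Icc.2 hab)
  obtain ⟨y₃, hy₃, h₃⟩ := exists_dist_le_hausdorffDist isCompact_Icc hB isCompact_Icc hA
    (left_mem_Icc.2 hcd)
  obtain ⟨y₄, hy₄, h₄⟩ := exists_dist_le_hausdorffDist isCompact_Icc hB isCompact_Icc hA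
    (right_mem_Icc.2 hcd)
  rw [Metric.hausdorffDist_comm] at h₃ h₄
  rw [Real.dist_eq, abs_le] at h₁ h₂ h₃ h₄
  refine max_le (abs_le.2 ⟨?_, ?_⟩) (abs_le.2 ⟨?_, ?_⟩)
  · linarith [hy₁.1, hy₁.2]
  · linarith [hy₃.1, hy₃.2]
  · linarith [hy₄.1, hy₄.2]
  · linarith [hy₂.1, hy₂.2]

lemma exists_dist_le_of_mem_Icc {a b c d x : ℝ} (hcd : c ≤ d) (hx : x ∈ Icc a b) :
    ∃ y ∈ Icc c d, dist x y ≤ max |a - c| |b - d| := by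
  -- The witness is the projection of x onto [c, d].
  refine ⟨max c (min x d), ⟨le_max_left _ _, max_le hcd (min_le_right _ _)⟩, ?_⟩
  rw [Real.dist_eq]
  have h1 := neg_abs_le (a - c)
  have h2 := le_abs_self (b - d)
  have h3 := le_max_left |a - c| |b - d|
  have h4 := le_max_right |a - c| |b - d|
  have h5 := abs_nonneg (a - c)
  rcases le_total x d with h | h
  · rw [min_eq_left h]
    rcases le_total c x with h' | h'
    · rw [max_eq_right h', sub_self, abs_zero]; linarith
    · rw [max_eq_left h', abs_le]; constructor <;> linarith [hx.1, hx.2]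
  · rw [min_eq_right h, max_eq_right hcd, abs_le]; constructor <;> linarith [hx.1, hx.2]

lemma hausdorffDist_Icc {a b c d : ℝ} (hab : a ≤ b) (hcd : c ≤ d) :
    Metric.hausdorffDist (Icc a b) (Icc c d) = max |a - c| |b - d| := by
  refine le_antisymm ?_ (abs_sub_le_hausdorffDist_Icc hab hcd)
  refine Metric.hausdorffDist_le_of_mem_dist (le_max_of_le_left (abs_nonneg _)) ?_ ?_
  · exact fun x hx => exists_dist_le_of_mem_Icc hcd hx
  · intro x hx
    rw [abs_sub_comm a c, abs_sub_comm b d]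
    exact exists_dist_le_of_mem_Icc hab hx

/-! ### Level sets of a fuzzy number -/

namespace FuzzyNum

lemma level_of_pos (p : FuzzyNum) {r : ℝ} (hr : 0 < r) : p.level r = {x | r ≤ p.toFun x} := by
  simp [level, fuzzyLevel, hr]

lemma level_zero_eq (p : FuzzyNum) : p.level 0 = closure {x | 0 < p.toFun x} := by
  simp [level, fuzzyLevel]

lemma convex_superlevel (p : FuzzyNum) {P : ℝ → Prop} (hP : ∀ s t, s ≤ t → P s → P t)
    (hmin : ∀ s t, P s → P t → P (min s t)) : Convex ℝ {x | P (p.toFun x)} := by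
  intro x hx y hy s t hs ht hst
  have := p.isFuzzy.convex x y s hs (by linarith)
  have e : t = 1 - s := by linarith
  simp only [smul_eq_mul, mem_ofPred_eq, e]
  exact hP _ _ this (hmin _ _ hx hy)

lemma convex_level (p : FuzzyNum) (r : ℝ) : Convex ℝ (p.level r) := by
  unfold level fuzzyLevel
  split_ifs with h
  · exact p.convex_superlevel (P := fun t => r ≤ t) (fun s t h1 h2 => h2.trans h1)
      fun s t h1 h2 => le_min h1 h2
  · exact (p.convex_superlevel (P := fun t => 0 < t) (fun s t h1 h2 => h2.trans_le h1)
      fun s t h1 h2 => lt_min h1 h2).closure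

lemma isCompact_level (p : FuzzyNum) (r : ℝ) : IsCompact (p.level r) :=
  p.isFuzzy.isCompact_level r

lemma level_nonempty (p : FuzzyNum) {r : ℝ} (hr : r ≤ 1) : (p.level r).Nonempty :=
  p.isFuzzy.level_nonempty hr

lemma level_eq_Icc (p : FuzzyNum) {r : ℝ} (hr : r ≤ 1) : p.level r = Icc (p.lo r) (p.hi r) :=
  eq_Icc_of_connected_compact ⟨p.level_nonempty hr, (p.convex_level r).isPreconnected⟩
    (p.isCompact_level r)

lemma lo_le_hi (p : FuzzyNum) {r : ℝ} (hr : r ≤ 1) : p.lo r ≤ p.hi r :=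
  nonempty_Icc.1 (p.level_eq_Icc hr ▸ p.level_nonempty hr)

lemma lo_hi_of_level_eq (p : FuzzyNum) {r c d : ℝ} (hr : r ≤ 1) (h : p.level r = Icc c d) :
    c ≤ d ∧ p.lo r = c ∧ p.hi r = d := by
  have hcd : c ≤ d := nonempty_Icc.1 (h ▸ p.level_nonempty hr)
  exact ⟨hcd, by rw [lo, h, csInf_Icc hcd], by rw [hi, h, csSup_Icc hcd]⟩

lemma level_anti (p : FuzzyNum) {r s : ℝ} (hr : 0 ≤ r) (hrs : r ≤ s) : p.level s ⊆ p.level r := by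
  rcases hr.eq_or_lt with rfl | hr
  · rcases hrs.eq_or_lt with rfl | hs
    · exact Subset.rfl
    · rw [level_zero_eq, level_of_pos p hs]
      exact fun x hx => subset_closure (hs.trans_le hx)
  · rw [level_of_pos p hr, level_of_pos p (hr.trans_le hrs)]
    exact fun x hx => hrs.trans hx

lemma lo_mono (p : FuzzyNum) {r s : ℝ} (hr : 0 ≤ r) (hrs : r ≤ s) (hs : s ≤ 1) :
    p.lo r ≤ p.lo s := by
  have := p.level_anti hr hrs
  rw [p.level_eq_Icc hs, p.level_eq_Icc (hrs.trans hs)] at this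
  exact ((Icc_subset_Icc_iff (p.lo_le_hi hs)).1 this).1

lemma hi_anti (p : FuzzyNum) {r s : ℝ} (hr : 0 ≤ r) (hrs : r ≤ s) (hs : s ≤ 1) :
    p.hi s ≤ p.hi r := by
  have := p.level_anti hr hrs
  rw [p.level_eq_Icc hs, p.level_eq_Icc (hrs.trans hs)] at this
  exact ((Icc_subset_Icc_iff (p.lo_le_hi hs)).1 this).2

lemma hausdorffDist_level (p q : FuzzyNum) {r s : ℝ} (hr : r ≤ 1) (hs : s ≤ 1) :
    Metric.hausdorffDist (p.level r) (q.level s) =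
      max |p.lo r - q.lo s| |p.hi r - q.hi s| := by
  rw [p.level_eq_Icc hr, q.level_eq_Icc hs, hausdorffDist_Icc (p.lo_le_hi hr) (q.lo_le_hi hs)]

lemma ext_level {p q : FuzzyNum} (h : ∀ r ∈ Icc (0 : ℝ) 1, p.level r = q.level r) : p = q := by
  have key : ∀ p q : FuzzyNum, (∀ r ∈ Icc (0 : ℝ) 1, p.level r = q.level r) →
      ∀ x, p.toFun x ≤ q.toFun x := by
    intro p q h x
    rcases (p.isFuzzy.nonneg x).eq_or_lt with h0 | h0
    · rw [← h0]; exact q.isFuzzy.nonneg x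
    -- The level tested is the membership value at x itself, for which x lies in the level of `p`.
    · have := h (p.toFun x) ⟨h0.le, p.isFuzzy.le_one x⟩
      rw [level_of_pos p h0, level_of_pos q h0] at this
      have hx : x ∈ {y | p.toFun x ≤ p.toFun y} := le_refl (p.toFun x)
      rw [this] at hx
      exact hx
  obtain ⟨f, hf, hf'⟩ := p
  obtain ⟨g, hg, hg'⟩ := q
  congr 1
  funext x
  exact le_antisymm (key ⟨f, hf, hf'⟩ ⟨g, hg, hg'⟩ h x)
    (key ⟨g, hg, hg'⟩ ⟨f, hf, hf'⟩ (fun r hr => (h r hr).symm) x)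

lemma ext_lo_hi {p q : FuzzyNum} (h : ∀ r ∈ Icc (0 : ℝ) 1, p.lo r = q.lo r ∧ p.hi r = q.hi r) :
    p = q :=
  ext_level fun r hr => by
    rw [p.level_eq_Icc hr.2, q.level_eq_Icc hr.2, (h r hr).1, (h r hr).2]

/-! ### Levels of sums and multiples -/

lemma level_add (p q : FuzzyNum) (r : ℝ) : (p + q).level r = p.level r + q.level r :=
  fuzzyLevel_add p.isFuzzy q.isFuzzy r

lemma level_smul {c : ℝ} (hc : c ≠ 0) (p : FuzzyNum) (r : ℝ) :
    (c • p).level r = (fun x => c * x) '' p.level r :=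
  fuzzyLevel_smul hc p.toFun r

lemma level_zero {r : ℝ} (hr : r ≤ 1) : (0 : FuzzyNum).level r = {0} :=
  fuzzyLevel_zero hr

lemma add_lo_hi (p q : FuzzyNum) {r : ℝ} (hr : r ≤ 1) :
    (p + q).lo r = p.lo r + q.lo r ∧ (p + q).hi r = p.hi r + q.hi r := by
  refine (lo_hi_of_level_eq _ hr ?_).2
  rw [level_add, p.level_eq_Icc hr, q.level_eq_Icc hr,
    Icc_add_Icc (p.lo_le_hi hr) (q.lo_le_hi hr)]

lemma smul_lo_hi {c : ℝ} (hc : 0 < c) (p : FuzzyNum) {r : ℝ} (hr : r ≤ 1) :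
    (c • p).lo r = c * p.lo r ∧ (c • p).hi r = c * p.hi r := by
  refine (lo_hi_of_level_eq _ hr ?_).2
  rw [level_smul hc.ne', p.level_eq_Icc hr, image_mul_left_Icc' hc]

lemma smul_lo_hi_of_neg {c : ℝ} (hc : c < 0) (p : FuzzyNum) {r : ℝ} (hr : r ≤ 1) :
    (c • p).lo r = c * p.hi r ∧ (c • p).hi r = c * p.lo r := by
  refine (lo_hi_of_level_eq _ hr ?_).2
  rw [level_smul hc.ne, p.level_eq_Icc hr]
  ext x
  constructor
  · rintro ⟨y, hy, rfl⟩
    exact ⟨mul_le_mul_of_nonpos_left hy.2 hc.le, mul_le_mul_of_nonpos_left hy.1 hc.le⟩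
  · rintro ⟨h1, h2⟩
    refine ⟨x / c, ⟨?_, ?_⟩, mul_div_cancel₀ x hc.ne⟩
    · rwa [le_div_iff_of_neg hc, mul_comm]
    · rwa [div_le_iff_of_neg hc, mul_comm]

lemma zero_lo_hi {r : ℝ} (hr : r ≤ 1) : (0 : FuzzyNum).lo r = 0 ∧ (0 : FuzzyNum).hi r = 0 := by
  refine (lo_hi_of_level_eq _ hr ?_).2
  rw [level_zero hr, Icc_self]

lemma isHDiff_iff (p q w : FuzzyNum) : IsHDiff p q w ↔ ∀ r ∈ Icc (0 : ℝ) 1,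
    p.lo r = q.lo r + w.lo r ∧ p.hi r = q.hi r + w.hi r := by
  refine ⟨fun h r hr => ?_, fun h => ext_lo_hi fun r hr => ?_⟩
  · rw [IsHDiff] at h
    rw [h]; exact add_lo_hi q w hr.2
  · rw [(add_lo_hi q w hr.2).1, (add_lo_hi q w hr.2).2]; exact h r hr

lemma isHDiffII_iff (p q w : FuzzyNum) : IsHDiffII p q w ↔ ∀ r ∈ Icc (0 : ℝ) 1,
    q.lo r = p.lo r - w.hi r ∧ q.hi r = p.hi r - w.lo r := by
  have e : ∀ r ∈ Icc (0 : ℝ) 1, (p + (-1 : ℝ) • w).lo r = p.lo r - w.hi r ∧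
      (p + (-1 : ℝ) • w).hi r = p.hi r - w.lo r := by
    intro r hr
    have h1 := add_lo_hi p ((-1 : ℝ) • w) hr.2
    have h2 := smul_lo_hi_of_neg (show (-1 : ℝ) < 0 by norm_num) w hr.2
    rw [h1.1, h1.2, h2.1, h2.2]
    constructor <;> ring
  refine ⟨fun h r hr => ?_, fun h => ext_lo_hi fun r hr => ?_⟩
  · rw [IsHDiffII] at h
    rw [h]; exact e r hr
  · rw [(e r hr).1, (e r hr).2]; exact h r hr

/-! ### The embedding into a Banach space -/

/-- The Banach space of the pairs of continuous functions on `[0,1]`. -/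
abbrev EndSpace : Type := C(Icc (0 : ℝ) 1, ℝ) × C(Icc (0 : ℝ) 1, ℝ)

/-- The Hausdorff distance of two intervals is the larger of the two end-point distances, so
continuity of the level map is continuity of both end points. This is what places `ends` in a space
of continuous functions. -/
lemma tendsto_lo_hi (p : FuzzyNum) {r : ℝ} (hr : r ∈ Icc (0 : ℝ) 1) :
    Tendsto p.lo (𝓝[Icc (0 : ℝ) 1] r) (𝓝 (p.lo r)) ∧
      Tendsto p.hi (𝓝[Icc (0 : ℝ) 1] r) (𝓝 (p.hi r)) := by
  have h := p.levelCont r hr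
  constructor
  all_goals
    rw [tendsto_iff_dist_tendsto_zero]
    refine squeeze_zero' (Eventually.of_forall fun _ => dist_nonneg) ?_ h
    filter_upwards [self_mem_nhdsWithin] with s hs
    have := hausdorffDist_level p p hs.2 hr.2
    rw [level, level] at this
    rw [this, Real.dist_eq]
  exacts [le_max_left _ _, le_max_right _ _]

lemma continuous_lo (p : FuzzyNum) : Continuous fun r : Icc (0 : ℝ) 1 => p.lo r :=
  continuousOn_iff_continuous_domRestrict.1 fun _ hr => (p.tendsto_lo_hi hr).1

lemma continuous_hi (p : FuzzyNum) : Continuous fun r : Icc (0 : ℝ) 1 => p.hi r :=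
  continuousOn_iff_continuous_domRestrict.1 fun _ hr => (p.tendsto_lo_hi hr).2

/-- The end points of the levels of a fuzzy number, as a pair of continuous functions. -/
noncomputable def ends (p : FuzzyNum) : EndSpace := (⟨_, p.continuous_lo⟩, ⟨_, p.continuous_hi⟩)

@[simp] lemma ends_fst (p : FuzzyNum) (r : Icc (0 : ℝ) 1) : (ends p).1 r = p.lo r := rfl

@[simp] lemma ends_snd (p : FuzzyNum) (r : Icc (0 : ℝ) 1) : (ends p).2 r = p.hi r := rfl

lemma ends_injective : Function.Injective ends := fun p q h => ext_lo_hi fun r hr => by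
  refine ⟨?_, ?_⟩
  · rw [← ends_fst p ⟨r, hr⟩, h]; rfl
  · rw [← ends_snd p ⟨r, hr⟩, h]; rfl

lemma ends_add (p q : FuzzyNum) : ends (p + q) = ends p + ends q := by
  ext r
  · exact (add_lo_hi p q r.2.2).1
  · exact (add_lo_hi p q r.2.2).2

lemma ends_smul {c : ℝ} (hc : 0 < c) (p : FuzzyNum) : ends (c • p) = c • ends p := by
  ext r
  · exact (smul_lo_hi hc p r.2.2).1
  · exact (smul_lo_hi hc p r.2.2).2

lemma ends_neg_smul {c : ℝ} (hc : c < 0) (p : FuzzyNum) : ends (c • p) = c • (ends p).swap := by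
  ext r
  · exact (smul_lo_hi_of_neg hc p r.2.2).1
  · exact (smul_lo_hi_of_neg hc p r.2.2).2

lemma ends_zero : ends 0 = 0 := by
  ext r
  · exact (zero_lo_hi r.2.2).1
  · exact (zero_lo_hi r.2.2).2

/-- Evaluation of the first component. -/
noncomputable def evalLo (r : Icc (0 : ℝ) 1) : EndSpace →L[ℝ] ℝ :=
  (ContinuousMap.evalCLM ℝ r).comp (ContinuousLinearMap.fst ℝ _ _)

/-- Evaluation of the second component. -/
noncomputable def evalHi (r : Icc (0 : ℝ) 1) : EndSpace →L[ℝ] ℝ :=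
  (ContinuousMap.evalCLM ℝ r).comp (ContinuousLinearMap.snd ℝ _ _)

lemma norm_eval_le (w : EndSpace) (r : Icc (0 : ℝ) 1) : |w.1 r| ≤ ‖w‖ ∧ |w.2 r| ≤ ‖w‖ :=
  ⟨(w.1.norm_coe_le_norm r).trans (norm_fst_le w), (w.2.norm_coe_le_norm r).trans (norm_snd_le w)⟩

/-- Levelwise the Hausdorff distance is the larger end-point distance, and its supremum over the
levels is the sup norm of the pair. Limits for 𝔻 thereby become limits in a Banach space. -/
lemma D_eq_norm (p q : FuzzyNum) : D p q = ‖ends p - ends q‖ := by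
  have e : ∀ r : Icc (0 : ℝ) 1, Metric.hausdorffDist (p.level r) (q.level r) =
      max |(ends p - ends q).1 r| |(ends p - ends q).2 r| :=
    fun r => hausdorffDist_level p q r.2.2 r.2.2
  have hb : ∀ r : Icc (0 : ℝ) 1, max |(ends p - ends q).1 r| |(ends p - ends q).2 r| ≤
      ‖ends p - ends q‖ := fun r => max_le (norm_eval_le _ r).1 (norm_eval_le _ r).2
  have hbdd : BddAbove (range fun r : Icc (0 : ℝ) 1 =>
      Metric.hausdorffDist (p.level r) (q.level r)) := by
    refine ⟨‖ends p - ends q‖, ?_⟩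
    rintro _ ⟨r, rfl⟩
    exact (e r).trans_le (hb r)
  have h0 : 0 ≤ D p q := Real.iSup_nonneg fun r => Metric.hausdorffDist_nonneg
  refine le_antisymm (ciSup_le fun r => (e r).trans_le (hb r)) ?_
  rw [Prod.norm_def]
  refine max_le ((ContinuousMap.norm_le _ h0).2 fun r => ?_)
    ((ContinuousMap.norm_le _ h0).2 fun r => ?_)
  · exact ((le_max_left _ _).trans_eq (e r).symm).trans (le_ciSup hbdd r)
  · exact ((le_max_right _ _).trans_eq (e r).symm).trans (le_ciSup hbdd r)

lemma tendsto_D_iff {α : Type*} {l : Filter α} (f : α → FuzzyNum) (p : FuzzyNum) :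
    Tendsto (fun u => D (f u) p) l (𝓝 0) ↔ Tendsto (fun u => ends (f u)) l (𝓝 (ends p)) := by
  simp only [D_eq_norm]
  exact tendsto_iff_norm_sub_tendsto_zero.symm

lemma contOn_iff (f : ℝ → ℝ → FuzzyNum) (S : Set (ℝ × ℝ)) :
    ContOn f S ↔ ContinuousOn (fun p : ℝ × ℝ => ends (f p.1 p.2)) S :=
  forall₂_congr fun _ _ => tendsto_D_iff _ _

/-! ### Fuzzy numbers with prescribed end points -/

/-- The closed convex cone of the pairs which are the end points of the levels of a fuzzy number. -/
def endCone : Set EndSpace :=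
  {w | (∀ r s, r ≤ s → w.1 r ≤ w.1 s) ∧ (∀ r s, r ≤ s → w.2 s ≤ w.2 r) ∧ ∀ r, w.1 r ≤ w.2 r}

lemma ends_mem_endCone (p : FuzzyNum) : ends p ∈ endCone :=
  ⟨fun r s h => p.lo_mono r.2.1 h s.2.2, fun r s h => p.hi_anti r.2.1 h s.2.2,
    fun r => p.lo_le_hi r.2.2⟩

lemma smul_mem_endCone {w : EndSpace} (hw : w ∈ endCone) {c : ℝ} (hc : 0 ≤ c) :
    c • w ∈ endCone :=
  ⟨fun r s h => mul_le_mul_of_nonneg_left (hw.1 r s h) hc,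
    fun r s h => mul_le_mul_of_nonneg_left (hw.2.1 r s h) hc,
    fun r => mul_le_mul_of_nonneg_left (hw.2.2 r) hc⟩

/-- The membership function with the given end points of the levels. -/
noncomputable def memberFun (w : EndSpace) (x : ℝ) : ℝ :=
  sSup {t : ℝ | ∃ r : Icc (0 : ℝ) 1, t = r ∧ w.1 r ≤ x ∧ x ≤ w.2 r}

lemma bddAbove_memberFun (w : EndSpace) (x : ℝ) :
    BddAbove {t : ℝ | ∃ r : Icc (0 : ℝ) 1, t = r ∧ w.1 r ≤ x ∧ x ≤ w.2 r} :=
  ⟨1, by rintro _ ⟨r, rfl, -⟩; exact r.2.2⟩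

lemma memberFun_nonneg (w : EndSpace) (x : ℝ) : 0 ≤ memberFun w x :=
  Real.sSup_nonneg (by rintro _ ⟨r, rfl, -⟩; exact r.2.1)

lemma memberFun_le_one (w : EndSpace) (x : ℝ) : memberFun w x ≤ 1 :=
  Real.sSup_le (by rintro _ ⟨r, rfl, -⟩; exact r.2.2) zero_le_one

/-- Continuity of the end points makes the set of admissible levels compact, so the supremum is
attained; admissibility then passes down to r because the intervals shrink as the level grows.
Positivity of r excludes the value 0 of an empty supremum. -/
lemma le_memberFun_iff {w : EndSpace} (hw : w ∈ endCone) {r : Icc (0 : ℝ) 1} (hr : 0 < (r : ℝ))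
    (x : ℝ) : (r : ℝ) ≤ memberFun w x ↔ w.1 r ≤ x ∧ x ≤ w.2 r := by
  refine ⟨fun h => ?_, fun h => le_csSup (bddAbove_memberFun w x) ⟨r, rfl, h⟩⟩
  have hne : {t : ℝ | ∃ r : Icc (0 : ℝ) 1, t = r ∧ w.1 r ≤ x ∧ x ≤ w.2 r}.Nonempty := by
    by_contra hne
    rw [not_nonempty_iff_eq_empty] at hne
    rw [memberFun, hne, Real.sSup_empty] at h
    exact absurd h (not_le.2 hr)
  have himg : {t : ℝ | ∃ r : Icc (0 : ℝ) 1, t = r ∧ w.1 r ≤ x ∧ x ≤ w.2 r} =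
      (fun r : Icc (0 : ℝ) 1 => (r : ℝ)) '' {r | w.1 r ≤ x ∧ x ≤ w.2 r} := by
    ext t
    constructor
    · rintro ⟨r, rfl, h⟩; exact ⟨r, h, rfl⟩
    · rintro ⟨r, h, rfl⟩; exact ⟨r, rfl, h⟩
  have hcl : IsClosed {r : Icc (0 : ℝ) 1 | w.1 r ≤ x ∧ x ≤ w.2 r} :=
    (isClosed_le w.1.continuous continuous_const).inter
      (isClosed_le continuous_const w.2.continuous)
  have hcomp : IsCompact {t : ℝ | ∃ r : Icc (0 : ℝ) 1, t = r ∧ w.1 r ≤ x ∧ x ≤ w.2 r} := by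
    rw [himg]; exact hcl.isCompact.image continuous_subtype_val
  obtain ⟨s, hs, h1, h2⟩ := hcomp.sSup_mem hne
  have hrs : r ≤ s := by
    change (r : ℝ) ≤ s
    rw [← hs]; exact h
  exact ⟨(hw.1 r s hrs).trans h1, h2.trans (hw.2.1 r s hrs)⟩

/-- Level 0 is a closure and needs its own argument: a point of [w.1 0, w.2 0] is the limit, as r
decreases to 0, of its projections onto the intervals with r > 0, where the membership function is
positive. -/
lemma fuzzyLevel_memberFun {w : EndSpace} (hw : w ∈ endCone) (r : Icc (0 : ℝ) 1) :
    fuzzyLevel (memberFun w) r = Icc (w.1 r) (w.2 r) := by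
  unfold fuzzyLevel
  split_ifs with h
  · ext x; exact le_memberFun_iff hw h x
  · obtain rfl : r = 0 := Subtype.ext (le_antisymm (not_lt.1 h) r.2.1)
    refine Subset.antisymm (closure_minimal (fun x hx => ?_) isClosed_Icc) fun x hx => ?_
    · have hx : 0 < memberFun w x := hx
      have := (le_memberFun_iff hw (r := ⟨memberFun w x, hx.le, memberFun_le_one w x⟩) hx x).1 le_rfl
      exact ⟨(hw.1 0 _ hx.le).trans this.1, this.2.trans (hw.2.1 0 _ hx.le)⟩
    · have hc : Continuous fun r : Icc (0 : ℝ) 1 => max (w.1 r) (min x (w.2 r)) := by fun_prop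
      have h0 : max (w.1 0) (min x (w.2 0)) = x := by rw [min_eq_left hx.2, max_eq_right hx.1]
      have hd : (0 : Icc (0 : ℝ) 1) ∈ closure {r : Icc (0 : ℝ) 1 | 0 < (r : ℝ)} := by
        have : {r : Icc (0 : ℝ) 1 | 0 < (r : ℝ)} = Ioi 0 := rfl
        rw [this, closure_Ioi' ⟨1, by simp⟩]
        exact self_mem_Ici
      have := map_mem_closure hc hd (t := {x | 0 < memberFun w x}) fun r (hr : 0 < (r : ℝ)) =>
        hr.trans_le ((le_memberFun_iff hw hr _).2
          ⟨le_max_left _ _, max_le (hw.2.2 r) (min_le_right _ _)⟩)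
      rwa [h0] at this

lemma isFuzzyNumber_memberFun {w : EndSpace} (hw : w ∈ endCone) : IsFuzzyNumber (memberFun w) where
  nonneg := memberFun_nonneg w
  le_one := memberFun_le_one w
  normal := ⟨w.1 1, le_antisymm (memberFun_le_one w _)
    ((le_memberFun_iff hw (r := 1) one_pos _).2 ⟨le_rfl, hw.2.2 1⟩)⟩
  convex x₁ x₂ t h0 h1 := by
    rcases le_or_gt (min (memberFun w x₁) (memberFun w x₂)) 0 with h | h
    · exact h.trans (memberFun_nonneg w _)
    · obtain ⟨r, hr⟩ : ∃ r : Icc (0 : ℝ) 1, (r : ℝ) = min (memberFun w x₁) (memberFun w x₂) :=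
        ⟨⟨_, h.le, (min_le_left _ _).trans (memberFun_le_one w _)⟩, rfl⟩
      rw [← hr] at h ⊢
      have a₁ := (le_memberFun_iff hw h x₁).1 (hr ▸ min_le_left _ _)
      have a₂ := (le_memberFun_iff hw h x₂).1 (hr ▸ min_le_right _ _)
      have := convex_Icc (w.1 r) (w.2 r) a₁ a₂ h0 (sub_nonneg.2 h1) (by ring)
      exact (le_memberFun_iff hw h _).2 this
  usc := by
    rw [upperSemicontinuous_iff_isClosed_preimage]
    intro r
    rcases le_or_gt r 0 with h0 | h0
    · convert isClosed_univ
      exact eq_univ_of_forall fun x => h0.trans (memberFun_nonneg w x)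
    · rcases le_or_gt r 1 with h1 | h1
      · have : memberFun w ⁻¹' Ici r = fuzzyLevel (memberFun w) r := by
          simp only [fuzzyLevel, if_pos h0]; rfl
        rw [this, fuzzyLevel_memberFun hw ⟨r, h0.le, h1⟩]
        exact isClosed_Icc
      · convert isClosed_empty
        exact eq_empty_of_forall_notMem fun x (hx : r ≤ memberFun w x) =>
          absurd (hx.trans (memberFun_le_one w x)) (not_le.2 h1)
  compact_support := by
    refine HasCompactSupport.intro (isCompact_Icc (a := w.1 0) (b := w.2 0)) fun x hx => ?_
    by_contra hne
    refine hx ?_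
    rw [← fuzzyLevel_memberFun hw 0]
    simp only [fuzzyLevel, Icc.coe_zero, lt_irrefl, if_false]
    exact subset_closure ((memberFun_nonneg w x).lt_of_ne' hne)

lemma isLevelContinuous_memberFun {w : EndSpace} (hw : w ∈ endCone) :
    IsLevelContinuous (memberFun w) := by
  intro r hr
  rw [tendsto_nhdsWithin_iff_subtype hr]
  have : (Icc (0 : ℝ) 1).domRestrict
      (fun s => Metric.hausdorffDist (fuzzyLevel (memberFun w) s) (fuzzyLevel (memberFun w) r)) =
      fun s => max |w.1 s - w.1 ⟨r, hr⟩| |w.2 s - w.2 ⟨r, hr⟩| := by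
    funext s
    rw [domRestrict_apply, fuzzyLevel_memberFun hw s, fuzzyLevel_memberFun hw ⟨r, hr⟩,
      hausdorffDist_Icc (hw.2.2 _) (hw.2.2 _)]
  rw [this]
  have hc : Continuous fun s => max |w.1 s - w.1 ⟨r, hr⟩| |w.2 s - w.2 ⟨r, hr⟩| := by fun_prop
  simpa using hc.tendsto ⟨r, hr⟩

/-- Together with `ends_mem_endCone` this identifies the image of `ends`. It turns integrals
computed in `EndSpace` back into fuzzy numbers. -/
lemma exists_ends_eq {w : EndSpace} (hw : w ∈ endCone) : ∃ p, ends p = w := by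
  let p : FuzzyNum := ⟨memberFun w, isFuzzyNumber_memberFun hw, isLevelContinuous_memberFun hw⟩
  have h := fun r : Icc (0 : ℝ) 1 => p.lo_hi_of_level_eq r.2.2 (fuzzyLevel_memberFun hw r)
  refine ⟨p, ?_⟩
  ext r
  · exact (h r).2.1
  · exact (h r).2.2

end FuzzyNum

/-! ### The one-dimensional Katugampola kernel -/

/-- The Beta density has total mass one; integrability and value are both read off from this. -/
lemma integrableOn_beta {α β : ℝ} (hα : 0 < α) (hβ : 0 < β) :
    IntegrableOn (fun v : ℝ => v ^ (β - 1) * (1 - v) ^ (α - 1)) (Ioo 0 1) ∧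
      ∫ v in Ioo (0 : ℝ) 1, v ^ (β - 1) * (1 - v) ^ (α - 1) =
        Real.Gamma α * Real.Gamma β / Real.Gamma (α + β) := by
  have hB := ProbabilityTheory.beta_pos hβ hα
  have hlint : ∫⁻ v in Ioo (0 : ℝ) 1, ENNReal.ofReal (v ^ (β - 1) * (1 - v) ^ (α - 1)) =
      ENNReal.ofReal (ProbabilityTheory.beta β α) := by
    have h1 := ProbabilityTheory.lintegral_betaPDF_eq_one hβ hα
    rw [ProbabilityTheory.lintegral_betaPDF] at h1
    have h2 : ∫⁻ v in Ioo (0 : ℝ) 1, ENNReal.ofReal (v ^ (β - 1) * (1 - v) ^ (α - 1)) =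
        ENNReal.ofReal (ProbabilityTheory.beta β α) * ∫⁻ v in Ioo (0 : ℝ) 1,
          ENNReal.ofReal ((1 / ProbabilityTheory.beta β α) * v ^ (β - 1) * (1 - v) ^ (α - 1)) := by
      rw [← lintegral_const_mul' _ _ ENNReal.ofReal_ne_top]
      refine lintegral_congr fun v => ?_
      rw [← ENNReal.ofReal_mul hB.le]
      congr 1
      field_simp
    rw [h2, h1, mul_one]
  have hnn : ∀ v ∈ Ioo (0 : ℝ) 1, 0 ≤ v ^ (β - 1) * (1 - v) ^ (α - 1) := fun v hv =>
    mul_nonneg (Real.rpow_nonneg hv.1.le _) (Real.rpow_nonneg (sub_pos.2 hv.2).le _)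
  have hae : 0 ≤ᵐ[volume.restrict (Ioo (0 : ℝ) 1)] fun v : ℝ => v ^ (β - 1) * (1 - v) ^ (α - 1) :=
    (ae_restrict_iff' measurableSet_Ioo).2 (Eventually.of_forall hnn)
  have hmeas : AEStronglyMeasurable (fun v : ℝ => v ^ (β - 1) * (1 - v) ^ (α - 1))
      (volume.restrict (Ioo (0 : ℝ) 1)) := by
    refine Measurable.aestronglyMeasurable ?_
    fun_prop
  constructor
  · refine ⟨hmeas, (hasFiniteIntegral_iff_ofReal hae).2 ?_⟩
    rw [hlint]; exact ENNReal.ofReal_lt_top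
  · rw [integral_eq_lintegral_of_nonneg_ae hae hmeas, hlint, ENNReal.toReal_ofReal hB.le,
      ProbabilityTheory.beta, mul_comm (Real.Gamma β), add_comm β]

namespace FuzzyNum

/-- The kernel of the one-dimensional Katugampola integral of order `α`. -/
noncomputable def katKernelOne (α ρ x s : ℝ) : ℝ :=
  ρ ^ (1 - α) / Real.Gamma α * (s ^ (ρ - 1) / (x ^ ρ - s ^ ρ) ^ (1 - α))

lemma katKernel_eq_mul (α ρ : ℝ × ℝ) (x y : ℝ) (p : ℝ × ℝ) :
    katKernel α ρ x y p = katKernelOne α.1 ρ.1 x p.1 * katKernelOne α.2 ρ.2 y p.2 := by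
  simp only [katKernel, katKernelOne, div_eq_mul_inv, mul_inv]
  ring

lemma rpow_sub_pos {ρ x s : ℝ} (hρ : 0 < ρ) (hs : 0 ≤ s) (hsx : s < x) : 0 < x ^ ρ - s ^ ρ :=
  sub_pos.2 (Real.rpow_lt_rpow hs hsx hρ)

lemma katKernelOne_pos {α ρ x s : ℝ} (hα : 0 < α) (hρ : 0 < ρ) (hs : 0 < s) (hsx : s < x) :
    0 < katKernelOne α ρ x s := by
  have h1 := Real.Gamma_pos_of_pos hα
  have h2 := Real.rpow_pos_of_pos (rpow_sub_pos hρ hs.le hsx) (1 - α)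
  have h3 := Real.rpow_pos_of_pos hs (ρ - 1)
  have h4 := Real.rpow_pos_of_pos hρ (1 - α)
  unfold katKernelOne
  positivity

lemma measurable_katKernelOne (α ρ : ℝ) :
    Measurable fun q : ℝ × ℝ => katKernelOne α ρ q.1 q.2 := by
  unfold katKernelOne
  fun_prop

/-- A Beta integral after the substitution `z = u ^ ρ`. -/
lemma integral_katKernelOne_mul_rpow {α β ρ x s : ℝ} (hα : 0 < α) (hβ : 0 < β) (hρ : 0 < ρ)
    (hs : 0 ≤ s) (hsx : s < x) :
    IntegrableOn (fun u => katKernelOne α ρ x u * (u ^ ρ - s ^ ρ) ^ (β - 1)) (Ioo s x) ∧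
      ∫ u in Ioo s x, katKernelOne α ρ x u * (u ^ ρ - s ^ ρ) ^ (β - 1) =
        ρ ^ (-α) * Real.Gamma β / Real.Gamma (α + β) * (x ^ ρ - s ^ ρ) ^ (α + β - 1) := by
  set S := s ^ ρ
  set X := x ^ ρ
  have hXS : 0 < X - S := rpow_sub_pos hρ hs hsx
  -- The affine normalisation of u^ρ that maps (s, x) onto (0, 1).
  set f : ℝ → ℝ := fun u => (u ^ ρ - S) / (X - S)
  set f' : ℝ → ℝ := fun u => ρ * u ^ (ρ - 1) / (X - S)
  have hf' : ∀ u ∈ Ioo s x, HasDerivWithinAt f (f' u) (Ioo s x) u := fun u hu =>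
    (((Real.hasDerivAt_rpow_const (Or.inl (hs.trans_lt hu.1).ne')).sub_const S).div_const
      (X - S)).hasDerivWithinAt
  have hmono : StrictMonoOn f (Icc s x) := fun u hu v hv huv =>
    div_lt_div_of_pos_right (sub_lt_sub_right (Real.rpow_lt_rpow (hs.trans hu.1) huv hρ) S) hXS
  have hcont : ContinuousOn f (Icc s x) :=
    ((Real.continuous_rpow_const hρ.le).sub continuous_const).div_const _ |>.continuousOn
  have hfs : f s = 0 := by simp [f, S]
  have hfx : f x = 1 := div_self hXS.ne'
  have himg : f '' Ioo s x = Ioo 0 1 := by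
    refine Subset.antisymm ?_ ?_
    · rintro _ ⟨u, hu, rfl⟩
      rw [← hfs, ← hfx]
      exact ⟨hmono (left_mem_Icc.2 hsx.le) (Ioo_subset_Icc_self hu) hu.1,
        hmono (Ioo_subset_Icc_self hu) (right_mem_Icc.2 hsx.le) hu.2⟩
    · have := intermediate_value_Ioo hsx.le hcont
      rwa [hfs, hfx] at this
  have hinj : InjOn f (Ioo s x) := hmono.injOn.mono Ioo_subset_Icc_self
  obtain ⟨h1, h2⟩ := integrableOn_beta hα hβ
  rw [← himg, integrableOn_image_iff_integrableOn_abs_deriv_smul measurableSet_Ioo hf' hinj] at h1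
  rw [← himg, integral_image_eq_integral_abs_deriv_smul measurableSet_Ioo hf' hinj] at h2
  -- What remains once the Beta integrand and the Jacobian |f'| are split off.
  set c : ℝ := ρ ^ (-α) / Real.Gamma α * (X - S) ^ (α + β - 1)
  have heq : ∀ u ∈ Ioo s x, katKernelOne α ρ x u * (u ^ ρ - S) ^ (β - 1) =
      c * (|f' u| • (f u ^ (β - 1) * (1 - f u) ^ (α - 1))) := by
    intro u hu
    have hu0 : 0 < u := hs.trans_lt hu.1
    have a1 : 0 < u ^ ρ - S := rpow_sub_pos hρ hs hu.1
    have a2 : 0 < X - u ^ ρ := rpow_sub_pos hρ hu0.le hu.2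
    have a3 : 0 < f' u := div_pos (mul_pos hρ (Real.rpow_pos_of_pos hu0 _)) hXS
    have e1 : 1 - f u = (X - u ^ ρ) / (X - S) := by
      simp only [f]; field_simp; ring
    rw [abs_of_pos a3, e1, smul_eq_mul, Real.div_rpow a1.le hXS.le, Real.div_rpow a2.le hXS.le]
    simp only [katKernelOne, f', c]
    have e2 : (X - S) ^ (α + β - 1) = (X - S) ^ (β - 1) * (X - S) ^ (α - 1) * (X - S) := by
      rw [← Real.rpow_add hXS, ← Real.rpow_add_one hXS.ne']; congr 1; ring
    have e3 : ρ ^ (1 - α) = ρ ^ (-α) * ρ := by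
      rw [← Real.rpow_add_one hρ.ne']; congr 1; ring
    have e4 : ((X - u ^ ρ) ^ (1 - α))⁻¹ = (X - u ^ ρ) ^ (α - 1) := by
      rw [← Real.rpow_neg a2.le]; congr 1; ring
    have p1 := Real.rpow_pos_of_pos hXS (β - 1)
    have p2 := Real.rpow_pos_of_pos hXS (α - 1)
    rw [e2, e3, div_eq_mul_inv _ ((X - u ^ ρ) ^ (1 - α)), e4]
    field_simp
  constructor
  · exact IntegrableOn.congr_fun (h1.const_mul c) (fun u hu => (heq u hu).symm) measurableSet_Ioo
  · rw [setIntegral_congr_fun measurableSet_Ioo heq, integral_const_mul, h2]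
    have := (Real.Gamma_pos_of_pos hα).ne'
    simp only [c]
    field_simp

/-- In u the second kernel is a constant multiple of (u^ρ - s^ρ)^(β-1), so the product reduces to
the preceding Beta integral. This is the semigroup law for the kernels. -/
lemma integral_katKernelOne_mul_katKernelOne {α β ρ x s : ℝ} (hα : 0 < α) (hβ : 0 < β)
    (hρ : 0 < ρ) (hs : 0 < s) (hsx : s < x) :
    IntegrableOn (fun u => katKernelOne α ρ x u * katKernelOne β ρ u s) (Ioo s x) ∧
      ∫ u in Ioo s x, katKernelOne α ρ x u * katKernelOne β ρ u s =
        katKernelOne (α + β) ρ x s := by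
  obtain ⟨h1, h2⟩ := integral_katKernelOne_mul_rpow hα hβ hρ hs.le hsx
  have hXS := rpow_sub_pos hρ hs.le hsx
  set c : ℝ := ρ ^ (1 - β) / Real.Gamma β * s ^ (ρ - 1)
  have heq : ∀ u ∈ Ioo s x, katKernelOne α ρ x u * katKernelOne β ρ u s =
      c * (katKernelOne α ρ x u * (u ^ ρ - s ^ ρ) ^ (β - 1)) := by
    intro u hu
    have e : ((u ^ ρ - s ^ ρ) ^ (1 - β))⁻¹ = (u ^ ρ - s ^ ρ) ^ (β - 1) := by
      rw [← Real.rpow_neg (rpow_sub_pos hρ hs.le hu.1).le]; congr 1; ring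
    rw [katKernelOne.eq_1 β, div_eq_mul_inv (s ^ (ρ - 1)), e]
    simp only [c]; ring
  constructor
  · exact IntegrableOn.congr_fun (h1.const_mul c) (fun u hu => (heq u hu).symm) measurableSet_Ioo
  · rw [setIntegral_congr_fun measurableSet_Ioo heq, integral_const_mul, h2]
    have e : ((x ^ ρ - s ^ ρ) ^ (1 - (α + β)))⁻¹ = (x ^ ρ - s ^ ρ) ^ (α + β - 1) := by
      rw [← Real.rpow_neg hXS.le]; congr 1; ring
    have e' : ρ ^ (1 - (α + β)) = ρ ^ (1 - β) * ρ ^ (-α) := by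
      rw [← Real.rpow_add hρ]; congr 1; ring
    have := (Real.Gamma_pos_of_pos hβ).ne'
    rw [katKernelOne.eq_1 (α + β), div_eq_mul_inv (s ^ (ρ - 1)), e, e']
    simp only [c]
    field_simp

/-- The case β = 1, s = 0 of the Beta integral, whose second factor is then 1. -/
lemma integral_katKernelOne {α ρ x : ℝ} (hα : 0 < α) (hρ : 0 < ρ) (hx : 0 < x) :
    IntegrableOn (katKernelOne α ρ x) (Ioo 0 x) ∧
      ∫ u in Ioo 0 x, katKernelOne α ρ x u =
        ρ ^ (-α) / Real.Gamma (α + 1) * (x ^ ρ) ^ α := by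
  have := integral_katKernelOne_mul_rpow hα one_pos hρ le_rfl hx
  simpa [Real.zero_rpow hρ.ne', Real.Gamma_one] using this

lemma katKernelOne_one (ρ x s : ℝ) : katKernelOne 1 ρ x s = s ^ (ρ - 1) := by
  simp [katKernelOne, Real.Gamma_one]

/-! ### The mixed kernel and the semigroup property -/

lemma katKernel_pos {α ρ : ℝ × ℝ} (hα₁ : 0 < α.1) (hα₂ : 0 < α.2) (hρ₁ : 0 < ρ.1) (hρ₂ : 0 < ρ.2)
    {x y : ℝ} {p : ℝ × ℝ} (hp : p ∈ Ioo 0 x ×ˢ Ioo 0 y) : 0 < katKernel α ρ x y p := by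
  rw [katKernel_eq_mul]
  exact mul_pos (katKernelOne_pos hα₁ hρ₁ hp.1.1 hp.1.2) (katKernelOne_pos hα₂ hρ₂ hp.2.1 hp.2.2)

lemma measurable_katKernel (α ρ : ℝ × ℝ) :
    Measurable fun q : (ℝ × ℝ) × (ℝ × ℝ) => katKernel α ρ q.1.1 q.1.2 q.2 := by
  unfold katKernel
  fun_prop

lemma measurable_katKernel_right (α ρ : ℝ × ℝ) (x y : ℝ) : Measurable (katKernel α ρ x y) := by
  unfold katKernel
  fun_prop

lemma measurableSet_rect (x y : ℝ) : MeasurableSet (Ioo (0 : ℝ) x ×ˢ Ioo (0 : ℝ) y) :=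
  measurableSet_Ioo.prod measurableSet_Ioo

/-- `KatIntegrable` only makes the product with the kernel measurable; dividing by the kernel,
positive on the rectangle, recovers measurability of μ. -/
lemma KatIntegrable.aestronglyMeasurable {α ρ : ℝ × ℝ} (hα₁ : 0 < α.1) (hα₂ : 0 < α.2)
    (hρ₁ : 0 < ρ.1) (hρ₂ : 0 < ρ.2) {μ : ℝ → ℝ → ℝ} {x y : ℝ} (h : KatIntegrable α ρ μ x y) :
    AEStronglyMeasurable (fun p : ℝ × ℝ => μ p.1 p.2)
      (volume.restrict (Ioo 0 x ×ˢ Ioo 0 y)) := by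
  have h1 := (measurable_katKernel_right α ρ x y).inv.aestronglyMeasurable.mul
    (Integrable.aestronglyMeasurable h)
  refine h1.congr ((ae_restrict_iff' (measurableSet_rect x y)).2 (Eventually.of_forall ?_))
  intro p hp
  exact inv_mul_cancel_left₀ (katKernel_pos hα₁ hα₂ hρ₁ hρ₂ hp).ne' _

lemma katKernel_integrableOn {α ρ : ℝ × ℝ} (hα₁ : 0 < α.1) (hα₂ : 0 < α.2)
    (hρ₁ : 0 < ρ.1) (hρ₂ : 0 < ρ.2) {x y : ℝ} (hx : 0 < x) (hy : 0 < y) :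
    IntegrableOn (katKernel α ρ x y) (Ioo 0 x ×ˢ Ioo 0 y) ∧
      ∫ p in Ioo 0 x ×ˢ Ioo 0 y, katKernel α ρ x y p =
        ρ.1 ^ (-α.1) / Real.Gamma (α.1 + 1) * (x ^ ρ.1) ^ α.1 *
          (ρ.2 ^ (-α.2) / Real.Gamma (α.2 + 1) * (y ^ ρ.2) ^ α.2) := by
  obtain ⟨h1, e1⟩ := integral_katKernelOne hα₁ hρ₁ hx
  obtain ⟨h2, e2⟩ := integral_katKernelOne hα₂ hρ₂ hy
  have e : katKernel α ρ x y = fun p => katKernelOne α.1 ρ.1 x p.1 * katKernelOne α.2 ρ.2 y p.2 :=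
    funext fun p => katKernel_eq_mul α ρ x y p
  rw [e]
  constructor
  · rw [IntegrableOn, Measure.volume_eq_prod, ← Measure.prod_restrict]
    exact h1.mul_prod h2
  · rw [← e1, ← e2, Measure.volume_eq_prod]
    exact setIntegral_prod_mul _ _ _ _

lemma integral_katKernel_mul_katKernel {α β ρ : ℝ × ℝ} (hα₁ : 0 < α.1) (hα₂ : 0 < α.2)
    (hβ₁ : 0 < β.1) (hβ₂ : 0 < β.2) (hρ₁ : 0 < ρ.1) (hρ₂ : 0 < ρ.2) {x y : ℝ} {s : ℝ × ℝ}
    (hs : s ∈ Ioo 0 x ×ˢ Ioo 0 y) :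
    IntegrableOn (fun u : ℝ × ℝ => katKernel α ρ x y u * katKernel β ρ u.1 u.2 s)
        (Ioo s.1 x ×ˢ Ioo s.2 y) ∧
      ∫ u in Ioo s.1 x ×ˢ Ioo s.2 y, katKernel α ρ x y u * katKernel β ρ u.1 u.2 s =
        katKernel (α + β) ρ x y s := by
  obtain ⟨h1, e1⟩ := integral_katKernelOne_mul_katKernelOne hα₁ hβ₁ hρ₁ hs.1.1 hs.1.2
  obtain ⟨h2, e2⟩ := integral_katKernelOne_mul_katKernelOne hα₂ hβ₂ hρ₂ hs.2.1 hs.2.2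
  have e : (fun u : ℝ × ℝ => katKernel α ρ x y u * katKernel β ρ u.1 u.2 s) =
      fun u => (katKernelOne α.1 ρ.1 x u.1 * katKernelOne β.1 ρ.1 u.1 s.1) *
        (katKernelOne α.2 ρ.2 y u.2 * katKernelOne β.2 ρ.2 u.2 s.2) := by
    funext u
    rw [katKernel_eq_mul, katKernel_eq_mul]; ring
  rw [e]
  constructor
  · rw [IntegrableOn, Measure.volume_eq_prod, ← Measure.prod_restrict]
    exact h1.mul_prod h2
  · rw [katKernel_eq_mul (α + β), Prod.fst_add, Prod.snd_add, ← e1, ← e2, Measure.volume_eq_prod]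
    exact setIntegral_prod_mul (fun u => katKernelOne α.1 ρ.1 x u * katKernelOne β.1 ρ.1 u s.1)
      (fun u => katKernelOne α.2 ρ.2 y u * katKernelOne β.2 ρ.2 u s.2) _ _

/-- The semigroup property of the mixed Katugampola integrals. -/
lemma katInt_katInt {α β ρ : ℝ × ℝ} (hα₁ : 0 < α.1) (hα₂ : 0 < α.2)
    (hβ₁ : 0 < β.1) (hβ₂ : 0 < β.2) (hρ₁ : 0 < ρ.1) (hρ₂ : 0 < ρ.2) {μ : ℝ → ℝ → ℝ} {x y : ℝ}
    (h : KatIntegrable (α + β) ρ μ x y) :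
    KatIntegrable α ρ (katInt β ρ μ) x y ∧
      katInt α ρ (katInt β ρ μ) x y = katInt (α + β) ρ μ x y := by
  set R : Set (ℝ × ℝ) := Ioo 0 x ×ˢ Ioo 0 y
  have hR : MeasurableSet R := measurableSet_rect x y
  set ν : Measure (ℝ × ℝ) := volume.restrict R
  have hμ := h.aestronglyMeasurable (α := α + β) (add_pos hα₁ hβ₁) (add_pos hα₂ hβ₂) hρ₁ hρ₂
  -- The region s < u, in both coordinates, of the iterated integral. Cutting off by its indicator
  -- moves everything to the fixed product R × R, where Fubini applies.
  set T : Set ((ℝ × ℝ) × (ℝ × ℝ)) := {q | q.2.1 < q.1.1} ∩ {q | q.2.2 < q.1.2}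
  have hT : MeasurableSet T :=
    (measurableSet_lt (by fun_prop) (by fun_prop)).inter
      (measurableSet_lt (by fun_prop) (by fun_prop))
  set K : (ℝ × ℝ) × (ℝ × ℝ) → ℝ :=
    T.indicator fun q => katKernel α ρ x y q.1 * katKernel β ρ q.1.1 q.1.2 q.2
  have hK : Measurable K :=
    (((measurable_katKernel_right α ρ x y).comp measurable_fst).mul
      (measurable_katKernel β ρ)).indicator hT
  set G : (ℝ × ℝ) × (ℝ × ℝ) → ℝ := fun q => K q * μ q.2.1 q.2.2
  have hG : AEStronglyMeasurable G (ν.prod ν) := hK.aestronglyMeasurable.mul hμ.comp_snd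
  have hnn : ∀ u ∈ R, ∀ s ∈ R, 0 ≤ K (u, s) := by
    intro u hu s hs
    refine indicator_apply_nonneg fun hT => ?_
    exact (mul_pos (katKernel_pos hα₁ hα₂ hρ₁ hρ₂ hu)
      (katKernel_pos hβ₁ hβ₂ hρ₁ hρ₂ ⟨⟨hs.1.1, hT.1⟩, ⟨hs.2.1, hT.2⟩⟩)).le
  have hind : ∀ s ∈ R, ∀ u, K (u, s) = (Ioi s.1 ×ˢ Ioi s.2).indicator
      (fun u : ℝ × ℝ => katKernel α ρ x y u * katKernel β ρ u.1 u.2 s) u := fun s hs u => rfl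
  have hset : ∀ s ∈ R, R ∩ Ioi s.1 ×ˢ Ioi s.2 = Ioo s.1 x ×ˢ Ioo s.2 y := by
    intro s hs
    rw [prod_inter_prod]
    congr 1
    · ext u; exact ⟨fun hu => ⟨hu.2, hu.1.2⟩, fun hu => ⟨⟨hs.1.1.trans hu.1, hu.2⟩, hu.1⟩⟩
    · ext u; exact ⟨fun hu => ⟨hu.2, hu.1.2⟩, fun hu => ⟨⟨hs.2.1.trans hu.1, hu.2⟩, hu.1⟩⟩
  have hKs : ∀ s ∈ R, Integrable (fun u => K (u, s)) ν ∧
      ∫ u, K (u, s) ∂ν = katKernel (α + β) ρ x y s := by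
    intro s hs
    obtain ⟨h1, e1⟩ := integral_katKernel_mul_katKernel hα₁ hα₂ hβ₁ hβ₂ hρ₁ hρ₂ hs
    have hm : MeasurableSet (Ioi s.1 ×ˢ Ioi s.2) := measurableSet_Ioi.prod measurableSet_Ioi
    simp only [hind s hs]
    constructor
    · rw [integrable_indicator_iff hm, IntegrableOn, Measure.restrict_restrict hm, inter_comm,
        hset s hs]
      exact h1
    · rw [setIntegral_indicator hm, hset s hs, e1]
  -- Integrating |G| in u first leaves the kernel of order α + β times |μ|, which is integrable by
  -- hypothesis.
  have hGint : Integrable G (ν.prod ν) := by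
    rw [integrable_prod_iff' hG]
    constructor
    · refine (ae_restrict_iff' hR).2 (Eventually.of_forall fun s hs => ?_)
      exact (hKs s hs).1.mul_const (μ s.1 s.2)
    · refine h.norm.congr ((ae_restrict_iff' hR).2 (Eventually.of_forall fun s hs => ?_))
      have e : ∫ u, ‖G (u, s)‖ ∂ν = ∫ u, K (u, s) * ‖μ s.1 s.2‖ ∂ν := by
        refine setIntegral_congr_fun hR fun u hu => ?_
        simp only [G, norm_mul]
        rw [Real.norm_of_nonneg (hnn u hu s hs)]
      simp only
      rw [e, integral_mul_const, (hKs s hs).2, norm_mul, Real.norm_of_nonneg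
        (katKernel_pos (add_pos hα₁ hβ₁) (add_pos hα₂ hβ₂) hρ₁ hρ₂ hs).le]
  have hGu : ∀ u ∈ R, ∫ s, G (u, s) ∂ν = katKernel α ρ x y u * katInt β ρ μ u.1 u.2 := by
    intro u hu
    have hm : MeasurableSet (Iio u.1 ×ˢ Iio u.2) := measurableSet_Iio.prod measurableSet_Iio
    have e : ∀ s, G (u, s) = (Iio u.1 ×ˢ Iio u.2).indicator (fun s : ℝ × ℝ =>
        katKernel α ρ x y u * (katKernel β ρ u.1 u.2 s * μ s.1 s.2)) s := by
      intro s
      simp only [G, K, indicator_apply]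
      have : (u, s) ∈ T ↔ s ∈ Iio u.1 ×ˢ Iio u.2 := Iff.rfl
      by_cases hs : s ∈ Iio u.1 ×ˢ Iio u.2
      · rw [if_pos (this.2 hs), if_pos hs, mul_assoc]
      · rw [if_neg (mt this.1 hs), if_neg hs, zero_mul]
    have hset' : R ∩ Iio u.1 ×ˢ Iio u.2 = Ioo 0 u.1 ×ˢ Ioo 0 u.2 := by
      rw [prod_inter_prod]
      congr 1
      · ext s; exact ⟨fun hs => ⟨hs.1.1, hs.2⟩, fun hs => ⟨⟨hs.1, hs.2.trans hu.1.2⟩, hs.2⟩⟩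
      · ext s; exact ⟨fun hs => ⟨hs.1.1, hs.2⟩, fun hs => ⟨⟨hs.1, hs.2.trans hu.2.2⟩, hs.2⟩⟩
    simp only [e]
    rw [setIntegral_indicator hm, hset', integral_const_mul, katInt]
  constructor
  · refine hGint.integral_prod_left.congr ((ae_restrict_iff' hR).2 (Eventually.of_forall hGu))
  · have e1 : katInt α ρ (katInt β ρ μ) x y = ∫ u, ∫ s, G (u, s) ∂ν ∂ν :=
      (setIntegral_congr_fun hR hGu).symm
    have e2 : katInt (α + β) ρ μ x y = ∫ s, ∫ u, G (u, s) ∂ν ∂ν := by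
      refine setIntegral_congr_fun hR fun s hs => ?_
      simp only [G]
      rw [integral_mul_const, (hKs s hs).2]
    rw [e1, e2]
    exact integral_integral_swap (f := fun u s => G (u, s)) hGint

/-! ### Monotonicity in the order -/

/-- The quotient of the kernels is a constant times (x^ρ - s^ρ)^(β-α), bounded because β ≥ α. The
absolute value keeps C non-negative without a sign condition on x. -/
lemma katKernelOne_le {α β ρ x : ℝ} (hα : 0 < α) (hαβ : α ≤ β) (hρ : 0 < ρ) :
    ∃ C, 0 ≤ C ∧ ∀ s ∈ Ioo 0 x, katKernelOne β ρ x s ≤ C * katKernelOne α ρ x s := by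
  have hβ := hα.trans_le hαβ
  have g1 := Real.Gamma_pos_of_pos hα
  have g2 := Real.Gamma_pos_of_pos hβ
  set c : ℝ := ρ ^ (1 - β) / Real.Gamma β / (ρ ^ (1 - α) / Real.Gamma α)
  have p1 := Real.rpow_pos_of_pos hρ (1 - β)
  have p2 := Real.rpow_pos_of_pos hρ (1 - α)
  have hc : 0 < c := by positivity
  refine ⟨c * |x ^ ρ| ^ (β - α), by positivity, fun s hs => ?_⟩
  have h0 := rpow_sub_pos hρ hs.1.le hs.2
  have hk := katKernelOne_pos hα hρ hs.1 hs.2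
  have e : katKernelOne β ρ x s = c * (x ^ ρ - s ^ ρ) ^ (β - α) * katKernelOne α ρ x s := by
    have e1 : (x ^ ρ - s ^ ρ) ^ (1 - α) = (x ^ ρ - s ^ ρ) ^ (β - α) * (x ^ ρ - s ^ ρ) ^ (1 - β) := by
      rw [← Real.rpow_add h0]; congr 1; ring
    have p3 := Real.rpow_pos_of_pos h0 (β - α)
    have p4 := Real.rpow_pos_of_pos h0 (1 - β)
    simp only [katKernelOne, e1, c]
    field_simp
  rw [e]
  refine mul_le_mul_of_nonneg_right (mul_le_mul_of_nonneg_left ?_ hc.le) hk.le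
  refine Real.rpow_le_rpow h0.le ?_ (sub_nonneg.2 hαβ)
  exact (sub_le_self _ (Real.rpow_nonneg hs.1.le _)).trans (le_abs_self _)

/-- Integrability is assumed at order φ only; orders 1 and φ + 1 are obtained from it here. -/
lemma KatIntegrable.mono_order {α β ρ : ℝ × ℝ} (hα₁ : 0 < α.1) (hα₂ : 0 < α.2)
    (h₁ : α.1 ≤ β.1) (h₂ : α.2 ≤ β.2) (hρ₁ : 0 < ρ.1) (hρ₂ : 0 < ρ.2) {μ : ℝ → ℝ → ℝ} {x y : ℝ}
    (h : KatIntegrable α ρ μ x y) : KatIntegrable β ρ μ x y := by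
  obtain ⟨C₁, hC₁, hb₁⟩ := katKernelOne_le (x := x) hα₁ h₁ hρ₁
  obtain ⟨C₂, hC₂, hb₂⟩ := katKernelOne_le (x := y) hα₂ h₂ hρ₂
  refine Integrable.mono' ((Integrable.norm h).const_mul (C₁ * C₂))
    ((measurable_katKernel_right β ρ x y).aestronglyMeasurable.mul
      (h.aestronglyMeasurable hα₁ hα₂ hρ₁ hρ₂))
    ((ae_restrict_iff' (measurableSet_rect x y)).2 (Eventually.of_forall fun p hp => ?_))
  rw [norm_mul, norm_mul, ← mul_assoc]
  refine mul_le_mul_of_nonneg_right ?_ (norm_nonneg _)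
  rw [Real.norm_of_nonneg (katKernel_pos (hα₁.trans_le h₁) (hα₂.trans_le h₂) hρ₁ hρ₂ hp).le,
    Real.norm_of_nonneg (katKernel_pos hα₁ hα₂ hρ₁ hρ₂ hp).le, katKernel_eq_mul, katKernel_eq_mul]
  calc _ ≤ (C₁ * katKernelOne α.1 ρ.1 x p.1) * (C₂ * katKernelOne α.2 ρ.2 y p.2) :=
        mul_le_mul (hb₁ _ hp.1) (hb₂ _ hp.2)
          (katKernelOne_pos (hα₂.trans_le h₂) hρ₂ hp.2.1 hp.2.2).le
          (mul_nonneg hC₁ (katKernelOne_pos hα₁ hρ₁ hp.1.1 hp.1.2).le)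
    _ = _ := by ring

/-- The bound is M times the total mass of the kernel. At order 1 - φ its positive powers of x and y
force the integral to vanish at the axes. -/
lemma katIntegrable_of_bdd {α ρ : ℝ × ℝ} (hα₁ : 0 < α.1) (hα₂ : 0 < α.2)
    (hρ₁ : 0 < ρ.1) (hρ₂ : 0 < ρ.2) {μ : ℝ → ℝ → ℝ} {x y M : ℝ} (hx : 0 < x) (hy : 0 < y)
    (hμ : AEStronglyMeasurable (fun p : ℝ × ℝ => μ p.1 p.2) (volume.restrict (Ioo 0 x ×ˢ Ioo 0 y)))
    (hM : ∀ p ∈ Ioo 0 x ×ˢ Ioo 0 y, |μ p.1 p.2| ≤ M) :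
    KatIntegrable α ρ μ x y ∧ |katInt α ρ μ x y| ≤ M * (ρ.1 ^ (-α.1) / Real.Gamma (α.1 + 1) *
      (x ^ ρ.1) ^ α.1 * (ρ.2 ^ (-α.2) / Real.Gamma (α.2 + 1) * (y ^ ρ.2) ^ α.2)) := by
  obtain ⟨h1, e1⟩ := katKernel_integrableOn hα₁ hα₂ hρ₁ hρ₂ hx hy
  have hbd : ∀ᵐ p ∂(volume.restrict (Ioo (0 : ℝ) x ×ˢ Ioo (0 : ℝ) y)),
      ‖katKernel α ρ x y p * μ p.1 p.2‖ ≤ M * katKernel α ρ x y p := by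
    refine (ae_restrict_iff' (measurableSet_rect x y)).2 (Eventually.of_forall fun p hp => ?_)
    have := (katKernel_pos hα₁ hα₂ hρ₁ hρ₂ hp).le
    rw [norm_mul, Real.norm_of_nonneg this, mul_comm M]
    exact mul_le_mul_of_nonneg_left (hM p hp) this
  refine ⟨Integrable.mono' (h1.const_mul M)
    ((measurable_katKernel_right α ρ x y).aestronglyMeasurable.mul hμ) hbd, ?_⟩
  rw [← e1, ← integral_const_mul]
  exact norm_integral_le_of_norm_le (h1.const_mul M) hbd

/-! ### Left difference quotients of the kernel -/

/-- The normalised left difference, between `x'` and `x`, of the kernel of order `α`. -/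
noncomputable def katDiff (α ρ x x' s : ℝ) : ℝ :=
  ρ / (x ^ ρ - x' ^ ρ) *
    (katKernelOne α ρ x s - (Iio x').indicator (katKernelOne α ρ x') s)

lemma measurable_katDiff (α ρ x x' : ℝ) : Measurable (katDiff α ρ x x') := by
  have h : ∀ x, Measurable (katKernelOne α ρ x) := fun x =>
    (measurable_katKernelOne α ρ).comp (measurable_const.prodMk measurable_id)
  exact measurable_const.mul ((h x).sub ((h x').indicator measurableSet_Iio))

lemma katKernelOne_add_one {φ ρ x s : ℝ} (hφ : 0 < φ) (hρ : 0 < ρ) (hs : 0 < s) (hsx : s < x) :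
    katKernelOne (φ + 1) ρ x s =
      ρ ^ (-φ) / (φ * Real.Gamma φ) * s ^ (ρ - 1) * (x ^ ρ - s ^ ρ) ^ φ := by
  have h0 := rpow_sub_pos hρ hs.le hsx
  have e : 1 - (φ + 1) = -φ := by ring
  rw [katKernelOne, Real.Gamma_add_one hφ.ne', e, Real.rpow_neg h0.le, div_inv_eq_mul, mul_assoc]

lemma katKernelOne_eq {φ ρ x s : ℝ} (hφ : 0 < φ) (hρ : 0 < ρ) (hs : 0 < s) (hsx : s < x) :
    katKernelOne φ ρ x s =
      φ * (ρ * (ρ ^ (-φ) / (φ * Real.Gamma φ) * s ^ (ρ - 1) * (x ^ ρ - s ^ ρ) ^ (φ - 1))) := by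
  have h0 := rpow_sub_pos hρ hs.le hsx
  have e : φ - 1 = -(1 - φ) := by ring
  have e' : ρ ^ (1 - φ) = ρ * ρ ^ (-φ) := by
    rw [sub_eq_add_neg, Real.rpow_add hρ, Real.rpow_one]
  have := (Real.Gamma_pos_of_pos hφ).ne'
  rw [katKernelOne, e', e, Real.rpow_neg h0.le]
  field_simp

/-- Since the power φ - 1 decreases, B^φ = B·B^(φ-1) ≥ B·A^(φ-1). Keeping the power at the larger
point A, unlike a mean value estimate, later gives a bound that does not depend on x'. -/
lemma rpow_sub_rpow_le {φ A B : ℝ} (h1 : φ ≤ 1) (hB : 0 < B) (hBA : B ≤ A) :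
    A ^ φ - B ^ φ ≤ (A - B) * A ^ (φ - 1) := by
  have hA := hB.trans_le hBA
  have e1 : A ^ φ = A * A ^ (φ - 1) := by
    rw [mul_comm, ← Real.rpow_add_one hA.ne']; congr 1; ring
  have e2 : B ^ φ = B * B ^ (φ - 1) := by
    rw [mul_comm, ← Real.rpow_add_one hB.ne']; congr 1; ring
  have h3 : A ^ (φ - 1) ≤ B ^ (φ - 1) := Real.rpow_le_rpow_of_nonpos hB hBA (by linarith)
  rw [e1, e2]
  nlinarith [mul_le_mul_of_nonneg_left h3 hB.le]

/-- The dominating function for the limit x' ↑ x. For s < x' it comes from `rpow_sub_rpow_le`; for s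
≥ x' the second kernel is absent and x^ρ - s^ρ ≤ x^ρ - x'^ρ gives the same bound. -/
lemma katDiff_add_one_mem {φ ρ x x' s : ℝ} (hφ : φ ∈ Ioo (0 : ℝ) 1) (hρ : 0 < ρ) (hx' : 0 < x')
    (hxx' : x' < x) (hs : s ∈ Ioo 0 x) :
    0 ≤ katDiff (φ + 1) ρ x x' s ∧ katDiff (φ + 1) ρ x x' s ≤ φ⁻¹ * katKernelOne φ ρ x s := by
  have hX := rpow_sub_pos hρ hx'.le hxx'
  have hXS := rpow_sub_pos hρ hs.1.le hs.2
  have hΓ := Real.Gamma_pos_of_pos hφ.1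
  have hc : 0 < ρ ^ (-φ) / (φ * Real.Gamma φ) * s ^ (ρ - 1) :=
    mul_pos (div_pos (Real.rpow_pos_of_pos hρ _) (mul_pos hφ.1 hΓ)) (Real.rpow_pos_of_pos hs.1 _)
  rw [katKernelOne_eq hφ.1 hρ hs.1 hs.2, inv_mul_cancel_left₀ hφ.1.ne', katDiff,
    katKernelOne_add_one hφ.1 hρ hs.1 hs.2]
  set c := ρ ^ (-φ) / (φ * Real.Gamma φ) * s ^ (ρ - 1)
  have key : ∀ d, 0 ≤ d → d ≤ (x ^ ρ - x' ^ ρ) * (x ^ ρ - s ^ ρ) ^ (φ - 1) →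
      0 ≤ ρ / (x ^ ρ - x' ^ ρ) * (c * d) ∧
        ρ / (x ^ ρ - x' ^ ρ) * (c * d) ≤ ρ * (c * (x ^ ρ - s ^ ρ) ^ (φ - 1)) := by
    intro d h0 h1
    refine ⟨by positivity, ?_⟩
    have : ρ / (x ^ ρ - x' ^ ρ) * (c * d) ≤
        ρ / (x ^ ρ - x' ^ ρ) * (c * ((x ^ ρ - x' ^ ρ) * (x ^ ρ - s ^ ρ) ^ (φ - 1))) := by gcongr
    refine this.trans_eq ?_
    field_simp
  by_cases hsx' : s < x'
  · rw [indicator_of_mem (show s ∈ Iio x' from hsx'), katKernelOne_add_one hφ.1 hρ hs.1 hsx',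
      ← mul_sub]
    have hB := rpow_sub_pos hρ hs.1.le hsx'
    have hBA : x' ^ ρ - s ^ ρ ≤ x ^ ρ - s ^ ρ := by linarith
    refine key _ (sub_nonneg.2 (Real.rpow_le_rpow hB.le hBA hφ.1.le)) ?_
    have := rpow_sub_rpow_le hφ.2.le hB hBA
    rwa [sub_sub_sub_cancel_right] at this
  · rw [indicator_of_notMem (show s ∉ Iio x' from hsx'), sub_zero]
    have hle : x' ^ ρ ≤ s ^ ρ := Real.rpow_le_rpow hx'.le (not_lt.1 hsx') hρ.le
    refine key _ (by positivity) ?_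
    have e1 : (x ^ ρ - s ^ ρ) ^ φ = (x ^ ρ - s ^ ρ) * (x ^ ρ - s ^ ρ) ^ (φ - 1) := by
      rw [mul_comm, ← Real.rpow_add_one hXS.ne']; congr 1; ring
    rw [e1]
    exact mul_le_mul_of_nonneg_right (by linarith) (Real.rpow_nonneg hXS.le _)

/-- In the variable z = x^ρ the kernel of order φ + 1 is a constant times (z - s^ρ)^φ, and ρ times
its z-derivative is the kernel of order φ. Once x' > s the cut-off plays no role. -/
lemma tendsto_katDiff {φ ρ x s : ℝ} (hφ : φ ∈ Ioo (0 : ℝ) 1) (hρ : 0 < ρ) (hs : s ∈ Ioo 0 x) :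
    Tendsto (fun x' => katDiff (φ + 1) ρ x x' s) (𝓝[<] x) (𝓝 (katKernelOne φ ρ x s)) := by
  have hXS := rpow_sub_pos hρ hs.1.le hs.2
  set c := ρ ^ (-φ) / (φ * Real.Gamma φ) * s ^ (ρ - 1)
  have hd : HasDerivAt (fun z : ℝ => (z - s ^ ρ) ^ φ) (φ * (x ^ ρ - s ^ ρ) ^ (φ - 1)) (x ^ ρ) := by
    simpa using ((hasDerivAt_id (x ^ ρ)).sub_const (s ^ ρ)).rpow_const (p := φ) (Or.inl hXS.ne')
  have ht : Tendsto (fun x' : ℝ => x' ^ ρ) (𝓝[<] x) (𝓝[≠] (x ^ ρ)) := by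
    refine tendsto_nhdsWithin_iff.2 ⟨?_, ?_⟩
    · exact ((Real.continuous_rpow_const hρ.le).tendsto x).mono_left nhdsWithin_le_nhds
    · filter_upwards [Ioo_mem_nhdsLT (hs.1.trans hs.2)] with x' hx'
      exact (Real.rpow_lt_rpow hx'.1.le hx'.2 hρ).ne
  have h := (((hasDerivAt_iff_tendsto_slope.1 hd).comp ht).const_mul (ρ * c))
  have e : katKernelOne φ ρ x s = ρ * c * (φ * (x ^ ρ - s ^ ρ) ^ (φ - 1)) := by
    rw [katKernelOne_eq hφ.1 hρ hs.1 hs.2]; ring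
  rw [e]
  refine h.congr' ?_
  filter_upwards [Ioo_mem_nhdsLT hs.2] with x' hx'
  have hX := rpow_sub_pos hρ (hs.1.trans hx'.1).le hx'.2
  have hX' : x' ^ ρ - x ^ ρ ≠ 0 := by linarith
  rw [katDiff, katKernelOne_add_one hφ.1 hρ hs.1 hs.2,
    indicator_of_mem (show s ∈ Iio x' from hx'.1), katKernelOne_add_one hφ.1 hρ hs.1 hx'.1,
    Function.comp_apply, slope_def_field]
  have : x' ^ ρ - x ^ ρ = -(x ^ ρ - x' ^ ρ) := by ring
  rw [this]
  field_simp
  ring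

/-- At order 1 the kernel does not depend on x, so on (0, x) the difference lives on [x', x). It has
mass one there (`integral_katDiff_one`) and concentrates at x. -/
lemma katDiff_one {ρ x x' s : ℝ} :
    katDiff 1 ρ x x' s = ρ / (x ^ ρ - x' ^ ρ) * (Ici x').indicator (fun s => s ^ (ρ - 1)) s := by
  rw [katDiff, katKernelOne_one]
  congr 1
  by_cases h : s < x'
  · rw [indicator_of_mem (show s ∈ Iio x' from h), indicator_of_notMem (by simpa using h),
      katKernelOne_one, sub_self]
  · rw [indicator_of_notMem (show s ∉ Iio x' from h), indicator_of_mem (by simpa using h), sub_zero]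

lemma katDiff_one_nonneg {ρ x x' s : ℝ} (hρ : 0 < ρ) (hx' : 0 < x')
    (hxx' : x' < x) (hs : 0 < s) : 0 ≤ katDiff 1 ρ x x' s := by
  rw [katDiff_one]
  exact mul_nonneg (div_pos hρ (rpow_sub_pos hρ hx'.le hxx')).le
    (indicator_apply_nonneg fun _ => Real.rpow_nonneg hs.le _)

lemma integral_katDiff_one {ρ x x' : ℝ} (hρ : 0 < ρ) (hx' : 0 < x') (hxx' : x' < x) :
    IntegrableOn (katDiff 1 ρ x x') (Ioo 0 x) ∧ ∫ s in Ioo 0 x, katDiff 1 ρ x x' s = 1 := by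
  obtain ⟨h1, e1⟩ := integral_katKernelOne one_pos hρ (hx'.trans hxx')
  obtain ⟨h2, e2⟩ := integral_katKernelOne one_pos hρ hx'
  have hset : Ioo 0 x ∩ Iio x' = Ioo 0 x' := by
    ext s; exact ⟨fun h => ⟨h.1.1, h.2⟩, fun h => ⟨⟨h.1, h.2.trans hxx'⟩, h.2⟩⟩
  have h3 : IntegrableOn ((Iio x').indicator (katKernelOne 1 ρ x')) (Ioo 0 x) := by
    rw [IntegrableOn, integrable_indicator_iff measurableSet_Iio, IntegrableOn,
      Measure.restrict_restrict measurableSet_Iio, inter_comm, hset]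
    exact h2
  refine ⟨(h1.sub h3).const_mul _, ?_⟩
  have hX := rpow_sub_pos hρ hx'.le hxx'
  unfold katDiff
  rw [integral_const_mul, integral_sub h1 h3, setIntegral_indicator measurableSet_Iio, hset, e1, e2]
  have : Real.Gamma (1 + 1) = 1 := by rw [Real.Gamma_add_one one_ne_zero]; simp
  rw [this, Real.rpow_one, Real.rpow_one, Real.rpow_neg_one]
  field_simp

/-- Extension by zero puts integrals with different corners on one rectangle, so that they can be
subtracted under the integral sign. -/
lemma katInt_eq_indicator {α ρ : ℝ × ℝ} {f : ℝ → ℝ → ℝ} {x y x' y' : ℝ} (hx : x' ≤ x)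
    (hy : y' ≤ y) (h : KatIntegrable α ρ f x' y') :
    IntegrableOn ((Iio x' ×ˢ Iio y').indicator fun p => katKernel α ρ x' y' p * f p.1 p.2)
        (Ioo 0 x ×ˢ Ioo 0 y) ∧
      ∫ p in Ioo 0 x ×ˢ Ioo 0 y, (Iio x' ×ˢ Iio y').indicator
        (fun p => katKernel α ρ x' y' p * f p.1 p.2) p = katInt α ρ f x' y' := by
  have hm : MeasurableSet (Iio x' ×ˢ Iio y') := measurableSet_Iio.prod measurableSet_Iio
  have hset : (Ioo 0 x ×ˢ Ioo 0 y) ∩ Iio x' ×ˢ Iio y' = Ioo 0 x' ×ˢ Ioo 0 y' := by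
    rw [prod_inter_prod]
    congr 1
    · ext s; exact ⟨fun h => ⟨h.1.1, h.2⟩, fun h => ⟨⟨h.1, h.2.trans_le hx⟩, h.2⟩⟩
    · ext s; exact ⟨fun h => ⟨h.1.1, h.2⟩, fun h => ⟨⟨h.1, h.2.trans_le hy⟩, h.2⟩⟩
  constructor
  · rw [IntegrableOn, integrable_indicator_iff hm, IntegrableOn, Measure.restrict_restrict hm,
      inter_comm, hset]
    exact h
  · rw [setIntegral_indicator hm, hset, katInt]

lemma integral_katDiff_mul_katDiff {α ρ : ℝ × ℝ} {f : ℝ → ℝ → ℝ} {x y x' y' : ℝ}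
    (hx : x' < x) (hy : y' < y) (h₁ : KatIntegrable α ρ f x y) (h₂ : KatIntegrable α ρ f x' y)
    (h₃ : KatIntegrable α ρ f x y') (h₄ : KatIntegrable α ρ f x' y') :
    ∫ p in Ioo 0 x ×ˢ Ioo 0 y,
        katDiff α.1 ρ.1 x x' p.1 * katDiff α.2 ρ.2 y y' p.2 * f p.1 p.2 =
      ρ.1 / (x ^ ρ.1 - x' ^ ρ.1) * (ρ.2 / (y ^ ρ.2 - y' ^ ρ.2)) *
        (katInt α ρ f x y - katInt α ρ f x' y - katInt α ρ f x y' + katInt α ρ f x' y') := by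
  obtain ⟨i1, e1⟩ := katInt_eq_indicator le_rfl le_rfl h₁
  obtain ⟨i2, e2⟩ := katInt_eq_indicator hx.le le_rfl h₂
  obtain ⟨i3, e3⟩ := katInt_eq_indicator le_rfl hy.le h₃
  obtain ⟨i4, e4⟩ := katInt_eq_indicator hx.le hy.le h₄
  rw [← e1, ← e2, ← e3, ← e4, ← integral_sub i1 i2, ← integral_sub (by exact i1.sub i2) i3,
    ← integral_add (by exact (i1.sub i2).sub i3) i4, ← integral_const_mul]
  refine setIntegral_congr_fun (measurableSet_rect x y) fun p hp => ?_
  have hpx : p.1 < x := hp.1.2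
  have hpy : p.2 < y := hp.2.2
  by_cases c1 : p.1 < x' <;> by_cases c2 : p.2 < y' <;>
    simp only [katDiff, indicator_apply, mem_prod, mem_Iio, hpx, hpy, c1, c2, katKernel_eq_mul,
      and_self, and_true, and_false, if_true, if_false] <;> ring

lemma tendsto_integral_katDiff {φ ρ : ℝ × ℝ} (hφ₁ : φ.1 ∈ Ioo (0 : ℝ) 1)
    (hφ₂ : φ.2 ∈ Ioo (0 : ℝ) 1) (hρ₁ : 0 < ρ.1) (hρ₂ : 0 < ρ.2) {f : ℝ → ℝ → ℝ} {x y : ℝ}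
    (hx : 0 < x) (hy : 0 < y) (hf : KatIntegrable φ ρ f x y) :
    Tendsto (fun q : ℝ × ℝ => ∫ p in Ioo 0 x ×ˢ Ioo 0 y,
        katDiff (φ.1 + 1) ρ.1 x q.1 p.1 * katDiff (φ.2 + 1) ρ.2 y q.2 p.2 * f p.1 p.2)
      (𝓝[<] x ×ˢ 𝓝[<] y) (𝓝 (katInt φ ρ f x y)) := by
  have hev : ∀ᶠ q : ℝ × ℝ in 𝓝[<] x ×ˢ 𝓝[<] y, q.1 ∈ Ioo 0 x ∧ q.2 ∈ Ioo 0 y :=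
    prod_mem_prod (Ioo_mem_nhdsLT hx) (Ioo_mem_nhdsLT hy)
  have hR := measurableSet_rect x y
  refine tendsto_integral_filter_of_dominated_convergence
    (fun p => φ.1⁻¹ * φ.2⁻¹ * ‖katKernel φ ρ x y p * f p.1 p.2‖) ?_ ?_
    ((Integrable.norm hf).const_mul _) ?_
  · refine Eventually.of_forall fun q => ?_
    exact (((measurable_katDiff _ _ _ _).comp measurable_fst).mul
      ((measurable_katDiff _ _ _ _).comp measurable_snd)).aestronglyMeasurable.mul
      (hf.aestronglyMeasurable hφ₁.1 hφ₂.1 hρ₁ hρ₂)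
  · filter_upwards [hev] with q hq
    refine (ae_restrict_iff' hR).2 (Eventually.of_forall fun p hp => ?_)
    obtain ⟨a1, a2⟩ := katDiff_add_one_mem hφ₁ hρ₁ hq.1.1 hq.1.2 hp.1
    obtain ⟨b1, b2⟩ := katDiff_add_one_mem hφ₂ hρ₂ hq.2.1 hq.2.2 hp.2
    rw [norm_mul, norm_mul (katKernel _ _ _ _ _), ← mul_assoc]
    refine mul_le_mul_of_nonneg_right ?_ (norm_nonneg _)
    rw [Real.norm_of_nonneg (mul_nonneg a1 b1),
      Real.norm_of_nonneg (katKernel_pos hφ₁.1 hφ₂.1 hρ₁ hρ₂ hp).le, katKernel_eq_mul]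
    refine (mul_le_mul a2 b2 b1 (a1.trans a2)).trans_eq ?_
    ring
  · refine (ae_restrict_iff' hR).2 (Eventually.of_forall fun p hp => ?_)
    rw [katKernel_eq_mul]
    exact (((tendsto_katDiff hφ₁ hρ₁ hp.1).comp tendsto_fst).mul
      ((tendsto_katDiff hφ₂ hρ₂ hp.2).comp tendsto_snd)).mul_const _

/-- An approximate identity: the product density has mass one and lives near the corner (x, y),
where γ is within ε/2 of γ(x, y). -/
lemma tendsto_integral_katDiff_one {ρ : ℝ × ℝ} (hρ₁ : 0 < ρ.1) (hρ₂ : 0 < ρ.2)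
    {γ : ℝ → ℝ → ℝ} {x y : ℝ} (hx : 0 < x) (hy : 0 < y)
    (hγ : ContinuousOn (fun p : ℝ × ℝ => γ p.1 p.2) (Icc 0 x ×ˢ Icc 0 y)) :
    Tendsto (fun q : ℝ × ℝ => ∫ p in Ioo 0 x ×ˢ Ioo 0 y,
        katDiff 1 ρ.1 x q.1 p.1 * katDiff 1 ρ.2 y q.2 p.2 * γ p.1 p.2)
      (𝓝[<] x ×ˢ 𝓝[<] y) (𝓝 (γ x y)) := by
  have hR := measurableSet_rect x y
  have hsub : Ioo 0 x ×ˢ Ioo 0 y ⊆ Icc 0 x ×ˢ Icc 0 y :=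
    prod_mono Ioo_subset_Icc_self Ioo_subset_Icc_self
  rw [Metric.tendsto_nhds]
  intro ε hε
  obtain ⟨δ, hδ, hd⟩ := Metric.continuousOn_iff.1 hγ (x, y)
    ⟨right_mem_Icc.2 hx.le, right_mem_Icc.2 hy.le⟩ (ε / 2) (half_pos hε)
  have hev : ∀ᶠ q : ℝ × ℝ in 𝓝[<] x ×ˢ 𝓝[<] y,
      q.1 ∈ Ioo (max 0 (x - δ)) x ∧ q.2 ∈ Ioo (max 0 (y - δ)) y :=
    prod_mem_prod (Ioo_mem_nhdsLT (max_lt hx (by linarith)))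
      (Ioo_mem_nhdsLT (max_lt hy (by linarith)))
  filter_upwards [hev] with q hq
  obtain ⟨⟨hx1, hx2⟩, hy1, hy2⟩ := hq
  rw [max_lt_iff] at hx1 hy1
  obtain ⟨i1, e1⟩ := integral_katDiff_one hρ₁ hx1.1 hx2
  obtain ⟨i2, e2⟩ := integral_katDiff_one hρ₂ hy1.1 hy2
  set N : ℝ × ℝ → ℝ := fun p => katDiff 1 ρ.1 x q.1 p.1 * katDiff 1 ρ.2 y q.2 p.2
  have hN : IntegrableOn N (Ioo 0 x ×ˢ Ioo 0 y) := by
    rw [IntegrableOn, Measure.volume_eq_prod, ← Measure.prod_restrict]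
    exact i1.mul_prod i2
  have hN1 : ∫ p in Ioo 0 x ×ˢ Ioo 0 y, N p = 1 := by
    have := setIntegral_prod_mul (μ := volume) (ν := volume) (katDiff 1 ρ.1 x q.1)
      (katDiff 1 ρ.2 y q.2) (Ioo 0 x) (Ioo 0 y)
    rw [e1, e2, one_mul] at this
    exact this
  have hN0 : ∀ p ∈ Ioo 0 x ×ˢ Ioo 0 y, 0 ≤ N p := fun p hp =>
    mul_nonneg (katDiff_one_nonneg hρ₁ hx1.1 hx2 hp.1.1)
      (katDiff_one_nonneg hρ₂ hy1.1 hy2 hp.2.1)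
  have hb : ∀ p ∈ Ioo 0 x ×ˢ Ioo 0 y, ‖N p * (γ p.1 p.2 - γ x y)‖ ≤ ε / 2 * N p := by
    intro p hp
    rw [norm_mul, Real.norm_of_nonneg (hN0 p hp), mul_comm (ε / 2)]
    by_cases hc : q.1 ≤ p.1 ∧ q.2 ≤ p.2
    · refine mul_le_mul_of_nonneg_left ?_ (hN0 p hp)
      refine (hd p (hsub hp) ?_).le
      rw [Prod.dist_eq, max_lt_iff, Real.dist_eq, Real.dist_eq, abs_lt, abs_lt]
      exact ⟨⟨by linarith [hc.1], by linarith [hp.1.2]⟩, by linarith [hc.2], by linarith [hp.2.2]⟩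
    · have : N p = 0 := by
        simp only [N, katDiff_one, indicator_apply, mem_Ici]
        rcases not_and_or.1 hc with h | h <;> simp [h]
      rw [this, zero_mul, zero_mul]
  have hγm : AEStronglyMeasurable (fun p : ℝ × ℝ => γ p.1 p.2)
      (volume.restrict (Ioo 0 x ×ˢ Ioo 0 y)) := (hγ.mono hsub).aestronglyMeasurable hR
  have hae := (ae_restrict_iff' (μ := volume) hR).2 (Eventually.of_forall hb)
  have hi : IntegrableOn (fun p : ℝ × ℝ => N p * (γ p.1 p.2 - γ x y)) (Ioo 0 x ×ˢ Ioo 0 y) :=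
    Integrable.mono' (hN.const_mul (ε / 2))
      (hN.aestronglyMeasurable.mul (hγm.sub aestronglyMeasurable_const)) hae
  have hle := norm_integral_le_of_norm_le (hN.const_mul (ε / 2)) hae
  rw [integral_const_mul, hN1, mul_one] at hle
  have e : ∫ p in Ioo 0 x ×ˢ Ioo 0 y, N p * γ p.1 p.2 =
      (∫ p in Ioo 0 x ×ˢ Ioo 0 y, N p * (γ p.1 p.2 - γ x y)) + γ x y := by
    have h2 : ∫ p in Ioo 0 x ×ˢ Ioo 0 y, N p * γ x y = γ x y := by
      rw [integral_mul_const, hN1, one_mul]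
    have h3 := integral_add hi (hN.mul_const (γ x y))
    rw [h2] at h3
    rw [← h3]
    exact integral_congr_ae (Eventually.of_forall fun p => by ring)
  rw [e, Real.dist_eq, add_sub_cancel_right]
  exact hle.trans_lt (half_lt_self hε)

/-- An Abel equation: if `I^{1-φ} γ = I^1 f`, then `γ = I^φ f` at every point. -/
lemma eq_katInt_of_katInt_eq {a b : ℝ} {φ ρ : ℝ × ℝ} (hφ₁ : φ.1 ∈ Ioo (0 : ℝ) 1)
    (hφ₂ : φ.2 ∈ Ioo (0 : ℝ) 1) (hρ₁ : 0 < ρ.1) (hρ₂ : 0 < ρ.2) {f γ : ℝ → ℝ → ℝ}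
    (hγ : ContinuousOn (fun p : ℝ × ℝ => γ p.1 p.2) (Icc 0 a ×ˢ Icc 0 b))
    (hf : ∀ x ∈ Ioc 0 a, ∀ y ∈ Ioc 0 b, KatIntegrable φ ρ f x y)
    (h : ∀ x ∈ Ioc 0 a, ∀ y ∈ Ioc 0 b, katInt (1 - φ) ρ γ x y = katInt 1 ρ f x y)
    {x y : ℝ} (hx : x ∈ Ioc 0 a) (hy : y ∈ Ioc 0 b) : γ x y = katInt φ ρ f x y := by
  have hsub : ∀ x ∈ Ioc 0 a, ∀ y ∈ Ioc 0 b, Ioo 0 x ×ˢ Ioo 0 y ⊆ Icc 0 a ×ˢ Icc 0 b :=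
    fun x hx y hy p hp => ⟨⟨hp.1.1.le, hp.1.2.le.trans hx.2⟩, hp.2.1.le, hp.2.2.le.trans hy.2⟩
  obtain ⟨M, hM⟩ := (isCompact_Icc.prod isCompact_Icc).exists_bound_of_continuousOn hγ
  have hγ1 : ∀ x ∈ Ioc 0 a, ∀ y ∈ Ioc 0 b, KatIntegrable 1 ρ γ x y := fun x hx y hy =>
    (katIntegrable_of_bdd one_pos one_pos hρ₁ hρ₂ hx.1 hy.1
      ((hγ.mono (hsub x hx y hy)).aestronglyMeasurable (measurableSet_rect x y))
      fun p hp => hM p (hsub x hx y hy hp)).1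
  have hf1 : ∀ x ∈ Ioc 0 a, ∀ y ∈ Ioc 0 b, KatIntegrable (φ + 1) ρ f x y := fun x hx y hy =>
    (hf x hx y hy).mono_order hφ₁.1 hφ₂.1 (by simp) (by simp) hρ₁ hρ₂
  -- I^φ is applied to both sides of the hypothesis, with I^φ I^{1-φ} = I^1 and I^φ I^1 = I^{φ+1}.
  have key : ∀ x ∈ Ioc 0 a, ∀ y ∈ Ioc 0 b, katInt 1 ρ γ x y = katInt (φ + 1) ρ f x y := by
    intro x hx y hy
    have e1 := (katInt_katInt (α := φ) (β := 1 - φ) (ρ := ρ) (μ := γ) (x := x) (y := y)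
      hφ₁.1 hφ₂.1 (sub_pos.2 hφ₁.2) (sub_pos.2 hφ₂.2) hρ₁ hρ₂
      (by rw [add_sub_cancel]; exact hγ1 x hx y hy)).2
    have e2 := (katInt_katInt (α := φ) (β := 1) (ρ := ρ) (μ := f) (x := x) (y := y)
      hφ₁.1 hφ₂.1 one_pos one_pos hρ₁ hρ₂ (hf1 x hx y hy)).2
    rw [add_sub_cancel] at e1
    rw [← e1, ← e2]
    refine setIntegral_congr_fun (measurableSet_rect x y) fun p hp => ?_
    rw [h p.1 ⟨hp.1.1, hp.1.2.le.trans hx.2⟩ p.2 ⟨hp.2.1, hp.2.2.le.trans hy.2⟩]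
  have t1 := tendsto_integral_katDiff hφ₁ hφ₂ hρ₁ hρ₂ hx.1 hy.1 (hf x hx y hy)
  have t2 := tendsto_integral_katDiff_one hρ₁ hρ₂ hx.1 hy.1
    (hγ.mono (prod_mono (Icc_subset_Icc_right hx.2) (Icc_subset_Icc_right hy.2)))
  -- By `key` the two families of mixed difference quotients coincide, hence so do their limits.
  refine tendsto_nhds_unique t2 (t1.congr' ?_)
  have hev : ∀ᶠ q : ℝ × ℝ in 𝓝[<] x ×ˢ 𝓝[<] y, q.1 ∈ Ioo 0 x ∧ q.2 ∈ Ioo 0 y :=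
    prod_mem_prod (Ioo_mem_nhdsLT hx.1) (Ioo_mem_nhdsLT hy.1)
  filter_upwards [hev] with q hq
  have hx' : q.1 ∈ Ioc 0 a := ⟨hq.1.1, hq.1.2.le.trans hx.2⟩
  have hy' : q.2 ∈ Ioc 0 b := ⟨hq.2.1, hq.2.2.le.trans hy.2⟩
  have d1 := integral_katDiff_mul_katDiff hq.1.2 hq.2.2 (hf1 x hx y hy) (hf1 _ hx' y hy)
    (hf1 x hx _ hy') (hf1 _ hx' _ hy')
  have d2 := integral_katDiff_mul_katDiff hq.1.2 hq.2.2 (hγ1 x hx y hy) (hγ1 _ hx' y hy)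
    (hγ1 x hx _ hy') (hγ1 _ hx' _ hy')
  rw [key x hx y hy, key _ hx' y hy, key x hx _ hy', key _ hx' _ hy', ← d1] at d2
  exact d2.symm

/-! ### Recovering a function from its mixed derivative -/

/-- The fundamental theorem of calculus, in t and then in s. As q is only integrable on the
rectangle, Fubini provides the inner step for almost every s; continuity of p serves the outer step.
-/
lemma integral_mixed_deriv {W p q : ℝ → ℝ → ℝ} {x₀ x y₀ y : ℝ} (hx : x₀ ≤ x) (hy : y₀ ≤ y)
    (hW : ∀ s ∈ Icc x₀ x, ∀ t ∈ Icc y₀ y, HasDerivWithinAt (fun u => W u t) (p s t) (Icc x₀ x) s)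
    (hp : ContinuousOn (fun z : ℝ × ℝ => p z.1 z.2) (Icc x₀ x ×ˢ Icc y₀ y))
    (hpq : ∀ s ∈ Icc x₀ x, ∀ t ∈ Icc y₀ y, HasDerivWithinAt (fun v => p s v) (q s t) (Icc y₀ y) t)
    (hq : IntegrableOn (fun z : ℝ × ℝ => q z.1 z.2) (Ioc x₀ x ×ˢ Ioc y₀ y)) :
    ∫ z in Ioc x₀ x ×ˢ Ioc y₀ y, q z.1 z.2 = W x y - W x₀ y - W x y₀ + W x₀ y₀ := by
  have hW' : ∀ t ∈ Icc y₀ y, IntervalIntegrable (fun s => p s t) volume x₀ x ∧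
      ∫ s in x₀..x, p s t = W x t - W x₀ t := by
    intro t ht
    have hc : ContinuousOn (fun s => p s t) (Icc x₀ x) :=
      hp.comp (f := fun s => (s, t)) (by fun_prop) fun s hs => ⟨hs, ht⟩
    have hi : IntervalIntegrable (fun s => p s t) volume x₀ x :=
      ContinuousOn.intervalIntegrable (by rwa [uIcc_of_le hx])
    refine ⟨hi, intervalIntegral.integral_eq_sub_of_hasDerivAt_of_le (f := fun u => W u t) hx
      (fun s hs => (hW s hs t ht).continuousWithinAt) (fun s hs => ?_) hi⟩
    exact (hW s (Ioo_subset_Icc_self hs) t ht).hasDerivAt (Icc_mem_nhds hs.1 hs.2)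
  have hq' : Integrable (fun z : ℝ × ℝ => q z.1 z.2)
      ((volume.restrict (Ioc x₀ x)).prod (volume.restrict (Ioc y₀ y))) := by
    rw [Measure.prod_restrict]; exact hq
  have hin : ∀ᵐ s ∂(volume.restrict (Ioc x₀ x)),
      ∫ t in Ioc y₀ y, q s t = p s y - p s y₀ := by
    filter_upwards [hq'.prod_right_ae, ae_restrict_mem measurableSet_Ioc] with s hs hsx
    have hs' := Ioc_subset_Icc_self hsx
    rw [← intervalIntegral.integral_of_le hy]
    refine intervalIntegral.integral_eq_sub_of_hasDerivAt_of_le (f := fun v => p s v) hy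
      (fun t ht => (hpq s hs' t ht).continuousWithinAt) (fun t ht => ?_)
      ((intervalIntegrable_iff_integrableOn_Ioc_of_le hy).2 hs)
    exact (hpq s hs' t (Ioo_subset_Icc_self ht)).hasDerivAt (Icc_mem_nhds ht.1 ht.2)
  rw [Measure.volume_eq_prod, setIntegral_prod _ hq, integral_congr_ae hin,
    ← intervalIntegral.integral_of_le hx]
  obtain ⟨j1, f1⟩ := hW' y (right_mem_Icc.2 hy)
  obtain ⟨j2, f2⟩ := hW' y₀ (left_mem_Icc.2 hy)
  rw [intervalIntegral.integral_sub j1 j2, f1, f2]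
  ring

/-- On [ε, x] × [ε, y] the integral is a combination of four corner values. As ε → 0 the power bound
removes the three near the axes, and integrability of q gives the limit of the integrals. -/
lemma eq_setIntegral_of_mixed_deriv {a b C κ₁ κ₂ : ℝ} (hκ₁ : 0 < κ₁) (hκ₂ : 0 < κ₂)
    {W p q : ℝ → ℝ → ℝ}
    (hW : ∀ x ∈ Ioc 0 a, ∀ y ∈ Ioc 0 b, HasDerivWithinAt (fun u => W u y) (p x y) (Ioc 0 a) x)
    (hp : ContinuousOn (fun z : ℝ × ℝ => p z.1 z.2) (Ioc 0 a ×ˢ Ioc 0 b))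
    (hpq : ∀ x ∈ Ioc 0 a, ∀ y ∈ Ioc 0 b, HasDerivWithinAt (fun v => p x v) (q x y) (Ioc 0 b) y)
    (hbd : ∀ x ∈ Ioc 0 a, ∀ y ∈ Ioc 0 b, |W x y| ≤ C * (x ^ κ₁ * y ^ κ₂))
    {x y : ℝ} (hx : x ∈ Ioc 0 a) (hy : y ∈ Ioc 0 b)
    (hq : IntegrableOn (fun z : ℝ × ℝ => q z.1 z.2) (Ioo 0 x ×ˢ Ioo 0 y)) :
    W x y = ∫ z in Ioo 0 x ×ˢ Ioo 0 y, q z.1 z.2 := by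
  have hR := measurableSet_rect x y
  have hev : ∀ᶠ ε : ℝ in 𝓝[>] 0, ε ∈ Ioo 0 (min x y) := Ioo_mem_nhdsGT (lt_min hx.1 hy.1)
  have hm : ∀ ε : ℝ, MeasurableSet (Ioi ε ×ˢ Ioi ε) := fun ε => measurableSet_Ioi.prod measurableSet_Ioi
  have t1 : Tendsto (fun ε : ℝ => ∫ z in Ioo 0 x ×ˢ Ioo 0 y,
      (Ioi ε ×ˢ Ioi ε).indicator (fun z => q z.1 z.2) z) (𝓝[>] 0)
      (𝓝 (∫ z in Ioo 0 x ×ˢ Ioo 0 y, q z.1 z.2)) := by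
    refine tendsto_integral_filter_of_dominated_convergence (fun z => ‖q z.1 z.2‖) ?_ ?_ hq.norm ?_
    · exact Eventually.of_forall fun ε => hq.aestronglyMeasurable.indicator (hm ε)
    · exact Eventually.of_forall fun ε => Eventually.of_forall fun z => norm_indicator_le_norm_self _ _
    · refine (ae_restrict_iff' hR).2 (Eventually.of_forall fun z hz => ?_)
      refine tendsto_const_nhds.congr' ?_
      filter_upwards [Ioo_mem_nhdsGT (lt_min hz.1.1 hz.2.1)] with ε hε
      rw [indicator_of_mem]
      exact ⟨hε.2.trans_le (min_le_left _ _), hε.2.trans_le (min_le_right _ _)⟩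
  have hz : ∀ {κ : ℝ}, 0 < κ → Tendsto (fun ε : ℝ => ε ^ κ) (𝓝[>] 0) (𝓝 0) := by
    intro κ hκ
    have := (Real.continuous_rpow_const hκ.le).tendsto 0
    rw [Real.zero_rpow hκ.ne'] at this
    exact this.mono_left nhdsWithin_le_nhds
  have w1 : Tendsto (fun ε => W ε y) (𝓝[>] 0) (𝓝 0) := by
    refine squeeze_zero_norm' ?_ (by simpa using ((hz hκ₁).mul_const (y ^ κ₂)).const_mul C)
    filter_upwards [hev] with ε hε
    exact hbd ε ⟨hε.1, (hε.2.le.trans (min_le_left _ _)).trans hx.2⟩ y hy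
  have w2 : Tendsto (fun ε => W x ε) (𝓝[>] 0) (𝓝 0) := by
    refine squeeze_zero_norm' ?_ (by simpa using ((hz hκ₂).const_mul (x ^ κ₁)).const_mul C)
    filter_upwards [hev] with ε hε
    exact hbd x hx ε ⟨hε.1, (hε.2.le.trans (min_le_right _ _)).trans hy.2⟩
  have w3 : Tendsto (fun ε => W ε ε) (𝓝[>] 0) (𝓝 0) := by
    refine squeeze_zero_norm' ?_ (by simpa using ((hz hκ₁).mul (hz hκ₂)).const_mul C)
    filter_upwards [hev] with ε hε
    exact hbd ε ⟨hε.1, (hε.2.le.trans (min_le_left _ _)).trans hx.2⟩ ε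
      ⟨hε.1, (hε.2.le.trans (min_le_right _ _)).trans hy.2⟩
  have t2 : Tendsto (fun ε => W x y - W ε y - W x ε + W ε ε) (𝓝[>] 0) (𝓝 (W x y)) := by
    simpa using (((tendsto_const_nhds (x := W x y)).sub w1).sub w2).add w3
  refine tendsto_nhds_unique t2 (t1.congr' ?_)
  filter_upwards [hev] with ε hε
  have hεx := hε.2.trans_le (min_le_left _ _)
  have hεy := hε.2.trans_le (min_le_right _ _)
  have sx : Icc ε x ⊆ Ioc 0 a := fun s hs => ⟨hε.1.trans_le hs.1, hs.2.trans hx.2⟩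
  have sy : Icc ε y ⊆ Ioc 0 b := fun s hs => ⟨hε.1.trans_le hs.1, hs.2.trans hy.2⟩
  have hae : (Ioc ε x ×ˢ Ioc ε y : Set (ℝ × ℝ)) =ᵐ[volume] (Ioo ε x ×ˢ Ioo ε y : Set (ℝ × ℝ)) :=
    Measure.set_prod_ae_eq Ioo_ae_eq_Ioc.symm Ioo_ae_eq_Ioc.symm
  have hqε : IntegrableOn (fun z : ℝ × ℝ => q z.1 z.2) (Ioc ε x ×ˢ Ioc ε y) :=
    (hq.mono_set (prod_mono (Ioo_subset_Ioo_left hε.1.le) (Ioo_subset_Ioo_left hε.1.le))).congr_set_ae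
      hae
  rw [← integral_mixed_deriv hεx.le hεy.le (fun s hs t ht => (hW s (sx hs) t (sy ht)).mono sx)
    (hp.mono (prod_mono sx sy)) (fun s hs t ht => (hpq s (sx hs) t (sy ht)).mono sy) hqε,
    setIntegral_indicator (hm ε), setIntegral_congr_set hae]
  congr 2
  rw [prod_inter_prod]
  congr 1
  · ext s; exact ⟨fun h => ⟨h.2, h.1.2⟩, fun h => ⟨⟨hε.1.trans h.1, h.2⟩, h.1⟩⟩
  · ext s; exact ⟨fun h => ⟨h.2, h.1.2⟩, fun h => ⟨⟨hε.1.trans h.1, h.2⟩, h.1⟩⟩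

/-! ### From the derivative to the integral -/

lemma katKernel_one (ρ : ℝ × ℝ) (x y : ℝ) (p : ℝ × ℝ) :
    katKernel 1 ρ x y p = p.1 ^ (ρ.1 - 1) * p.2 ^ (ρ.2 - 1) := by
  rw [katKernel_eq_mul, Prod.fst_one, Prod.snd_one, katKernelOne_one, katKernelOne_one]

lemma katInt_congr {α ρ : ℝ × ℝ} {f g : ℝ → ℝ → ℝ} {x y : ℝ}
    (h : ∀ s ∈ Ioo 0 x, ∀ t ∈ Ioo 0 y, f s t = g s t) : katInt α ρ f x y = katInt α ρ g x y :=
  setIntegral_congr_fun (measurableSet_rect x y) fun p hp => by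
    simp only [h p.1 hp.1 p.2 hp.2]

/-- A real function is the integral of its mixed Katugampola derivative. -/
lemma eq_katInt_of_mixed_deriv {a b : ℝ} {φ ρ : ℝ × ℝ} (hφ₁ : φ.1 ∈ Ioo (0 : ℝ) 1)
    (hφ₂ : φ.2 ∈ Ioo (0 : ℝ) 1) (hρ₁ : 0 < ρ.1) (hρ₂ : 0 < ρ.2) {f γ W p q : ℝ → ℝ → ℝ}
    (hγ : ContinuousOn (fun p : ℝ × ℝ => γ p.1 p.2) (Icc 0 a ×ˢ Icc 0 b))
    (hf : ∀ x ∈ Ioc 0 a, ∀ y ∈ Ioc 0 b, KatIntegrable φ ρ f x y)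
    (hWγ : ∀ x ∈ Ioc 0 a, ∀ y ∈ Ioc 0 b, W x y = katInt (1 - φ) ρ γ x y)
    (hW : ∀ x ∈ Ioc 0 a, ∀ y ∈ Ioc 0 b, HasDerivWithinAt (fun u => W u y) (p x y) (Ioc 0 a) x)
    (hp : ContinuousOn (fun z : ℝ × ℝ => p z.1 z.2) (Ioc 0 a ×ˢ Ioc 0 b))
    (hpq : ∀ x ∈ Ioc 0 a, ∀ y ∈ Ioc 0 b, HasDerivWithinAt (fun v => p x v) (q x y) (Ioc 0 b) y)
    (hqf : ∀ x ∈ Ioc 0 a, ∀ y ∈ Ioc 0 b, q x y = x ^ (ρ.1 - 1) * y ^ (ρ.2 - 1) * f x y)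
    {x y : ℝ} (hx : x ∈ Ioc 0 a) (hy : y ∈ Ioc 0 b) : γ x y = katInt φ ρ f x y := by
  have hsub : ∀ x ∈ Ioc 0 a, ∀ y ∈ Ioc 0 b, Ioo 0 x ×ˢ Ioo 0 y ⊆ Icc 0 a ×ˢ Icc 0 b :=
    fun x hx y hy p hp => ⟨⟨hp.1.1.le, hp.1.2.le.trans hx.2⟩, hp.2.1.le, hp.2.2.le.trans hy.2⟩
  obtain ⟨M, hM⟩ := (isCompact_Icc.prod isCompact_Icc).exists_bound_of_continuousOn hγ
  have k₁ : 0 < 1 - φ.1 := sub_pos.2 hφ₁.2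
  have k₂ : 0 < 1 - φ.2 := sub_pos.2 hφ₂.2
  refine eq_katInt_of_katInt_eq hφ₁ hφ₂ hρ₁ hρ₂ hγ hf (fun x hx y hy => ?_) hx hy
  have hker : ∀ z ∈ Ioo 0 x ×ˢ Ioo 0 y, katKernel 1 ρ x y z * f z.1 z.2 = q z.1 z.2 := by
    intro z hz
    rw [katKernel_one, hqf z.1 ⟨hz.1.1, hz.1.2.le.trans hx.2⟩ z.2 ⟨hz.2.1, hz.2.2.le.trans hy.2⟩]
  rw [← hWγ x hx y hy, katInt, setIntegral_congr_fun (measurableSet_rect x y) hker]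
  -- The exponents and C come from the bound M on γ times the mass of the kernel of order 1 - φ.
  refine eq_setIntegral_of_mixed_deriv (mul_pos hρ₁ k₁) (mul_pos hρ₂ k₂)
    (C := M * (ρ.1 ^ (-(1 - φ.1)) / Real.Gamma (1 - φ.1 + 1) *
      (ρ.2 ^ (-(1 - φ.2)) / Real.Gamma (1 - φ.2 + 1)))) hW hp hpq (fun x hx y hy => ?_) hx hy ?_
  · have := (katIntegrable_of_bdd (α := 1 - φ) k₁ k₂ hρ₁ hρ₂ hx.1 hy.1
      ((hγ.mono (hsub x hx y hy)).aestronglyMeasurable (measurableSet_rect x y))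
      fun p hp => hM p (hsub x hx y hy hp)).2
    rw [hWγ x hx y hy]
    refine this.trans_eq ?_
    rw [Real.rpow_mul hx.1.le, Real.rpow_mul hy.1.le]
    simp only [Prod.fst_sub, Prod.snd_sub, Prod.fst_one, Prod.snd_one]
    ring
  · exact IntegrableOn.congr_fun ((hf x hx y hy).mono_order (β := 1) hφ₁.1 hφ₂.1 hφ₁.2.le hφ₂.2.le
      hρ₁ hρ₂) hker (measurableSet_rect x y)

lemma continuousOn_lo_hi {f : ℝ → ℝ → FuzzyNum} {S : Set (ℝ × ℝ)} (hf : ContOn f S) {r : ℝ}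
    (hr : r ∈ Icc (0 : ℝ) 1) : ContinuousOn (fun p : ℝ × ℝ => (f p.1 p.2).lo r) S ∧
      ContinuousOn (fun p : ℝ × ℝ => (f p.1 p.2).hi r) S := by
  have h := (contOn_iff f S).1 hf
  exact ⟨(evalLo ⟨r, hr⟩).continuous.comp_continuousOn h,
    (evalHi ⟨r, hr⟩).continuous.comp_continuousOn h⟩

lemma HasFuzzyKatInt.lo_hi {α ρ : ℝ × ℝ} {f : ℝ → ℝ → FuzzyNum} {x y : ℝ} {J : FuzzyNum}
    (h : HasFuzzyKatInt α ρ f x y J) {r : ℝ} (hr : r ∈ Icc (0 : ℝ) 1) :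
    J.lo r = katInt α ρ (fun s t => (f s t).lo r) x y ∧
      J.hi r = katInt α ρ (fun s t => (f s t).hi r) x y :=
  (lo_hi_of_level_eq J hr.2 (h.2 r hr)).2

lemma katInt_mono {α ρ : ℝ × ℝ} (hα₁ : 0 < α.1) (hα₂ : 0 < α.2) (hρ₁ : 0 < ρ.1) (hρ₂ : 0 < ρ.2)
    {f g : ℝ → ℝ → ℝ} {x y : ℝ} (hf : KatIntegrable α ρ f x y) (hg : KatIntegrable α ρ g x y)
    (h : ∀ s t, f s t ≤ g s t) : katInt α ρ f x y ≤ katInt α ρ g x y :=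
  setIntegral_mono_on hf hg (measurableSet_rect x y) fun _ hp =>
    mul_le_mul_of_nonneg_left (h _ _) (katKernel_pos hα₁ hα₂ hρ₁ hρ₂ hp).le

/-- If `d` is the Katugampola derivative of `g`, then `g` is the integral of `d`. -/
lemma HasKatDeriv.eq_katInt {a b : ℝ} {φ ρ : ℝ × ℝ} (hφ₁ : φ.1 ∈ Ioo (0 : ℝ) 1)
    (hφ₂ : φ.2 ∈ Ioo (0 : ℝ) 1) (hρ₁ : 0 < ρ.1) (hρ₂ : 0 < ρ.2) {g d : ℝ → ℝ → FuzzyNum}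
    (h : HasKatDeriv a b φ ρ g d) (hint : KatIntegrableOn a b φ ρ d) {r : ℝ}
    (hr : r ∈ Icc (0 : ℝ) 1) {γ₁ γ₂ : ℝ → ℝ → ℝ}
    (hγ₁ : ContinuousOn (fun p : ℝ × ℝ => γ₁ p.1 p.2) (Icc 0 a ×ˢ Icc 0 b))
    (hγ₂ : ContinuousOn (fun p : ℝ × ℝ => γ₂ p.1 p.2) (Icc 0 a ×ˢ Icc 0 b))
    (h₁ : ∀ x ∈ Ioc 0 a, ∀ y ∈ Ioc 0 b, (g x y).lo r = γ₁ x y)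
    (h₂ : ∀ x ∈ Ioc 0 a, ∀ y ∈ Ioc 0 b, (g x y).hi r = γ₂ x y)
    {x y : ℝ} (hx : x ∈ Ioc 0 a) (hy : y ∈ Ioc 0 b) :
    (g x y).lo r = katInt φ ρ (fun s t => (d s t).lo r) x y ∧
      (g x y).hi r = katInt φ ρ (fun s t => (d s t).hi r) x y := by
  obtain ⟨U, Q, hU, ⟨-, P, hP, hX, hY⟩, hQ⟩ := h
  obtain ⟨hPlo, hPhi⟩ := continuousOn_lo_hi hP hr
  have hUlo : ∀ x ∈ Ioc 0 a, ∀ y ∈ Ioc 0 b, (U x y).lo r = katInt (1 - φ) ρ γ₁ x y := by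
    intro x hx y hy
    rw [((hU x hx y hy).lo_hi hr).1]
    exact katInt_congr fun s hs t ht =>
      h₁ s ⟨hs.1, hs.2.le.trans hx.2⟩ t ⟨ht.1, ht.2.le.trans hy.2⟩
  have hUhi : ∀ x ∈ Ioc 0 a, ∀ y ∈ Ioc 0 b, (U x y).hi r = katInt (1 - φ) ρ γ₂ x y := by
    intro x hx y hy
    rw [((hU x hx y hy).lo_hi hr).2]
    exact katInt_congr fun s hs t ht =>
      h₂ s ⟨hs.1, hs.2.le.trans hx.2⟩ t ⟨ht.1, ht.2.le.trans hy.2⟩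
  have hQd : ∀ x ∈ Ioc 0 a, ∀ y ∈ Ioc 0 b,
      (Q x y).lo r = x ^ (ρ.1 - 1) * y ^ (ρ.2 - 1) * (d x y).lo r ∧
        (Q x y).hi r = x ^ (ρ.1 - 1) * y ^ (ρ.2 - 1) * (d x y).hi r := by
    intro x hx y hy
    have e1 : x ^ (ρ.1 - 1) * x ^ (1 - ρ.1) = 1 := by
      rw [← Real.rpow_add hx.1]; simp
    have e2 : y ^ (ρ.2 - 1) * y ^ (1 - ρ.2) = 1 := by
      rw [← Real.rpow_add hy.1]; simp
    have e : ∀ z, z = x ^ (ρ.1 - 1) * y ^ (ρ.2 - 1) * (x ^ (1 - ρ.1) * y ^ (1 - ρ.2) * z) := by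
      intro z
      calc z = (x ^ (ρ.1 - 1) * x ^ (1 - ρ.1)) * (y ^ (ρ.2 - 1) * y ^ (1 - ρ.2)) * z := by
            rw [e1, e2]; ring
        _ = _ := by ring
    obtain ⟨s1, s2⟩ := smul_lo_hi (mul_pos (Real.rpow_pos_of_pos hx.1 (1 - ρ.1))
      (Real.rpow_pos_of_pos hy.1 (1 - ρ.2))) (Q x y) hr.2
    rw [hQ x hx y hy, s1, s2]
    exact ⟨e _, e _⟩
  have hdlo : ∀ x ∈ Ioc 0 a, ∀ y ∈ Ioc 0 b, KatIntegrable φ ρ (fun s t => (d s t).lo r) x y :=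
    fun x hx y hy => (hint x hx y hy r hr).1
  have hdhi : ∀ x ∈ Ioc 0 a, ∀ y ∈ Ioc 0 b, KatIntegrable φ ρ (fun s t => (d s t).hi r) x y :=
    fun x hx y hy => (hint x hx y hy r hr).2
  have hle := katInt_mono hφ₁.1 hφ₂.1 hρ₁ hρ₂ (hdlo x hx y hy) (hdhi x hx y hy)
    fun s t => (d s t).lo_le_hi hr.2
  have hle' := (g x y).lo_le_hi hr.2
  rw [h₁ x hx y hy, h₂ x hx y hy] at hle' ⊢
  -- Differentiations of equal type preserve the order of the end points, those of different types
  -- reverse it.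
  rcases hX with hX | hX <;> rcases hY with hY | hY
  · exact ⟨eq_katInt_of_mixed_deriv hφ₁ hφ₂ hρ₁ hρ₂ hγ₁ hdlo hUlo
        (fun x hx y hy => ((hX x hx y hy).2 r hr).1) hPlo
        (fun x hx y hy => ((hY x hx y hy).2 r hr).1) (fun x hx y hy => (hQd x hx y hy).1) hx hy,
      eq_katInt_of_mixed_deriv hφ₁ hφ₂ hρ₁ hρ₂ hγ₂ hdhi hUhi
        (fun x hx y hy => ((hX x hx y hy).2 r hr).2) hPhi
        (fun x hx y hy => ((hY x hx y hy).2 r hr).2) (fun x hx y hy => (hQd x hx y hy).2) hx hy⟩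
  -- Reversed order: γ₁ = I^φ(upper) ≥ I^φ(lower) = γ₂ ≥ γ₁, so all of these are equal.
  · have c1 := eq_katInt_of_mixed_deriv hφ₁ hφ₂ hρ₁ hρ₂ hγ₁ hdhi hUlo
        (fun x hx y hy => ((hX x hx y hy).2 r hr).1) hPlo
        (fun x hx y hy => ((hY x hx y hy).2 r hr).1) (fun x hx y hy => (hQd x hx y hy).2) hx hy
    have c2 := eq_katInt_of_mixed_deriv hφ₁ hφ₂ hρ₁ hρ₂ hγ₂ hdlo hUhi
        (fun x hx y hy => ((hX x hx y hy).2 r hr).2) hPhi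
        (fun x hx y hy => ((hY x hx y hy).2 r hr).2) (fun x hx y hy => (hQd x hx y hy).1) hx hy
    constructor <;> linarith
  · have c1 := eq_katInt_of_mixed_deriv hφ₁ hφ₂ hρ₁ hρ₂ hγ₁ hdhi hUlo
        (fun x hx y hy => ((hX x hx y hy).2 r hr).1) hPhi
        (fun x hx y hy => ((hY x hx y hy).2 r hr).2) (fun x hx y hy => (hQd x hx y hy).2) hx hy
    have c2 := eq_katInt_of_mixed_deriv hφ₁ hφ₂ hρ₁ hρ₂ hγ₂ hdlo hUhi
        (fun x hx y hy => ((hX x hx y hy).2 r hr).2) hPlo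
        (fun x hx y hy => ((hY x hx y hy).2 r hr).1) (fun x hx y hy => (hQd x hx y hy).1) hx hy
    constructor <;> linarith
  · exact ⟨eq_katInt_of_mixed_deriv hφ₁ hφ₂ hρ₁ hρ₂ hγ₁ hdlo hUlo
        (fun x hx y hy => ((hX x hx y hy).2 r hr).1) hPhi
        (fun x hx y hy => ((hY x hx y hy).2 r hr).2) (fun x hx y hy => (hQd x hx y hy).1) hx hy,
      eq_katInt_of_mixed_deriv hφ₁ hφ₂ hρ₁ hρ₂ hγ₂ hdhi hUhi
        (fun x hx y hy => ((hX x hx y hy).2 r hr).2) hPlo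
        (fun x hx y hy => ((hY x hx y hy).2 r hr).1) (fun x hx y hy => (hQd x hx y hy).2) hx hy⟩

/-! ### The sign of the increments -/

/-- Positivity of the kernel makes f vanish almost everywhere on the larger rectangle, hence on the
smaller one, whatever the kernel used there. -/
lemma katInt_eq_zero_of_le {α ρ : ℝ × ℝ} (hα₁ : 0 < α.1) (hα₂ : 0 < α.2) (hρ₁ : 0 < ρ.1)
    (hρ₂ : 0 < ρ.2) {f : ℝ → ℝ → ℝ} (hf0 : ∀ s t, 0 ≤ f s t) {x y x' y' : ℝ} (hx : x ≤ x')
    (hy : y ≤ y') (hf : KatIntegrable α ρ f x' y') (h : katInt α ρ f x' y' = 0) :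
    katInt α ρ f x y = 0 := by
  have hR := measurableSet_rect x' y'
  have hnn : 0 ≤ᵐ[volume.restrict (Ioo (0 : ℝ) x' ×ˢ Ioo (0 : ℝ) y')]
      fun p : ℝ × ℝ => katKernel α ρ x' y' p * f p.1 p.2 :=
    (ae_restrict_iff' hR).2 (Eventually.of_forall fun p hp =>
      mul_nonneg (katKernel_pos hα₁ hα₂ hρ₁ hρ₂ hp).le (hf0 _ _))
  have h0 := (integral_eq_zero_iff_of_nonneg_ae hnn hf).1 h
  have h1 : ∀ᵐ p ∂(volume.restrict (Ioo (0 : ℝ) x' ×ˢ Ioo (0 : ℝ) y')), f p.1 p.2 = 0 := by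
    filter_upwards [h0, ae_restrict_mem hR] with p hp hpR
    exact (mul_eq_zero.1 hp).resolve_left (katKernel_pos hα₁ hα₂ hρ₁ hρ₂ hpR).ne'
  refine integral_eq_zero_of_ae ?_
  filter_upwards [ae_restrict_of_ae_restrict_of_subset
    (prod_mono (Ioo_subset_Ioo_right hx) (Ioo_subset_Ioo_right hy)) h1] with p hp
  rw [hp, mul_zero]; rfl

/-- A continuous function whose modulus is the integral of a non-negative function has a
constant sign. -/
lemma nonneg_of_abs_eq_katInt {a b : ℝ} {α ρ : ℝ × ℝ} (hα₁ : 0 < α.1) (hα₂ : 0 < α.2)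
    (hρ₁ : 0 < ρ.1) (hρ₂ : 0 < ρ.2) {f e : ℝ → ℝ → ℝ} (hf0 : ∀ s t, 0 ≤ f s t)
    (hf : ∀ x ∈ Ioc 0 a, ∀ y ∈ Ioc 0 b, KatIntegrable α ρ f x y)
    (he : ContinuousOn (fun p : ℝ × ℝ => e p.1 p.2) (Icc 0 a ×ˢ Icc 0 b))
    (hef : ∀ x ∈ Ioc 0 a, ∀ y ∈ Ioc 0 b, |e x y| = katInt α ρ f x y) (h0 : 0 ≤ e a b)
    {x y : ℝ} (hx : x ∈ Ioc 0 a) (hy : y ∈ Ioc 0 b) : 0 ≤ e x y := by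
  by_contra hneg
  rw [not_le] at hneg
  -- The segment from (x, y) to (a, b) increases in both coordinates, so the rectangle below any of
  -- its points contains the one below (x, y).
  have hmem : ∀ τ ∈ Icc (0 : ℝ) 1, x ≤ x + τ * (a - x) ∧ x + τ * (a - x) ≤ a ∧
      y ≤ y + τ * (b - y) ∧ y + τ * (b - y) ≤ b := by
    intro τ hτ
    have := hx.2
    have := hy.2
    refine ⟨?_, ?_, ?_, ?_⟩ <;> nlinarith [hτ.1, hτ.2]
  have hc : ContinuousOn (fun τ => e (x + τ * (a - x)) (y + τ * (b - y))) (Icc 0 1) :=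
    he.comp (f := fun τ => (x + τ * (a - x), y + τ * (b - y))) (by fun_prop) fun τ hτ => by
      obtain ⟨h1, h2, h3, h4⟩ := hmem τ hτ
      exact ⟨⟨hx.1.le.trans h1, h2⟩, hy.1.le.trans h3, h4⟩
  have hivt := intermediate_value_Icc zero_le_one hc
  obtain ⟨τ, hτ, hz⟩ := hivt (show (0 : ℝ) ∈ Icc _ _ from ⟨by simpa using hneg.le, by simpa using h0⟩)
  obtain ⟨h1, h2, h3, h4⟩ := hmem τ hτ
  have hx' : x + τ * (a - x) ∈ Ioc 0 a := ⟨hx.1.trans_le h1, h2⟩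
  have hy' : y + τ * (b - y) ∈ Ioc 0 b := ⟨hy.1.trans_le h3, h4⟩
  have hK := hef _ hx' _ hy'
  simp only at hz
  rw [hz, abs_zero] at hK
  have := katInt_eq_zero_of_le hα₁ hα₂ hρ₁ hρ₂ hf0 h1 h3 (hf _ hx' _ hy') hK.symm
  rw [← hef x hx y hy, abs_eq_zero] at this
  exact hneg.ne this

/-- The left end point of the increment of `υ`. -/
noncomputable def incLo (υ : ℝ → ℝ → FuzzyNum) (r x y : ℝ) : ℝ :=
  (υ x y).lo r + (υ 0 0).lo r - (υ x 0).lo r - (υ 0 y).lo r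

/-- The right end point of the increment of `υ`. -/
noncomputable def incHi (υ : ℝ → ℝ → FuzzyNum) (r x y : ℝ) : ℝ :=
  (υ x y).hi r + (υ 0 0).hi r - (υ x 0).hi r - (υ 0 y).hi r

lemma isIncrI_iff (υ g : ℝ → ℝ → FuzzyNum) (x y : ℝ) : IsIncrI υ g x y ↔
    ∀ r ∈ Icc (0 : ℝ) 1, (g x y).lo r = incLo υ r x y ∧ (g x y).hi r = incHi υ r x y := by
  rw [IsIncrI, isHDiff_iff]
  refine forall₂_congr fun r hr => ?_
  rw [(add_lo_hi _ _ hr.2).1, (add_lo_hi _ _ hr.2).2, (add_lo_hi _ _ hr.2).1,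
    (add_lo_hi _ _ hr.2).2, incLo, incHi]
  constructor <;> rintro ⟨h1, h2⟩ <;> constructor <;> linarith

lemma isIncrII_iff (υ g : ℝ → ℝ → FuzzyNum) (x y : ℝ) : IsIncrII υ g x y ↔
    ∀ r ∈ Icc (0 : ℝ) 1, (g x y).lo r = incHi υ r x y ∧ (g x y).hi r = incLo υ r x y := by
  rw [IsIncrII, isHDiffII_iff]
  refine forall₂_congr fun r hr => ?_
  rw [(add_lo_hi _ _ hr.2).1, (add_lo_hi _ _ hr.2).2, (add_lo_hi _ _ hr.2).1,
    (add_lo_hi _ _ hr.2).2, incLo, incHi]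
  constructor <;> rintro ⟨h1, h2⟩ <;> constructor <;> linarith

lemma continuousOn_inc {a b : ℝ} (ha : 0 ≤ a) (hb : 0 ≤ b) {υ : ℝ → ℝ → FuzzyNum}
    (hυ : ContOn υ (Icc 0 a ×ˢ Icc 0 b)) {r : ℝ} (hr : r ∈ Icc (0 : ℝ) 1) :
    ContinuousOn (fun p : ℝ × ℝ => incLo υ r p.1 p.2) (Icc 0 a ×ˢ Icc 0 b) ∧
      ContinuousOn (fun p : ℝ × ℝ => incHi υ r p.1 p.2) (Icc 0 a ×ˢ Icc 0 b) := by
  have key : ∀ {f : ℝ → ℝ → ℝ},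
      ContinuousOn (fun p : ℝ × ℝ => f p.1 p.2) (Icc 0 a ×ˢ Icc 0 b) →
      ContinuousOn (fun p : ℝ × ℝ => f p.1 p.2 + f 0 0 - f p.1 0 - f 0 p.2)
        (Icc 0 a ×ˢ Icc 0 b) := by
    intro f hf
    have h1 : ContinuousOn (fun p : ℝ × ℝ => f p.1 0) (Icc 0 a ×ˢ Icc 0 b) :=
      hf.comp (f := fun p : ℝ × ℝ => (p.1, (0 : ℝ))) (by fun_prop)
        fun p hp => ⟨hp.1, left_mem_Icc.2 hb⟩
    have h2 : ContinuousOn (fun p : ℝ × ℝ => f 0 p.2) (Icc 0 a ×ˢ Icc 0 b) :=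
      hf.comp (f := fun p : ℝ × ℝ => ((0 : ℝ), p.2)) (by fun_prop)
        fun p hp => ⟨left_mem_Icc.2 ha, hp.2⟩
    exact ((hf.add continuousOn_const).sub h1).sub h2
  obtain ⟨h1, h2⟩ := continuousOn_lo_hi hυ hr
  exact ⟨key (f := fun x y => (υ x y).lo r) h1, key (f := fun x y => (υ x y).hi r) h2⟩

/-- The increment is the integral of the Caputo–Katugampola derivative, and the clause which
holds at the corner `(a, b)` holds at every point. -/
lemma HasKatDeriv.incr {a b : ℝ} (ha : 0 < a) (hb : 0 < b) {φ ρ : ℝ × ℝ}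
    (hφ₁ : φ.1 ∈ Ioo (0 : ℝ) 1) (hφ₂ : φ.2 ∈ Ioo (0 : ℝ) 1) (hρ₁ : 0 < ρ.1) (hρ₂ : 0 < ρ.2)
    {υ g d : ℝ → ℝ → FuzzyNum} (hυ : ContOn υ (Icc 0 a ×ˢ Icc 0 b))
    (hg : ∀ x ∈ Ioc 0 a, ∀ y ∈ Ioc 0 b, IsIncrI υ g x y ∨ IsIncrII υ g x y)
    (h : HasKatDeriv a b φ ρ g d) (hint : KatIntegrableOn a b φ ρ d) :
    (∀ x ∈ Ioc 0 a, ∀ y ∈ Ioc 0 b, HasFuzzyKatInt φ ρ d x y (g x y)) ∧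
      (IsIncrI υ g a b → ∀ x ∈ Ioc 0 a, ∀ y ∈ Ioc 0 b, IsIncrI υ g x y) ∧
      (IsIncrII υ g a b → ∀ x ∈ Ioc 0 a, ∀ y ∈ Ioc 0 b, IsIncrII υ g x y) := by
  have hmm : ∀ r ∈ Icc (0 : ℝ) 1, ∀ x ∈ Ioc 0 a, ∀ y ∈ Ioc 0 b,
      ((g x y).lo r = incLo υ r x y ∧ (g x y).hi r = incHi υ r x y) ∨
        ((g x y).lo r = incHi υ r x y ∧ (g x y).hi r = incLo υ r x y) := fun r hr x hx y hy =>
    (hg x hx y hy).imp (fun h => (isIncrI_iff υ g x y).1 h r hr)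
      fun h => (isIncrII_iff υ g x y).1 h r hr
  have hI : ∀ r ∈ Icc (0 : ℝ) 1, ∀ x ∈ Ioc 0 a, ∀ y ∈ Ioc 0 b,
      (g x y).lo r = katInt φ ρ (fun s t => (d s t).lo r) x y ∧
        (g x y).hi r = katInt φ ρ (fun s t => (d s t).hi r) x y := by
    intro r hr x hx y hy
    obtain ⟨c1, c2⟩ := continuousOn_inc ha.le hb.le hυ hr
    -- The end points of g are the smaller and the larger of the two increments. These are
    -- continuous up to the axes even if the clause varies from point to point.
    refine h.eq_katInt hφ₁ hφ₂ hρ₁ hρ₂ hint hr (γ₁ := fun x y => min (incLo υ r x y) (incHi υ r x y))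
      (γ₂ := fun x y => max (incLo υ r x y) (incHi υ r x y)) (c1.inf c2) (c1.sup c2)
      (fun x hx y hy => ?_) (fun x hx y hy => ?_) hx hy
    · have := (g x y).lo_le_hi hr.2
      rcases hmm r hr x hx y hy with ⟨h1, h2⟩ | ⟨h1, h2⟩
      · rw [min_eq_left (by linarith), h1]
      · rw [min_eq_right (by linarith), h1]
    · have := (g x y).lo_le_hi hr.2
      rcases hmm r hr x hx y hy with ⟨h1, h2⟩ | ⟨h1, h2⟩
      · rw [max_eq_right (by linarith), h2]
      · rw [max_eq_left (by linarith), h2]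
  -- The gap between the increments is, up to sign, the length of the level of g, which by `hI` is
  -- I^φ of the length of the level of d.
  have habs : ∀ r ∈ Icc (0 : ℝ) 1, ∀ x ∈ Ioc 0 a, ∀ y ∈ Ioc 0 b,
      |incHi υ r x y - incLo υ r x y| = (g x y).hi r - (g x y).lo r := by
    intro r hr x hx y hy
    have := (g x y).lo_le_hi hr.2
    rcases hmm r hr x hx y hy with ⟨h1, h2⟩ | ⟨h1, h2⟩
    · rw [abs_of_nonneg (by linarith)]; linarith
    · rw [abs_of_nonpos (by linarith)]; linarith
  have hlen : ∀ r ∈ Icc (0 : ℝ) 1, ∀ x ∈ Ioc 0 a, ∀ y ∈ Ioc 0 b,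
      KatIntegrable φ ρ (fun s t => (d s t).hi r - (d s t).lo r) x y ∧
      katInt φ ρ (fun s t => (d s t).hi r - (d s t).lo r) x y = (g x y).hi r - (g x y).lo r := by
    intro r hr x hx y hy
    obtain ⟨i1, i2⟩ := hint x hx y hy r hr
    have e : (fun p : ℝ × ℝ => katKernel φ ρ x y p * ((d p.1 p.2).hi r - (d p.1 p.2).lo r)) =
        fun p => katKernel φ ρ x y p * (d p.1 p.2).hi r -
          katKernel φ ρ x y p * (d p.1 p.2).lo r := funext fun p => mul_sub _ _ _
    rw [(hI r hr x hx y hy).1, (hI r hr x hx y hy).2]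
    unfold KatIntegrable katInt
    simp only [e]
    exact ⟨i2.sub i1, integral_sub i2 i1⟩
  have hpos : ∀ r ∈ Icc (0 : ℝ) 1, ∀ s t, 0 ≤ (d s t).hi r - (d s t).lo r :=
    fun r hr s t => sub_nonneg.2 ((d s t).lo_le_hi hr.2)
  have hab : a ∈ Ioc 0 a ∧ b ∈ Ioc 0 b := ⟨right_mem_Ioc.2 ha, right_mem_Ioc.2 hb⟩
  refine ⟨fun x hx y hy => ⟨hint x hx y hy, fun r hr => ?_⟩, fun hc x hx y hy => ?_,
    fun hc x hx y hy => ?_⟩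
  · rw [← (hI r hr x hx y hy).1, ← (hI r hr x hx y hy).2, level_eq_Icc _ hr.2]
  · rw [isIncrI_iff] at hc ⊢
    intro r hr
    obtain ⟨c1, c2⟩ := continuousOn_inc ha.le hb.le hυ hr
    have h0 := (g a b).lo_le_hi hr.2
    rw [(hc r hr).1, (hc r hr).2] at h0
    have := nonneg_of_abs_eq_katInt hφ₁.1 hφ₂.1 hρ₁ hρ₂ (hpos r hr)
      (fun x hx y hy => (hlen r hr x hx y hy).1)
      (e := fun x y => incHi υ r x y - incLo υ r x y) (c2.sub c1)
      (fun x hx y hy => by rw [habs r hr x hx y hy, (hlen r hr x hx y hy).2]) (sub_nonneg.2 h0) hx hy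
    have h2 := (g x y).lo_le_hi hr.2
    rcases hmm r hr x hx y hy with h3 | ⟨h3, h4⟩
    · exact h3
    -- The opposite clause would put the increments in the reverse order; they are then equal, and
    -- both clauses hold at this level.
    · constructor <;> linarith
  · rw [isIncrII_iff] at hc ⊢
    intro r hr
    obtain ⟨c1, c2⟩ := continuousOn_inc ha.le hb.le hυ hr
    have h0 := (g a b).lo_le_hi hr.2
    rw [(hc r hr).1, (hc r hr).2] at h0
    have := nonneg_of_abs_eq_katInt hφ₁.1 hφ₂.1 hρ₁ hρ₂ (hpos r hr)
      (fun x hx y hy => (hlen r hr x hx y hy).1)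
      (e := fun x y => incLo υ r x y - incHi υ r x y) (c1.sub c2)
      (fun x hx y hy => by rw [abs_sub_comm, habs r hr x hx y hy, (hlen r hr x hx y hy).2])
      (sub_nonneg.2 h0) hx hy
    have h2 := (g x y).lo_le_hi hr.2
    rcases hmm r hr x hx y hy with ⟨h3, h4⟩ | h3
    · constructor <;> linarith
    · exact h3

/-! ### The Volterra equations at the boundary -/

/-- The domain of integration is empty on the axes, so the Volterra equations, posed on the closed
rectangle, reduce there to the boundary conditions. -/
lemma hasFuzzyKatInt_zero (α ρ : ℝ × ℝ) (f : ℝ → ℝ → FuzzyNum) {x y : ℝ} (h : x = 0 ∨ y = 0) :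
    HasFuzzyKatInt α ρ f x y 0 := by
  have hR : Ioo 0 x ×ˢ Ioo 0 y = (∅ : Set (ℝ × ℝ)) := by
    rcases h with rfl | rfl <;> simp
  refine ⟨fun r hr => ?_, fun r hr => ?_⟩
  · simp [KatIntegrable, hR]
  · simp [katInt, hR, level_zero hr.2]

/-- The boundary values give υ(x,0) + υ(0,y) = ξ₁(0) + h(x,y). Cancelling ξ₁(0), legitimate after
embedding by `ends`, leaves the pointwise form of one or the other Volterra equation. -/
lemma HasBoundary.incr_iff {a b : ℝ} {ξ₁ ξ₂ : ℝ → FuzzyNum}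
    {h υ : ℝ → ℝ → FuzzyNum} (hh : IsDarbouxData a b ξ₁ ξ₂ h) (hB : HasBoundary a b ξ₁ ξ₂ υ)
    {g : ℝ → ℝ → FuzzyNum} {x y : ℝ} (hx : x ∈ Icc 0 a) (hy : y ∈ Icc 0 b) :
    (IsIncrI υ g x y ↔ υ x y = h x y + g x y) ∧
      (IsIncrII υ g x y ↔ IsHDiff (h x y) ((-1 : ℝ) • g x y) (υ x y)) := by
  have ha : (0 : ℝ) ∈ Icc 0 a := left_mem_Icc.2 (hx.1.trans hx.2)
  have e0 : υ 0 0 = ξ₁ 0 := hB.1 0 ha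
  have e1 : υ x 0 = ξ₁ x := hB.1 x hx
  have e2 : υ 0 y = ξ₂ y := hB.2 y hy
  have hd := congrArg ends (hh x hx y hy)
  rw [ends_add, ends_add] at hd
  constructor
  · rw [IsIncrI, IsHDiff, e0, e1, e2, ← ends_injective.eq_iff, ← ends_injective.eq_iff]
    simp only [ends_add]
    rw [hd]
    constructor
    · intro h'
      refine add_right_cancel (b := ends (ξ₁ 0)) (h'.trans ?_)
      abel
    · intro h'
      rw [h']; abel
  · rw [IsIncrII, IsHDiffII, IsHDiff, e0, e1, e2, ← ends_injective.eq_iff,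
      ← ends_injective.eq_iff]
    simp only [ends_add]
    rw [hd]
    constructor
    · intro h'
      refine add_left_cancel (a := ends (ξ₁ 0)) (h'.trans ?_)
      abel
    · intro h'
      rw [h']; abel

lemma IsDarbouxData.boundary {a b : ℝ} {ξ₁ ξ₂ : ℝ → FuzzyNum} (hξ : ξ₁ 0 = ξ₂ 0)
    {h : ℝ → ℝ → FuzzyNum} (hh : IsDarbouxData a b ξ₁ ξ₂ h) {x y : ℝ} (hx : x ∈ Icc 0 a)
    (hy : y ∈ Icc 0 b) : (y = 0 → h x y = ξ₁ x) ∧ (x = 0 → h x y = ξ₂ y) := by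
  have hd := congrArg ends (hh x hx y hy)
  rw [ends_add, ends_add] at hd
  constructor <;> rintro rfl <;> refine ends_injective ?_
  · rw [← hξ] at hd
    exact (add_left_cancel ((add_comm _ _).trans hd)).symm
  · exact (add_left_cancel hd).symm

lemma IsDarbouxData.eq_of_boundary {a b : ℝ} {ξ₁ ξ₂ : ℝ → FuzzyNum} (hξ : ξ₁ 0 = ξ₂ 0)
    {h υ : ℝ → ℝ → FuzzyNum} (hh : IsDarbouxData a b ξ₁ ξ₂ h) (hB : HasBoundary a b ξ₁ ξ₂ υ)
    {x y : ℝ} (hx : x ∈ Icc 0 a) (hy : y ∈ Icc 0 b) (h0 : x = 0 ∨ y = 0) : υ x y = h x y := by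
  obtain ⟨b1, b2⟩ := hh.boundary hξ hx hy
  rcases h0 with h0 | h0
  · rw [b2 h0, h0, hB.2 y hy]
  · rw [b1 h0, h0, hB.1 x hx]

lemma fuzzy_add_zero (p : FuzzyNum) : p + 0 = p :=
  ends_injective (by rw [ends_add, ends_zero, add_zero])

lemma isHDiff_neg_zero (p : FuzzyNum) : IsHDiff p ((-1 : ℝ) • (0 : FuzzyNum)) p :=
  ends_injective (by
    rw [ends_add, ends_neg_smul (by norm_num), ends_zero, Prod.swap_zero, smul_zero, zero_add])

lemma volterra_of_incr {a b : ℝ} {φ ρ : ℝ × ℝ} {ξ₁ ξ₂ : ℝ → FuzzyNum} (hξ : ξ₁ 0 = ξ₂ 0)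
    {h υ g f : ℝ → ℝ → FuzzyNum} (hh : IsDarbouxData a b ξ₁ ξ₂ h) (hB : HasBoundary a b ξ₁ ξ₂ υ)
    (hI : ∀ x ∈ Ioc 0 a, ∀ y ∈ Ioc 0 b, HasFuzzyKatInt φ ρ f x y (g x y)) :
    ((∀ x ∈ Ioc 0 a, ∀ y ∈ Ioc 0 b, IsIncrI υ g x y) → VolterraPlus a b φ ρ h f υ) ∧
      ((∀ x ∈ Ioc 0 a, ∀ y ∈ Ioc 0 b, IsIncrII υ g x y) → VolterraMinus a b φ ρ h f υ) := by
  have hsplit : ∀ x ∈ Icc 0 a, ∀ y ∈ Icc 0 b, (x = 0 ∨ y = 0) ∨ (x ∈ Ioc 0 a ∧ y ∈ Ioc 0 b) := by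
    intro x hx y hy
    rcases hx.1.eq_or_lt with h1 | h1
    · exact Or.inl (Or.inl h1.symm)
    · rcases hy.1.eq_or_lt with h2 | h2
      · exact Or.inl (Or.inr h2.symm)
      · exact Or.inr ⟨⟨h1, hx.2⟩, h2, hy.2⟩
  constructor
  · intro hc x hx y hy
    rcases hsplit x hx y hy with h0 | ⟨hx', hy'⟩
    · exact ⟨0, hasFuzzyKatInt_zero φ ρ f h0, by rw [fuzzy_add_zero, hh.eq_of_boundary hξ hB hx hy h0]⟩
    · exact ⟨_, hI x hx' y hy', ((hB.incr_iff hh hx hy).1).1 (hc x hx' y hy')⟩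
  · intro hc x hx y hy
    rcases hsplit x hx y hy with h0 | ⟨hx', hy'⟩
    · refine ⟨0, hasFuzzyKatInt_zero φ ρ f h0, ?_⟩
      rw [hh.eq_of_boundary hξ hB hx hy h0]
      exact isHDiff_neg_zero _
    · exact ⟨_, hI x hx' y hy', ((hB.incr_iff hh hx hy).2).1 (hc x hx' y hy')⟩

/-! ### Integration and differentiation in the Banach space of end points -/

/-- The cone is cut out by inequalities between continuous linear functionals, and integration
preserves each of them. -/
lemma integral_mem_endCone {α : Type*} [MeasurableSpace α] {μ : Measure α} {S : Set α}
    (hS : MeasurableSet S) {p : α → EndSpace} (hp : IntegrableOn p S μ)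
    (h : ∀ s ∈ S, p s ∈ endCone) : ∫ s in S, p s ∂μ ∈ endCone := by
  have hL : ∀ L : EndSpace →L[ℝ] ℝ, IntegrableOn (fun s => L (p s)) S μ ∧
      ∫ s in S, L (p s) ∂μ = L (∫ s in S, p s ∂μ) :=
    fun L => ⟨L.integrable_comp hp, L.integral_comp_comm hp⟩
  have key : ∀ L₁ L₂ : EndSpace →L[ℝ] ℝ, (∀ s ∈ S, L₁ (p s) ≤ L₂ (p s)) →
      L₁ (∫ s in S, p s ∂μ) ≤ L₂ (∫ s in S, p s ∂μ) := by
    intro L₁ L₂ h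
    rw [← (hL L₁).2, ← (hL L₂).2]
    exact setIntegral_mono_on (hL L₁).1 (hL L₂).1 hS h
  exact ⟨fun r s hrs => key (evalLo r) (evalLo s) fun z hz => (h z hz).1 r s hrs,
    fun r s hrs => key (evalHi s) (evalHi r) fun z hz => (h z hz).2.1 r s hrs,
    fun r => key (evalLo r) (evalHi r) fun z hz => (h z hz).2.2 r⟩

/-- The fuzzy number with the given end points, or `0` if there is none. -/
noncomputable def ofEnds (w : EndSpace) : FuzzyNum :=
  open Classical in if h : w ∈ endCone then (exists_ends_eq h).choose else 0

lemma ends_ofEnds {w : EndSpace} (hw : w ∈ endCone) : ends (ofEnds w) = w := by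
  rw [ofEnds, dif_pos hw]
  exact (exists_ends_eq hw).choose_spec

/-- When the increments lie in the cone the required differences exist as fuzzy numbers, and the
gH-difference quotient embeds as the slope of `ends ∘ f`. -/
lemma hasGHDerivI_of_ends {f : ℝ → FuzzyNum} {f' : FuzzyNum} {s : Set ℝ} {x : ℝ} (hx : x ∈ s)
    (hd : HasDerivWithinAt (fun u => ends (f u)) (ends f') s x)
    (hmono : ∀ u ∈ s, ∀ v ∈ s, u ≤ v → ends (f v) - ends (f u) ∈ endCone) :
    HasGHDerivI f f' s x := by
  have hneg : ∀ p : FuzzyNum, ends ((-1 : ℝ) • p) = -(ends p).swap := fun p => by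
    rw [ends_neg_smul (by norm_num), neg_one_smul]
  -- For u < x it is f(x) ⊖ f(u) that exists, and clause (ii) holds with its negative. This sign and
  -- that of (u - x)⁻¹ interchange the end points twice, so the order is restored.
  refine ⟨⟨fun u => open Classical in if x ≤ u then ofEnds (ends (f u) - ends (f x)) else
    (-1 : ℝ) • ofEnds (ends (f x) - ends (f u)), ?_, ?_⟩, fun r hr => ?_⟩
  · filter_upwards [self_mem_nhdsWithin] with u hu
    by_cases hxu : x ≤ u
    · simp only [hxu, if_true]
      refine Or.inl (ends_injective ?_)
      rw [ends_add, ends_ofEnds (hmono x hx u hu.1 hxu), add_sub_cancel]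
    · simp only [hxu, if_false]
      refine Or.inr (ends_injective ?_)
      rw [ends_add, hneg, hneg, ends_ofEnds (hmono u hu.1 x hx (not_le.1 hxu).le), Prod.swap_neg,
        neg_neg, Prod.swap_swap, add_sub_cancel]
  · rw [tendsto_D_iff]
    refine (hasDerivWithinAt_iff_tendsto_slope.1 hd).congr' ?_
    filter_upwards [self_mem_nhdsWithin] with u hu
    by_cases hxu : x ≤ u
    · have hlt : 0 < u - x := sub_pos.2 (lt_of_le_of_ne hxu (Ne.symm hu.2))
      simp only [hxu, if_true]
      rw [ends_smul (inv_pos.2 hlt), ends_ofEnds (hmono x hx u hu.1 hxu), slope_def_module]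
    · have hlt : u - x < 0 := sub_neg.2 (not_le.1 hxu)
      simp only [hxu, if_false]
      rw [ends_neg_smul (inv_lt_zero.2 hlt), hneg, ends_ofEnds (hmono u hu.1 x hx (not_le.1 hxu).le),
        Prod.swap_neg, Prod.swap_swap, neg_sub, slope_def_module]
  · exact ⟨(evalLo ⟨r, hr⟩).hasFDerivAt.comp_hasDerivWithinAt x hd,
      (evalHi ⟨r, hr⟩).hasFDerivAt.comp_hasDerivWithinAt x hd⟩

section Vector

variable {X : Type*} [NormedAddCommGroup X] [NormedSpace ℝ X]

/-- Relative to (0, a] the derivative at x = a is one-sided, hence the two cases. Since p may be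
unbounded near 0, its integrability is a separate assumption. -/
lemma hasDerivWithinAt_integral_Ioc [CompleteSpace X] {a : ℝ} {p : ℝ → X}
    (hc : ContinuousOn p (Ioc 0 a)) (hi : IntegrableOn p (Ioc 0 a)) {x : ℝ} (hx : x ∈ Ioc 0 a) :
    HasDerivWithinAt (fun u => ∫ s in Ioc 0 u, p s) (p x) (Ioc 0 a) x := by
  have hii : IntervalIntegrable p volume 0 x :=
    (intervalIntegrable_iff_integrableOn_Ioc_of_le hx.1.le).2
      (hi.mono_set (Ioc_subset_Ioc_right hx.2))
  have hmeas : StronglyMeasurableAtFilter p (𝓝[Ioc 0 a] x) volume :=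
    ⟨Ioc 0 a, self_mem_nhdsWithin, hi.aestronglyMeasurable⟩
  have hd : HasDerivWithinAt (fun u => ∫ s in (0 : ℝ)..u, p s) (p x) (Ioc 0 a) x := by
    rcases hx.2.eq_or_lt with rfl | hlt
    · have hle : 𝓝[Ioc 0 x] x = 𝓝[≤] x := nhdsWithin_Ioc_eq_nhdsLE hx.1
      have h1 : HasDerivWithinAt (fun u => ∫ s in (0 : ℝ)..u, p s) (p x) (Iic x) x :=
        intervalIntegral.integral_hasDerivWithinAt_right hii (hle ▸ hmeas) (by
          have := hc x hx
          rwa [ContinuousWithinAt, hle] at this)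
      exact h1.mono Ioc_subset_Iic_self
    · have hn : Ioc 0 a ∈ 𝓝 x := Ioc_mem_nhds hx.1 hlt
      have he : 𝓝[Ioc 0 a] x = 𝓝 x := nhdsWithin_eq_nhds.2 hn
      exact (intervalIntegral.integral_hasDerivAt_right hii (he ▸ hmeas)
        (hc.continuousAt hn)).hasDerivWithinAt
  refine hd.congr (fun u hu => ?_) ?_
  · rw [intervalIntegral.integral_of_le hu.1.le]
  · rw [intervalIntegral.integral_of_le hx.1.le]

lemma integral_Ioc_sub_integral_Ioc {a u v : ℝ} {p : ℝ → X} (hi : IntegrableOn p (Ioc 0 a))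
    (hu : 0 ≤ u) (huv : u ≤ v) (hv : v ≤ a) :
    (∫ s in Ioc 0 v, p s) - ∫ s in Ioc 0 u, p s = ∫ s in Ioc u v, p s := by
  have hii : ∀ w, 0 ≤ w → w ≤ a → IntervalIntegrable p volume 0 w := fun w h0 h1 =>
    (intervalIntegrable_iff_integrableOn_Ioc_of_le h0).2 (hi.mono_set (Ioc_subset_Ioc_right h1))
  rw [← intervalIntegral.integral_of_le hu, ← intervalIntegral.integral_of_le (hu.trans huv),
    ← intervalIntegral.integral_of_le huv]
  exact intervalIntegral.integral_interval_sub_left (hii v (hu.trans huv) hv)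
    (hii u hu (huv.trans hv))

/-- The variable upper limit becomes an indicator, which converges for every t different from the
limiting end point, and dominated convergence applies. -/
lemma continuousOn_integral_Ioc {a b : ℝ} {G : ℝ → ℝ → X}
    (hG : ContinuousOn (fun z : ℝ × ℝ => G z.1 z.2) (Ioc 0 a ×ˢ Ioc 0 b)) {B : ℝ → ℝ}
    (hB : IntegrableOn B (Ioc 0 b)) (hb : ∀ x ∈ Ioc 0 a, ∀ t ∈ Ioc 0 b, ‖G x t‖ ≤ B t) :
    ContinuousOn (fun z : ℝ × ℝ => ∫ t in Ioc 0 z.2, G z.1 t) (Ioc 0 a ×ˢ Ioc 0 b) := by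
  have hGx : ∀ x ∈ Ioc 0 a, ContinuousOn (G x) (Ioc 0 b) := fun x hx =>
    hG.comp (f := fun t => (x, t)) (by fun_prop) fun t ht => ⟨hx, ht⟩
  have e : ∀ z ∈ Ioc 0 a ×ˢ Ioc 0 b, ∫ t in Ioc 0 z.2, G z.1 t =
      ∫ t in Ioc 0 b, (Iic z.2).indicator (G z.1) t := by
    intro z hz
    rw [setIntegral_indicator measurableSet_Iic]
    congr 2
    ext t
    exact ⟨fun h => ⟨⟨h.1, h.2.trans hz.2.2⟩, h.2⟩, fun h => ⟨h.1.1, h.2⟩⟩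
  refine ContinuousOn.congr (fun z hz => ?_) e
  refine continuousWithinAt_of_dominated (bound := B) ?_ ?_ hB ?_
  · filter_upwards [self_mem_nhdsWithin] with z hz
    exact ((hGx z.1 hz.1).aestronglyMeasurable measurableSet_Ioc).indicator measurableSet_Iic
  · filter_upwards [self_mem_nhdsWithin] with z hz
    refine (ae_restrict_iff' measurableSet_Ioc).2 (Eventually.of_forall fun t ht => ?_)
    exact (norm_indicator_le_norm_self _ _).trans (hb z.1 hz.1 t ht)
  · have hne : ∀ᵐ t ∂(volume.restrict (Ioc 0 b)), t ≠ z.2 :=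
      ae_restrict_of_ae (by simp [ae_iff, measure_singleton])
    filter_upwards [hne, ae_restrict_mem measurableSet_Ioc] with t ht htb
    rcases lt_or_gt_of_ne ht with h | h
    · have hev : ∀ᶠ w : ℝ × ℝ in 𝓝[Ioc 0 a ×ˢ Ioc 0 b] z, t < w.2 :=
        nhdsWithin_le_nhds (continuous_snd.continuousAt.eventually (lt_mem_nhds h))
      have hcw : ContinuousWithinAt (fun w : ℝ × ℝ => G w.1 t) (Ioc 0 a ×ˢ Ioc 0 b) z :=
        ContinuousWithinAt.comp (f := fun w : ℝ × ℝ => (w.1, t)) (hG (z.1, t) ⟨hz.1, htb⟩)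
          (by fun_prop) fun w hw => ⟨hw.1, htb⟩
      refine hcw.congr_of_eventuallyEq ?_ (indicator_of_mem (show t ∈ Iic z.2 from h.le) _)
      filter_upwards [hev] with w hw
      exact indicator_of_mem (show t ∈ Iic w.2 from hw.le) _
    · have hev : ∀ᶠ w : ℝ × ℝ in 𝓝[Ioc 0 a ×ˢ Ioc 0 b] z, w.2 < t :=
        nhdsWithin_le_nhds (continuous_snd.continuousAt.eventually (gt_mem_nhds h))
      refine (continuousWithinAt_const (b := (0 : X))).congr_of_eventuallyEq ?_
        (indicator_of_notMem (show t ∉ Iic z.2 from not_le.2 h) _)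
      filter_upwards [hev] with w hw
      exact indicator_of_notMem (show t ∉ Iic w.2 from not_le.2 hw) _

end Vector

lemma integrableOn_rpow_Ioc {ρ : ℝ} (hρ : 0 < ρ) (b : ℝ) :
    IntegrableOn (fun t : ℝ => t ^ (ρ - 1)) (Ioc 0 b) := by
  rcases le_or_gt b 0 with h | h
  · rw [Ioc_eq_empty (not_lt.2 h)]; exact integrableOn_empty
  · exact (intervalIntegrable_iff_integrableOn_Ioc_of_le h.le).1
      (intervalIntegral.intervalIntegrable_rpow' (by linarith))

/-! ### From the integral to the derivative -/

/-- The first iterated integral, `x^{ρ₁-1} ∫₀^y t^{ρ₂-1} v(x,t) dt`. -/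
noncomputable def katPrim (ρ : ℝ × ℝ) (v : ℝ → ℝ → EndSpace) (x y : ℝ) : EndSpace :=
  x ^ (ρ.1 - 1) • ∫ t in Ioc 0 y, t ^ (ρ.2 - 1) • v x t

lemma continuousOn_rpow_Ioc (a κ : ℝ) : ContinuousOn (fun x : ℝ => x ^ κ) (Ioc 0 a) :=
  fun x hx => (Real.continuousAt_rpow_const x κ (Or.inl hx.1.ne')).continuousWithinAt

section Iterated

variable {a b M : ℝ} {ρ : ℝ × ℝ} {v : ℝ → ℝ → EndSpace}

lemma continuousOn_smul_right
    (hv : ContinuousOn (fun z : ℝ × ℝ => v z.1 z.2) (Ioc 0 a ×ˢ Ioc 0 b)) :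
    ContinuousOn (fun z : ℝ × ℝ => z.2 ^ (ρ.2 - 1) • v z.1 z.2) (Ioc 0 a ×ˢ Ioc 0 b) :=
  ((continuousOn_rpow_Ioc b (ρ.2 - 1)).comp continuousOn_snd fun _ hz => hz.2).smul hv

lemma norm_smul_right_le (hM : ∀ x ∈ Ioc 0 a, ∀ y ∈ Ioc 0 b, ‖v x y‖ ≤ M) {x t : ℝ}
    (hx : x ∈ Ioc 0 a) (ht : t ∈ Ioc 0 b) :
    ‖t ^ (ρ.2 - 1) • v x t‖ ≤ t ^ (ρ.2 - 1) * M := by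
  have h0 := Real.rpow_nonneg ht.1.le (ρ.2 - 1)
  rw [norm_smul, Real.norm_of_nonneg h0]
  exact mul_le_mul_of_nonneg_left (hM x hx t ht) h0

lemma integrableOn_smul_right (hρ₂ : 0 < ρ.2)
    (hv : ContinuousOn (fun z : ℝ × ℝ => v z.1 z.2) (Ioc 0 a ×ˢ Ioc 0 b))
    (hM : ∀ x ∈ Ioc 0 a, ∀ y ∈ Ioc 0 b, ‖v x y‖ ≤ M) {x : ℝ} (hx : x ∈ Ioc 0 a) :
    ContinuousOn (fun t => t ^ (ρ.2 - 1) • v x t) (Ioc 0 b) ∧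
      IntegrableOn (fun t => t ^ (ρ.2 - 1) • v x t) (Ioc 0 b) := by
  have hc : ContinuousOn (fun t => t ^ (ρ.2 - 1) • v x t) (Ioc 0 b) :=
    (continuousOn_smul_right hv).comp (f := fun t => (x, t)) (by fun_prop) fun t ht => ⟨hx, ht⟩
  exact ⟨hc, Integrable.mono' ((integrableOn_rpow_Ioc hρ₂ b).mul_const M)
    (hc.aestronglyMeasurable measurableSet_Ioc) ((ae_restrict_iff' measurableSet_Ioc).2
      (Eventually.of_forall fun t ht => norm_smul_right_le hM hx ht))⟩

lemma continuousOn_katPrim (hρ₂ : 0 < ρ.2)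
    (hv : ContinuousOn (fun z : ℝ × ℝ => v z.1 z.2) (Ioc 0 a ×ˢ Ioc 0 b))
    (hM : ∀ x ∈ Ioc 0 a, ∀ y ∈ Ioc 0 b, ‖v x y‖ ≤ M) :
    ContinuousOn (fun z : ℝ × ℝ => katPrim ρ v z.1 z.2) (Ioc 0 a ×ˢ Ioc 0 b) :=
  ((continuousOn_rpow_Ioc a (ρ.1 - 1)).comp continuousOn_fst fun _ hz => hz.1).smul
    (continuousOn_integral_Ioc (G := fun x t => t ^ (ρ.2 - 1) • v x t)
      (continuousOn_smul_right hv) ((integrableOn_rpow_Ioc hρ₂ b).mul_const M)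
      fun _ hx _ ht => norm_smul_right_le hM hx ht)

/-- The bound is independent of y and a multiple of x^(ρ₁-1), integrable when ρ₁ > 0, as dominated
convergence in the outer integral requires. -/
lemma norm_katPrim_le (hρ₂ : 0 < ρ.2)
    (hM : ∀ x ∈ Ioc 0 a, ∀ y ∈ Ioc 0 b, ‖v x y‖ ≤ M) {x y : ℝ} (hx : x ∈ Ioc 0 a)
    (hy : y ∈ Ioc 0 b) :
    ‖katPrim ρ v x y‖ ≤ x ^ (ρ.1 - 1) * ∫ t in Ioc 0 b, t ^ (ρ.2 - 1) * M := by
  have h0 := Real.rpow_nonneg hx.1.le (ρ.1 - 1)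
  have hsub : Ioc 0 y ⊆ Ioc 0 b := Ioc_subset_Ioc_right hy.2
  have hi : IntegrableOn (fun t : ℝ => t ^ (ρ.2 - 1) * M) (Ioc 0 b) :=
    (integrableOn_rpow_Ioc hρ₂ b).mul_const M
  have hM0 : 0 ≤ M := (norm_nonneg _).trans (hM x hx y hy)
  rw [katPrim, norm_smul, Real.norm_of_nonneg h0]
  refine mul_le_mul_of_nonneg_left ?_ h0
  refine (norm_integral_le_of_norm_le (hi.mono_set hsub) ((ae_restrict_iff' measurableSet_Ioc).2
    (Eventually.of_forall fun t ht => norm_smul_right_le hM hx (hsub ht)))).trans ?_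
  refine setIntegral_mono_set hi ((ae_restrict_iff' measurableSet_Ioc).2
    (Eventually.of_forall fun t ht => mul_nonneg (Real.rpow_nonneg ht.1.le _) hM0))
    hsub.eventuallyLE

lemma integrableOn_katPrim (hρ₁ : 0 < ρ.1) (hρ₂ : 0 < ρ.2)
    (hv : ContinuousOn (fun z : ℝ × ℝ => v z.1 z.2) (Ioc 0 a ×ˢ Ioc 0 b))
    (hM : ∀ x ∈ Ioc 0 a, ∀ y ∈ Ioc 0 b, ‖v x y‖ ≤ M) {y : ℝ} (hy : y ∈ Ioc 0 b) :
    ContinuousOn (fun s => katPrim ρ v s y) (Ioc 0 a) ∧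
      IntegrableOn (fun s => katPrim ρ v s y) (Ioc 0 a) := by
  have hc : ContinuousOn (fun s => katPrim ρ v s y) (Ioc 0 a) :=
    (continuousOn_katPrim hρ₂ hv hM).comp (f := fun s => (s, y)) (by fun_prop)
      fun s hs => ⟨hs, hy⟩
  exact ⟨hc, Integrable.mono' ((integrableOn_rpow_Ioc hρ₁ a).mul_const _)
    (hc.aestronglyMeasurable measurableSet_Ioc) ((ae_restrict_iff' measurableSet_Ioc).2
      (Eventually.of_forall fun s hs => norm_katPrim_le hρ₂ hM hs hy))⟩

lemma continuousOn_integral_katPrim (hρ₁ : 0 < ρ.1) (hρ₂ : 0 < ρ.2)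
    (hv : ContinuousOn (fun z : ℝ × ℝ => v z.1 z.2) (Ioc 0 a ×ˢ Ioc 0 b))
    (hM : ∀ x ∈ Ioc 0 a, ∀ y ∈ Ioc 0 b, ‖v x y‖ ≤ M) :
    ContinuousOn (fun z : ℝ × ℝ => ∫ s in Ioc 0 z.1, katPrim ρ v s z.2)
      (Ioc 0 a ×ˢ Ioc 0 b) := by
  -- The outer integral is over the first variable, so the two variables exchange roles.
  have h := continuousOn_integral_Ioc (a := b) (b := a) (G := fun y s => katPrim ρ v s y)
    ((continuousOn_katPrim hρ₂ hv hM).comp continuous_swap.continuousOn fun z hz => ⟨hz.2, hz.1⟩)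
    ((integrableOn_rpow_Ioc hρ₁ a).mul_const _) fun y hy s hs => norm_katPrim_le hρ₂ hM hs hy
  exact h.comp continuous_swap.continuousOn fun z hz => ⟨hz.2, hz.1⟩

lemma hasDerivWithinAt_katPrim (hρ₂ : 0 < ρ.2)
    (hv : ContinuousOn (fun z : ℝ × ℝ => v z.1 z.2) (Ioc 0 a ×ˢ Ioc 0 b))
    (hM : ∀ x ∈ Ioc 0 a, ∀ y ∈ Ioc 0 b, ‖v x y‖ ≤ M) {x y : ℝ} (hx : x ∈ Ioc 0 a)
    (hy : y ∈ Ioc 0 b) :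
    HasDerivWithinAt (katPrim ρ v x) ((x ^ (ρ.1 - 1) * y ^ (ρ.2 - 1)) • v x y) (Ioc 0 b) y := by
  obtain ⟨hc, hi⟩ := integrableOn_smul_right hρ₂ hv hM hx
  rw [mul_smul]
  exact (hasDerivWithinAt_integral_Ioc hc hi hy).const_smul (x ^ (ρ.1 - 1))

/-- The increment is an integral over (y, y'] of cone elements with non-negative weights. This is
what makes the differentiation in y of type (i). -/
lemma katPrim_sub_mem_endCone (hρ₂ : 0 < ρ.2)
    (hv : ContinuousOn (fun z : ℝ × ℝ => v z.1 z.2) (Ioc 0 a ×ˢ Ioc 0 b))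
    (hM : ∀ x ∈ Ioc 0 a, ∀ y ∈ Ioc 0 b, ‖v x y‖ ≤ M) (hcone : ∀ x y, v x y ∈ endCone)
    {x y y' : ℝ} (hx : x ∈ Ioc 0 a) (hy0 : 0 ≤ y) (hyy' : y ≤ y') (hy' : y' ≤ b) :
    katPrim ρ v x y' - katPrim ρ v x y ∈ endCone := by
  obtain ⟨-, hi⟩ := integrableOn_smul_right (ρ := ρ) hρ₂ hv hM hx
  rw [katPrim, katPrim, ← smul_sub, integral_Ioc_sub_integral_Ioc hi hy0 hyy' hy']
  refine smul_mem_endCone (integral_mem_endCone measurableSet_Ioc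
    (hi.mono_set (Ioc_subset_Ioc hy0 hy')) fun t ht => ?_) (Real.rpow_nonneg hx.1.le _)
  exact smul_mem_endCone (hcone _ _) (Real.rpow_nonneg (hy0.trans ht.1.le) _)

lemma katPrim_mem_endCone (hρ₂ : 0 < ρ.2)
    (hv : ContinuousOn (fun z : ℝ × ℝ => v z.1 z.2) (Ioc 0 a ×ˢ Ioc 0 b))
    (hM : ∀ x ∈ Ioc 0 a, ∀ y ∈ Ioc 0 b, ‖v x y‖ ≤ M) (hcone : ∀ x y, v x y ∈ endCone)
    {x y : ℝ} (hx : x ∈ Ioc 0 a) (hy : y ∈ Ioc 0 b) : katPrim ρ v x y ∈ endCone := by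
  simpa [katPrim] using katPrim_sub_mem_endCone (ρ := ρ) hρ₂ hv hM hcone hx le_rfl hy.1.le hy.2

/-- Continuous functionals commute with both Bochner integrals, and Fubini turns the iterated
integral into a real integral of order 1. With `evalLo` and `evalHi` this computes the end points of
the candidate for I^{1-φ} g. -/
lemma apply_integral_katPrim (hρ₁ : 0 < ρ.1) (hρ₂ : 0 < ρ.2)
    (hv : ContinuousOn (fun z : ℝ × ℝ => v z.1 z.2) (Ioc 0 a ×ˢ Ioc 0 b))
    (hM : ∀ x ∈ Ioc 0 a, ∀ y ∈ Ioc 0 b, ‖v x y‖ ≤ M) (L : EndSpace →L[ℝ] ℝ)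
    {x y : ℝ} (hx : x ∈ Ioc 0 a) (hy : y ∈ Ioc 0 b) :
    KatIntegrable 1 ρ (fun s t => L (v s t)) x y ∧
      L (∫ s in Ioc 0 x, katPrim ρ v s y) = katInt 1 ρ (fun s t => L (v s t)) x y := by
  have hsub : Ioo 0 x ×ˢ Ioo 0 y ⊆ Ioc 0 a ×ˢ Ioc 0 b :=
    fun p hp => ⟨⟨hp.1.1, hp.1.2.le.trans hx.2⟩, hp.2.1, hp.2.2.le.trans hy.2⟩
  have hK : KatIntegrable 1 ρ (fun s t => L (v s t)) x y :=
    (katIntegrable_of_bdd (M := ‖L‖ * M) one_pos one_pos hρ₁ hρ₂ hx.1 hy.1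
      (((L.continuous.comp_continuousOn hv).mono hsub).aestronglyMeasurable (measurableSet_rect x y))
      fun p hp => (L.le_opNorm _).trans (mul_le_mul_of_nonneg_left
        (hM _ (hsub hp).1 _ (hsub hp).2) (norm_nonneg _))).1
  refine ⟨hK, ?_⟩
  rw [← L.integral_comp_comm ((integrableOn_katPrim hρ₁ hρ₂ hv hM hy).2.mono_set
    (Ioc_subset_Ioc_right hx.2)), katInt, Measure.volume_eq_prod, setIntegral_prod _ hK,
    integral_Ioc_eq_integral_Ioo]
  refine setIntegral_congr_fun measurableSet_Ioo fun s hs => ?_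
  have hs' : s ∈ Ioc 0 a := ⟨hs.1, hs.2.le.trans hx.2⟩
  simp only [katPrim, map_smul, katKernel_one]
  rw [← L.integral_comp_comm ((integrableOn_smul_right hρ₂ hv hM hs').2.mono_set
    (Ioc_subset_Ioc_right hy.2)), integral_Ioc_eq_integral_Ioo, smul_eq_mul, ← integral_const_mul]
  refine setIntegral_congr_fun measurableSet_Ioo fun t ht => ?_
  simp only [map_smul, smul_eq_mul, mul_assoc]

end Iterated

/-- The integral of a bounded continuous function has this function as its derivative. -/
lemma hasKatDeriv_of_hasFuzzyKatInt {a b : ℝ} {φ ρ : ℝ × ℝ} (hφ₁ : φ.1 ∈ Ioo (0 : ℝ) 1)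
    (hφ₂ : φ.2 ∈ Ioo (0 : ℝ) 1) (hρ₁ : 0 < ρ.1) (hρ₂ : 0 < ρ.2) {g f : ℝ → ℝ → FuzzyNum}
    (hf : BddContOn a b f)
    (hg : ∀ x ∈ Ioc 0 a, ∀ y ∈ Ioc 0 b, HasFuzzyKatInt φ ρ f x y (g x y)) :
    HasKatDeriv a b φ ρ g f := by
  obtain ⟨hfc, M, hfM⟩ := hf
  set v : ℝ → ℝ → EndSpace := fun x y => ends (f x y)
  have hv : ContinuousOn (fun z : ℝ × ℝ => v z.1 z.2) (Ioc 0 a ×ˢ Ioc 0 b) :=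
    (contOn_iff f _).1 hfc
  have hM : ∀ x ∈ Ioc 0 a, ∀ y ∈ Ioc 0 b, ‖v x y‖ ≤ M := by
    intro x hx y hy
    have := hfM x hx y hy
    rwa [D_eq_norm, ends_zero, sub_zero] at this
  have hcone : ∀ x y, v x y ∈ endCone := fun x y => ends_mem_endCone _
  have hPcone := fun x (hx : x ∈ Ioc 0 a) y (hy : y ∈ Ioc 0 b) =>
    katPrim_mem_endCone (ρ := ρ) hρ₂ hv hM hcone hx hy
  -- The candidate for I^{1-φ} g, equal to I^1 f by the semigroup property, in a form that can be
  -- differentiated in `EndSpace`.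
  set UX : ℝ → ℝ → EndSpace := fun x y => ∫ s in Ioc 0 x, katPrim ρ v s y
  have hPi := fun y (hy : y ∈ Ioc 0 b) => integrableOn_katPrim hρ₁ hρ₂ hv hM hy
  have hUmono : ∀ y ∈ Ioc 0 b, ∀ u u' : ℝ, 0 ≤ u → u ≤ u' → u' ≤ a →
      UX u' y - UX u y ∈ endCone := by
    intro y hy u u' h0 h1 h2
    simp only [UX]
    rw [integral_Ioc_sub_integral_Ioc (hPi y hy).2 h0 h1 h2]
    exact integral_mem_endCone measurableSet_Ioc ((hPi y hy).2.mono_set (Ioc_subset_Ioc h0 h2))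
      fun s hs => hPcone s ⟨h0.trans_lt hs.1, hs.2.trans h2⟩ y hy
  have hUcone : ∀ x ∈ Ioc 0 a, ∀ y ∈ Ioc 0 b, UX x y ∈ endCone := by
    intro x hx y hy
    simpa [UX] using hUmono y hy 0 x le_rfl hx.1.le hx.2
  have eU : ∀ x ∈ Ioc 0 a, ∀ y ∈ Ioc 0 b, ends (ofEnds (UX x y)) = UX x y :=
    fun x hx y hy => ends_ofEnds (hUcone x hx y hy)
  have eP : ∀ x ∈ Ioc 0 a, ∀ y ∈ Ioc 0 b, ends (ofEnds (katPrim ρ v x y)) = katPrim ρ v x y :=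
    fun x hx y hy => ends_ofEnds (hPcone x hx y hy)
  have hpow : ∀ x ∈ Ioc 0 a, ∀ y ∈ Ioc 0 b, ∀ κ₁ κ₂ : ℝ, 0 < x ^ κ₁ * y ^ κ₂ :=
    fun x hx y hy κ₁ κ₂ => mul_pos (Real.rpow_pos_of_pos hx.1 _) (Real.rpow_pos_of_pos hy.1 _)
  refine ⟨fun x y => ofEnds (UX x y), fun x y => (x ^ (ρ.1 - 1) * y ^ (ρ.2 - 1)) • f x y,
    fun x hx y hy => ?_, ⟨?_, fun x y => ofEnds (katPrim ρ v x y), ?_, Or.inl fun x hx y hy => ?_,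
      Or.inl fun x hx y hy => ?_⟩, fun x hx y hy => ?_⟩
  -- A general functional covers both end points at once: L(g) = I^φ L(f) gives I^{1-φ} L(g) = I^1
  -- L(f) = L(UX).
  · have key : ∀ (L : EndSpace →L[ℝ] ℝ),
        (∀ s ∈ Ioc 0 a, ∀ t ∈ Ioc 0 b,
          L (ends (g s t)) = katInt φ ρ (fun s t => L (ends (f s t))) s t) →
        KatIntegrable (1 - φ) ρ (fun s t => L (ends (g s t))) x y ∧
          L (UX x y) = katInt (1 - φ) ρ (fun s t => L (ends (g s t))) x y := by
      intro L hL
      obtain ⟨h1, h2⟩ := apply_integral_katPrim hρ₁ hρ₂ hv hM L hx hy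
      obtain ⟨h3, h4⟩ := katInt_katInt (α := 1 - φ) (β := φ) (sub_pos.2 hφ₁.2) (sub_pos.2 hφ₂.2)
        hφ₁.1 hφ₂.1 hρ₁ hρ₂ (μ := fun s t => L (v s t)) (x := x) (y := y)
        (by rw [sub_add_cancel]; exact h1)
      have hmem : ∀ s ∈ Ioo 0 x, ∀ t ∈ Ioo 0 y,
          katInt φ ρ (fun s t => L (v s t)) s t = L (ends (g s t)) := fun s hs t ht =>
        (hL s ⟨hs.1, hs.2.le.trans hx.2⟩ t ⟨ht.1, ht.2.le.trans hy.2⟩).symm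
      refine ⟨IntegrableOn.congr_fun h3 (fun p hp => ?_) (measurableSet_rect x y), ?_⟩
      · simp only [hmem p.1 hp.1 p.2 hp.2]
      · rw [h2, ← katInt_congr hmem, h4, sub_add_cancel]
    have hr' : ∀ r (hr : r ∈ Icc (0 : ℝ) 1), _ := fun r hr =>
      And.intro (key (evalLo ⟨r, hr⟩) fun s hs t ht => ((hg s hs t ht).lo_hi hr).1)
        (key (evalHi ⟨r, hr⟩) fun s hs t ht => ((hg s hs t ht).lo_hi hr).2)
    refine ⟨fun r hr => ⟨(hr' r hr).1.1, (hr' r hr).2.1⟩, fun r hr => ?_⟩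
    have e1 := (hr' r hr).1.2
    have e2 := (hr' r hr).2.2
    rw [← eU x hx y hy] at e1 e2
    rw [level_eq_Icc _ hr.2]
    exact congrArg₂ Icc e1 e2
  · rw [contOn_iff]
    exact (continuousOn_integral_katPrim hρ₁ hρ₂ hv hM).congr fun z hz => eU _ hz.1 _ hz.2
  · rw [contOn_iff]
    exact (continuousOn_katPrim hρ₂ hv hM).congr fun z hz => eP _ hz.1 _ hz.2
  · refine hasGHDerivI_of_ends hx ?_ fun u hu u' hu' huu' => ?_
    · rw [eP x hx y hy]
      exact (hasDerivWithinAt_integral_Ioc (hPi y hy).1 (hPi y hy).2 hx).congr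
        (fun u hu => eU u hu y hy) (eU x hx y hy)
    · rw [eU u hu y hy, eU u' hu' y hy]
      exact hUmono y hy u u' hu.1.le huu' hu'.2
  · refine hasGHDerivI_of_ends hy ?_ fun u hu u' hu' huu' => ?_
    · rw [ends_smul (hpow x hx y hy _ _)]
      exact (hasDerivWithinAt_katPrim hρ₂ hv hM hx hy).congr
        (fun u hu => eP x hx u hu) (eP x hx y hy)
    · rw [eP x hx u hu, eP x hx u' hu']
      exact katPrim_sub_mem_endCone hρ₂ hv hM hcone hx hu.1.le huu' hu'.2
  · refine ends_injective ?_
    rw [ends_smul (hpow x hx y hy _ _), ends_smul (hpow x hx y hy _ _), smul_smul]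
    have e1 : x ^ (1 - ρ.1) * x ^ (ρ.1 - 1) = 1 := by rw [← Real.rpow_add hx.1]; simp
    have e2 : y ^ (1 - ρ.2) * y ^ (ρ.2 - 1) = 1 := by rw [← Real.rpow_add hy.1]; simp
    rw [mul_mul_mul_comm, e1, e2, one_mul, one_smul]

/-! ### From a Volterra equation back to the Darboux problem -/

lemma HasFuzzyKatInt.unique {α ρ : ℝ × ℝ} {f : ℝ → ℝ → FuzzyNum} {x y : ℝ} {J J' : FuzzyNum}
    (h : HasFuzzyKatInt α ρ f x y J) (h' : HasFuzzyKatInt α ρ f x y J') : J = J' :=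
  ext_level fun r hr => (h.2 r hr).trans (h'.2 r hr).symm

lemma hasBoundary_of_eq {a b : ℝ} (ha : 0 ≤ a) (hb : 0 ≤ b) {ξ₁ ξ₂ : ℝ → FuzzyNum}
    (hξ : ξ₁ 0 = ξ₂ 0) {h υ : ℝ → ℝ → FuzzyNum} (hh : IsDarbouxData a b ξ₁ ξ₂ h)
    (heq : ∀ x ∈ Icc 0 a, ∀ y ∈ Icc 0 b, x = 0 ∨ y = 0 → υ x y = h x y) :
    HasBoundary a b ξ₁ ξ₂ υ := by
  have ha' : (0 : ℝ) ∈ Icc 0 a := left_mem_Icc.2 ha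
  have hb' : (0 : ℝ) ∈ Icc 0 b := left_mem_Icc.2 hb
  exact ⟨fun x hx => (heq x hx 0 hb' (Or.inr rfl)).trans ((hh.boundary hξ hx hb').1 rfl),
    fun y hy => (heq 0 ha' y hy (Or.inl rfl)).trans ((hh.boundary hξ ha' hy).2 rfl)⟩

/-- The integrals in the equation, collected into one function g, are themselves the increments.
They vanish on the axes, which gives the boundary values, and their derivative is f. -/
lemma VolterraPlus.exists_incr {a b : ℝ} (ha : 0 < a) (hb : 0 < b) {φ ρ : ℝ × ℝ}
    (hφ₁ : φ.1 ∈ Ioo (0 : ℝ) 1) (hφ₂ : φ.2 ∈ Ioo (0 : ℝ) 1) (hρ₁ : 0 < ρ.1) (hρ₂ : 0 < ρ.2)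
    {ξ₁ ξ₂ : ℝ → FuzzyNum} (hξ : ξ₁ 0 = ξ₂ 0) {h υ f : ℝ → ℝ → FuzzyNum}
    (hh : IsDarbouxData a b ξ₁ ξ₂ h) (hf : BddContOn a b f)
    (hV : VolterraPlus a b φ ρ h f υ) : HasBoundary a b ξ₁ ξ₂ υ ∧
      ∃ g : ℝ → ℝ → FuzzyNum, (∀ x ∈ Ioc 0 a, ∀ y ∈ Ioc 0 b, IsIncrI υ g x y) ∧
        HasKatDeriv a b φ ρ g f := by
  have : Nonempty FuzzyNum := ⟨0⟩
  choose! g hg hgυ using hV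
  have hB : HasBoundary a b ξ₁ ξ₂ υ := by
    refine hasBoundary_of_eq ha.le hb.le hξ hh fun x hx y hy h0 => ?_
    rw [hgυ x hx y hy, (hg x hx y hy).unique (hasFuzzyKatInt_zero φ ρ f h0), fuzzy_add_zero]
  refine ⟨hB, g, fun x hx y hy => ?_, hasKatDeriv_of_hasFuzzyKatInt hφ₁ hφ₂ hρ₁ hρ₂ hf
    fun x hx y hy => hg x (Ioc_subset_Icc_self hx) y (Ioc_subset_Icc_self hy)⟩
  have hx' := Ioc_subset_Icc_self hx
  have hy' := Ioc_subset_Icc_self hy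
  exact ((hB.incr_iff hh hx' hy').1).2 (hgυ x hx' y hy')

/-- The derivative of the integral is built exactly as for the other equation; the minus sign enters
only through clause (ii) for the increment. -/
lemma VolterraMinus.exists_incr {a b : ℝ} (ha : 0 < a) (hb : 0 < b) {φ ρ : ℝ × ℝ}
    (hφ₁ : φ.1 ∈ Ioo (0 : ℝ) 1) (hφ₂ : φ.2 ∈ Ioo (0 : ℝ) 1) (hρ₁ : 0 < ρ.1) (hρ₂ : 0 < ρ.2)
    {ξ₁ ξ₂ : ℝ → FuzzyNum} (hξ : ξ₁ 0 = ξ₂ 0) {h υ f : ℝ → ℝ → FuzzyNum}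
    (hh : IsDarbouxData a b ξ₁ ξ₂ h) (hf : BddContOn a b f)
    (hV : VolterraMinus a b φ ρ h f υ) : HasBoundary a b ξ₁ ξ₂ υ ∧
      ∃ g : ℝ → ℝ → FuzzyNum, (∀ x ∈ Ioc 0 a, ∀ y ∈ Ioc 0 b, IsIncrII υ g x y) ∧
        HasKatDeriv a b φ ρ g f := by
  have : Nonempty FuzzyNum := ⟨0⟩
  choose! g hg hgυ using hV
  have hB : HasBoundary a b ξ₁ ξ₂ υ := by
    refine hasBoundary_of_eq ha.le hb.le hξ hh fun x hx y hy h0 => ?_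
    have h1 := hgυ x hx y hy
    have h2 := isHDiff_neg_zero (υ x y)
    rw [(hg x hx y hy).unique (hasFuzzyKatInt_zero φ ρ f h0)] at h1
    exact h2.trans h1.symm
  refine ⟨hB, g, fun x hx y hy => ?_, hasKatDeriv_of_hasFuzzyKatInt hφ₁ hφ₂ hρ₁ hρ₂ hf
    fun x hx y hy => hg x (Ioc_subset_Icc_self hx) y (Ioc_subset_Icc_self hy)⟩
  have hx' := Ioc_subset_Icc_self hx
  have hy' := Ioc_subset_Icc_self hy
  exact ((hB.incr_iff hh hx' hy').2).2 (hgυ x hx' y hy')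

end FuzzyNum

/-! ### The single and the coupled Darboux problem -/

theorem mainTheorem8 (a b : ℝ) (ha : 0 < a) (hb : 0 < b)
    (φ ρ : ℝ × ℝ) (hφ₁ : φ.1 ∈ Ioo (0 : ℝ) 1) (hφ₂ : φ.2 ∈ Ioo (0 : ℝ) 1)
    (hρ₁ : 0 < ρ.1) (hρ₂ : 0 < ρ.2)
    (ξ₁ ξ₂ : ℝ → FuzzyNum) (hξ : ξ₁ 0 = ξ₂ 0)
    (h : ℝ → ℝ → FuzzyNum) (hh : IsDarbouxData a b ξ₁ ξ₂ h) :
    -- the single problem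
    (∀ (F : ℝ → ℝ → FuzzyNum → FuzzyNum) (υ : ℝ → ℝ → FuzzyNum),
      ContOn υ (Icc 0 a ×ˢ Icc 0 b) →
      (KatIntegrableOn a b φ ρ (fun x y => F x y (υ x y)) →
        SolvesDarboux a b φ ρ F ξ₁ ξ₂ υ →
          VolterraPlus a b φ ρ h (fun x y => F x y (υ x y)) υ ∨
          VolterraMinus a b φ ρ h (fun x y => F x y (υ x y)) υ) ∧
      (BddContOn a b (fun x y => F x y (υ x y)) →
        (VolterraPlus a b φ ρ h (fun x y => F x y (υ x y)) υ ∨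
          VolterraMinus a b φ ρ h (fun x y => F x y (υ x y)) υ) →
        SolvesDarboux a b φ ρ F ξ₁ ξ₂ υ)) ∧
    -- the coupled problem
    (∀ (ψ : ℝ × ℝ), ψ.1 ∈ Ioo (0 : ℝ) 1 → ψ.2 ∈ Ioo (0 : ℝ) 1 →
      ∀ (η₁ η₂ : ℝ → FuzzyNum), η₁ 0 = η₂ 0 →
      ∀ (k : ℝ → ℝ → FuzzyNum), IsDarbouxData a b η₁ η₂ k →
      ∀ (F G : ℝ → ℝ → FuzzyNum → FuzzyNum → FuzzyNum) (υ ω : ℝ → ℝ → FuzzyNum),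
      ContOn υ (Icc 0 a ×ˢ Icc 0 b) → ContOn ω (Icc 0 a ×ˢ Icc 0 b) →
      (KatIntegrableOn a b φ ρ (fun x y => F x y (υ x y) (ω x y)) →
        KatIntegrableOn a b ψ ρ (fun x y => G x y (υ x y) (ω x y)) →
        SolvesCoupledDarboux a b φ ψ ρ F G ξ₁ ξ₂ η₁ η₂ υ ω →
          (VolterraPlus a b φ ρ h (fun x y => F x y (υ x y) (ω x y)) υ ∧
            VolterraPlus a b ψ ρ k (fun x y => G x y (υ x y) (ω x y)) ω) ∨
          (VolterraMinus a b φ ρ h (fun x y => F x y (υ x y) (ω x y)) υ ∧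
            VolterraMinus a b ψ ρ k (fun x y => G x y (υ x y) (ω x y)) ω)) ∧
      (BddContOn a b (fun x y => F x y (υ x y) (ω x y)) →
        BddContOn a b (fun x y => G x y (υ x y) (ω x y)) →
        ((VolterraPlus a b φ ρ h (fun x y => F x y (υ x y) (ω x y)) υ ∧
            VolterraPlus a b ψ ρ k (fun x y => G x y (υ x y) (ω x y)) ω) ∨
          (VolterraMinus a b φ ρ h (fun x y => F x y (υ x y) (ω x y)) υ ∧
            VolterraMinus a b ψ ρ k (fun x y => G x y (υ x y) (ω x y)) ω)) →
        SolvesCoupledDarboux a b φ ψ ρ F G ξ₁ ξ₂ η₁ η₂ υ ω)) := by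
  refine ⟨fun F υ hυ => ⟨fun hint hS => ?_, fun hf hV => ?_⟩,
    fun ψ hψ₁ hψ₂ η₁ η₂ hη k hk F G υ ω hυ hω => ⟨fun hintF hintG hS => ?_, fun hf he hV => ?_⟩⟩
  · obtain ⟨hB, g, hg, hd⟩ := hS
    obtain ⟨hI, hc₁, hc₂⟩ := hd.incr ha hb hφ₁ hφ₂ hρ₁ hρ₂ hυ hg hint
    obtain ⟨hv₁, hv₂⟩ := volterra_of_incr hξ hh hB hI
    -- The clause valid at the corner (a, b) selects the equation.
    exact (hg a (right_mem_Ioc.2 ha) b (right_mem_Ioc.2 hb)).imp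
      (fun hc => hv₁ (hc₁ hc)) fun hc => hv₂ (hc₂ hc)
  · rcases hV with hV | hV
    · obtain ⟨hB, g, hg, hd⟩ := hV.exists_incr ha hb hφ₁ hφ₂ hρ₁ hρ₂ hξ hh hf
      exact ⟨hB, g, fun x hx y hy => Or.inl (hg x hx y hy), hd⟩
    · obtain ⟨hB, g, hg, hd⟩ := hV.exists_incr ha hb hφ₁ hφ₂ hρ₁ hρ₂ hξ hh hf
      exact ⟨hB, g, fun x hx y hy => Or.inr (hg x hx y hy), hd⟩
  · obtain ⟨hB, hB', g, l, hgl, hd, hd'⟩ := hS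
    obtain ⟨hI, hc₁, hc₂⟩ := hd.incr ha hb hφ₁ hφ₂ hρ₁ hρ₂ hυ
      (fun x hx y hy => (hgl x hx y hy).imp And.left And.left) hintF
    obtain ⟨hI', hc₁', hc₂'⟩ := hd'.incr ha hb hψ₁ hψ₂ hρ₁ hρ₂ hω
      (fun x hx y hy => (hgl x hx y hy).imp And.right And.right) hintG
    obtain ⟨hv₁, hv₂⟩ := volterra_of_incr hξ hh hB hI
    obtain ⟨hv₁', hv₂'⟩ := volterra_of_incr hη hk hB' hI'
    -- At the corner one clause serves both components, so both satisfy the same type of equation.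
    exact (hgl a (right_mem_Ioc.2 ha) b (right_mem_Ioc.2 hb)).imp
      (fun hc => ⟨hv₁ (hc₁ hc.1), hv₁' (hc₁' hc.2)⟩) fun hc => ⟨hv₂ (hc₂ hc.1), hv₂' (hc₂' hc.2)⟩
  · rcases hV with ⟨hV, hV'⟩ | ⟨hV, hV'⟩
    · obtain ⟨hB, g, hg, hd⟩ := hV.exists_incr ha hb hφ₁ hφ₂ hρ₁ hρ₂ hξ hh hf
      obtain ⟨hB', l, hl, hd'⟩ := hV'.exists_incr ha hb hψ₁ hψ₂ hρ₁ hρ₂ hη hk he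
      exact ⟨hB, hB', g, l, fun x hx y hy => Or.inl ⟨hg x hx y hy, hl x hx y hy⟩, hd, hd'⟩
    · obtain ⟨hB, g, hg, hd⟩ := hV.exists_incr ha hb hφ₁ hφ₂ hρ₁ hρ₂ hξ hh hf
      obtain ⟨hB', l, hl, hd'⟩ := hV'.exists_incr ha hb hψ₁ hψ₂ hρ₁ hρ₂ hη hk he
      exact ⟨hB, hB', g, l, fun x hx y hy => Or.inr ⟨hg x hx y hy, hl x hx y hy⟩, hd, hd'⟩
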